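/- **Setting.** Intervals have real endpoints $s<f$; $I=(s,f)$ and $J=(s',f')$ are compatible if $f\le s'$ or $f'\le s$. Write $I\prec J$ if $I$ ends before $J$. Let $S$ be a finite set of $n$ intervals (a *part*) with pairwise distinct endpoints. $I\in S$ is *inactive* if it contains another interval of $S$, otherwise *active*. $\mathrm{LC}(I)$ is the earliest ending interval of $S$ that starts at or after the end of $I$. The greedy algorithm on $m$ machines considers the intervals of $S$ by increasing end; an interval $J$ is rejected if no machine is free at its start, and otherwise is assigned to the free machine that was busy up to the latest time. A machine state is an element $I$ (busy up to the end of $I$) or $\overline I$ (busy up to the start of $I$) with $I\in S$. An *entry state* is a multiset of $m$ elements $\overline{I}$, $I\in S$. A *greedy state* of the part is the multiset of the $m$ machine states at some time $t$ (when exactly the intervals ending at or before $t$ have been considered) of the greedy execution from some entry state. Elements are ordered by the time up to which they are busy. For elements $A\preceq B$, $\mathrm{FMR}(A,B)$ is the interval of $S$ (if any) that replaces $A$ when the greedy algorithm on two machines is resumed from the state $\{A,B\}$ at the time up to which $B$ is busy (if $A$ and $B$ are busy up to the same time, a tie is resolved in favour of the machine of $A$). A greedy state $G=\{I_1\preceq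 I_2\preceq\dots\preceq I_m\}$ is *compressible* if its latest element $I_m$ is an interval of $S$ (not an $\overline{I}$) and (a) $I_m$ is inactive, or (b) $I_m$ is active and $I_m=\mathrm{LC}(P)$ for some active interval $P$ that is itself an element of $G$, or (c) $I_m=\mathrm{FMR}(I_1,I_{m-1})$. **Model of computation.** Programs are finite first-order functional programs with recursive functions over values built from nil, stored reals and pairs; the operations (variable, nil, pairing, projections, local binding, test for a pair, comparison of two stored reals, function call) cost one step each. (Every step is a constant number of steps of a random access machine.) Natural numbers are output in binary. **Theorem.** 1. For every $m\ge 3$ there is a constant $C_m$ such that every part of $n$ intervals with pairwise distinct endpoints has at most $C_m n^{m-1}$ compressible greedy states on $m$ machines. 2. There are a program and constants $c,C$ such that for every $n$ and every list of $n$ distinct intervals with pairwise distinct endpoints the program outputs the table of $\mathrm{FMR}(I,J)$ for all pairs $I\prec J$ from the list in at most $C(n+2)^2\log^{c}(n+2)$ steps, i.e. in $\tilde O(n^2)$ time. 3. For every $m\ge 3$ there are a program and constants $c,C$ such that the program is a data structure, starting empty, that maintains a finite set $S$ of intervals (endpoints need not be distinct) under insertions of new intervals and deletions of present ones, reports after each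 update the largest number of intervals of $S$ that can be scheduled on $m$ machines (intervals on one machine being pairwise compatible), and takes $\tilde O(n^{1-1/m})$ amortized time per update: any sequence of $k$ updates takes at most $$C\sum_{i=1}^{k}(n_i+2)^{1-1/m}\log^{c}(n_i+2)$$ steps in total, where $n_i$ is the size of $S$ after the $i$-th update. -/

import Mathlib

noncomputable section

namespace DIS

/-! ### Intervals -/

/-- An interval (a job) with real endpoints. -/
@[ext]
structure Ival where
  start : ℝ
  finish : ℝ
  start_lt : start < finish

/-- The order `≺`: intervals are compared by their end (ties, which do not occur when endpoints are
pairwise distinct, are broken by the start). -/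
instance : LinearOrder Ival :=
  LinearOrder.lift' (fun I => toLex (I.finish, I.start)) (by
    intro I J h
    have h2 : (I.finish, I.start) = (J.finish, J.start) := toLex.injective h
    have h3 := Prod.mk.inj h2
    exact Ival.ext h3.2 h3.1)

/-- Two intervals are compatible if they do not overlap (touching is allowed). -/
def Compatible (I J : Ival) : Prop := I.finish ≤ J.start ∨ J.finish ≤ I.start

/-- The endpoints of all intervals in `S` are pairwise distinct. -/
def DistinctEndpoints (S : Finset Ival) : Prop :=
  ∀ I ∈ S, ∀ J ∈ S, I.start ≠ J.finish ∧ (I ≠ J → I.start ≠ J.start ∧ I.finish ≠ J.finish)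

/-- `I` contains another interval of `S`. -/
def ContainsOther (S : Finset Ival) (I : Ival) : Prop :=
  ∃ J ∈ S, J ≠ I ∧ I.start ≤ J.start ∧ J.finish ≤ I.finish

def Active (S : Finset Ival) (I : Ival) : Prop := I ∈ S ∧ ¬ ContainsOther S I

def Inactive (S : Finset Ival) (I : Ival) : Prop := I ∈ S ∧ ContainsOther S I

/-- `J = LC(I)` in the collection `S`: the earliest ending interval that starts at or after
the end of `I`. -/
def IsLC (S : Finset Ival) (I J : Ival) : Prop :=
  J ∈ S ∧ I.finish ≤ J.start ∧ ∀ K ∈ S, I.finish ≤ K.start → J.finish ≤ K.finish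

/-- A set of intervals can be scheduled on `m` machines: intervals on the same machine are
pairwise compatible. -/
def Schedulable (m : ℕ) (T : Finset Ival) : Prop :=
  ∃ σ : Ival → Fin m, ∀ I ∈ T, ∀ J ∈ T, I ≠ J → σ I = σ J → Compatible I J

open Classical in
/-- The largest number of intervals of `S` that can be scheduled on `m` machines. -/
def opt (m : ℕ) (S : Finset Ival) : ℕ := (S.powerset.filter (Schedulable m)).sup Finset.card

/-! ### The greedy algorithm on several machines and its states -/

/-- An element of a greedy state: `busy I` is a machine that is busy up to the end of `I`,
`bar I` (written `I` with an overline) is a machine that is busy up to the start of `I`. -/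
inductive Slot where
  | busy (I : Ival)
  | bar (I : Ival)

/-- The time up to which the machine is busy. -/
def Slot.time : Slot → ℝ
  | .busy I => I.finish
  | .bar I => I.start

/-- The machine to which the greedy algorithm assigns the interval `J`: among the machines that are
available at the start of `J`, one that was busy up to the latest time; `none` if no machine is
available, in which case `J` is rejected. -/
def chooseMachine {m : ℕ} (G : Fin m → Slot) (J : Ival) : Option (Fin m) :=
  ((List.finRange m).filter (fun i => (G i).time ≤ J.start)).argmax (fun i => (G i).time)

/-- The greedy algorithm considers one interval. -/
def step {m : ℕ} (G : Fin m → Slot) (J : Ival) : Fin m → Slot :=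
  match chooseMachine G J with
  | none => G
  | some i => Function.update G i (.busy J)

/-- The contents of the machines at time `t`, when the greedy algorithm is run on `S` from `E`:
the intervals ending at or before `t` have been considered, by increasing end. -/
def stateAt {m : ℕ} (S : Finset Ival) (E : Fin m → Slot) (t : ℝ) : Fin m → Slot :=
  ((S.filter (fun J => J.finish ≤ t)).sort).foldl step E

/-- An entry state of the part `S`: each machine is busy up to the start of some interval of the
part and has not accepted an interval of the part yet. -/
def IsEntry {m : ℕ} (S : Finset Ival) (E : Fin m → Slot) : Prop := ∀ i, ∃ I ∈ S, E i = .bar I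

/-- `G` is a greedy state of the part `S` on `m` machines: it is the multiset of machine contents at
some time of the greedy execution from some entry state. -/
def IsGreedyState (m : ℕ) (S : Finset Ival) (G : Multiset Slot) : Prop :=
  ∃ E : Fin m → Slot, IsEntry S E ∧ ∃ t : ℝ,
    G = (Finset.univ : Finset (Fin m)).val.map (stateAt S E t)

/-- The first interval of the list that the greedy algorithm on two machines assigns to
machine `0`. -/
def firstOnMachineZero : (Fin 2 → Slot) → List Ival → Option Ival
  | _, [] => none
  | G, J :: L => if chooseMachine G J = some 0 then some J else firstOnMachineZero (step G J) L

/-- First machine replacement: the interval of `S` that replaces `a` when the greedy algorithm is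
resumed, on two machines, from the state `{a, b}` (where `a` ends before `b`). -/
def FMR (S : Finset Ival) (a b : Slot) : Option Ival :=
  firstOnMachineZero ![a, b] ((S.filter (fun J => b.time < J.finish)).sort)

/-- A state `{I₁ ⪯ ... ⪯ Iₘ}` of the part `S` is compressible if its latest element `Iₘ` is an
interval `L` of the part that (a) is inactive, or (b) is active and equal to `LC(P)` for some
active element `P` of the state, or (c) is equal to `FMR(I₁, Iₘ₋₁)`. -/
def Compressible (S : Finset Ival) (G : Multiset Slot) : Prop :=
  ∃ l : List Slot, (l : Multiset Slot) = G ∧ l.Pairwise (fun a b => a.time ≤ b.time) ∧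
    ∃ L ∈ S, l.getLast? = some (.busy L) ∧
      (Inactive S L ∨
       (Active S L ∧ ∃ P, Slot.busy P ∈ G ∧ Active S P ∧ IsLC S P L) ∨
       (∃ a b, l.head? = some a ∧ l[l.length - 2]? = some b ∧ FMR S a b = some L))

/-! ### The model of computation

A first-order functional language over pairs (pure LISP). Programs are finite texts that contain no
numbers and no reals; a real can only be stored and compared with another real. Every evaluation
step costs one, and is a constant number of steps on a random access machine. -/

inductive Val where
  | nil
  | key (x : ℝ)
  | pair (a b : Val)

def Val.fst : Val → Val
  | .pair a _ => a
  | _ => .nil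

def Val.snd : Val → Val
  | .pair _ b => b
  | _ => .nil

def Val.IsPair : Val → Prop
  | .pair _ _ => True
  | _ => False

/-- Comparison of two stored reals; false if one of the values is not a real. -/
def Val.KeyLt : Val → Val → Prop
  | .key x, .key y => x < y
  | _, _ => False

/-- Expressions; variables are de Bruijn indices into the local environment. -/
inductive Term where
  | var (i : ℕ)
  | nil
  | pair (a b : Term)
  | fst (a : Term)
  | snd (a : Term)
  | bind (a b : Term)
  | ifPair (c a b : Term)
  | ifLt (x y a b : Term)
  | call (f : ℕ) (a : Term)

/-- A program: the list of the bodies of its (mutually recursive, unary) functions. -/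
abbrev Program := List Term

def Program.body (P : Program) (f : ℕ) : Term := P.getD f .nil

/-- `Eval P ρ e v t`: in the environment `ρ`, the expression `e` evaluates to `v` in exactly `t`
steps. -/
inductive Eval (P : Program) : List Val → Term → Val → ℕ → Prop where
  | var {ρ : List Val} {i : ℕ} : Eval P ρ (.var i) (ρ.getD i .nil) 1
  | nil {ρ : List Val} : Eval P ρ .nil .nil 1
  | pair {ρ : List Val} {a b : Term} {v w : Val} {t u : ℕ} :
      Eval P ρ a v t → Eval P ρ b w u → Eval P ρ (.pair a b) (.pair v w) (t + u + 1)
  | fst {ρ : List Val} {a : Term} {v : Val} {t : ℕ} :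
      Eval P ρ a v t → Eval P ρ (.fst a) v.fst (t + 1)
  | snd {ρ : List Val} {a : Term} {v : Val} {t : ℕ} :
      Eval P ρ a v t → Eval P ρ (.snd a) v.snd (t + 1)
  | bind {ρ : List Val} {a b : Term} {v w : Val} {t u : ℕ} :
      Eval P ρ a v t → Eval P (v :: ρ) b w u → Eval P ρ (.bind a b) w (t + u + 1)
  | ifPair_true {ρ : List Val} {c a b : Term} {v w : Val} {t u : ℕ} :
      Eval P ρ c v t → v.IsPair → Eval P ρ a w u → Eval P ρ (.ifPair c a b) w (t + u + 1)
  | ifPair_false {ρ : List Val} {c a b : Term} {v w : Val} {t u : ℕ} :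
      Eval P ρ c v t → ¬ v.IsPair → Eval P ρ b w u → Eval P ρ (.ifPair c a b) w (t + u + 1)
  | ifLt_true {ρ : List Val} {x y a b : Term} {v v' w : Val} {t t' u : ℕ} :
      Eval P ρ x v t → Eval P ρ y v' t' → v.KeyLt v' → Eval P ρ a w u →
      Eval P ρ (.ifLt x y a b) w (t + t' + u + 1)
  | ifLt_false {ρ : List Val} {x y a b : Term} {v v' w : Val} {t t' u : ℕ} :
      Eval P ρ x v t → Eval P ρ y v' t' → ¬ v.KeyLt v' → Eval P ρ b w u →
      Eval P ρ (.ifLt x y a b) w (t + t' + u + 1)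
  | call {ρ : List Val} {f : ℕ} {a : Term} {v w : Val} {t u : ℕ} :
      Eval P ρ a v t → Eval P [v] (P.body f) w u → Eval P ρ (.call f a) w (t + u + 1)

/-- The main function (number `0`) of `P`, applied to `x`, returns `y` in exactly `t` steps. -/
def Computes (P : Program) (x y : Val) (t : ℕ) : Prop := Eval P [x] (P.body 0) y t

/-! ### Encodings -/

def encList {α : Type} (enc : α → Val) (l : List α) : Val :=
  l.foldr (fun a v => .pair (enc a) v) .nil

def encBool : Bool → Val
  | false => .nil
  | true => .pair .nil .nil

/-- Natural numbers in binary, least significant bit first. -/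
def encNat (n : ℕ) : Val := encList encBool n.bits

def encIval (I : Ival) : Val := .pair (.key I.start) (.key I.finish)

def encOption : Option Ival → Val
  | none => .nil
  | some I => encIval I

def encEntry (x : Ival × Ival × Option Ival) : Val :=
  .pair (encIval x.1) (.pair (encIval x.2.1) (encOption x.2.2))

/-! ### The dynamic problem -/

inductive Update where
  | insert (I : Ival)
  | delete (I : Ival)

def encUpdate : Update → Val
  | .insert I => .pair (encBool true) (encIval I)
  | .delete I => .pair (encBool false) (encIval I)

def Update.apply : Update → Finset Ival → Finset Ival
  | .insert I, S => Insert.insert I S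
  | .delete I, S => S.erase I

/-- Only new intervals are inserted and only present ones are deleted. -/
def Update.Valid : Update → Finset Ival → Prop
  | .insert I, S => I ∉ S
  | .delete I, S => I ∈ S

def ValidSeq : Finset Ival → List Update → Prop
  | _, [] => True
  | S, u :: us => u.Valid S ∧ ValidSeq (u.apply S) us

/-- The sets of intervals after each of the updates. -/
def history : Finset Ival → List Update → List (Finset Ival)
  | _, [] => []
  | S, u :: us => u.apply S :: history (u.apply S) us

/-- `Serves P σ us as T`: the data structure `P`, whose current content is `σ`, performs the updates
`us` one after another and reports the values `as` after them, in `T` steps altogether. For each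
update the main function receives the update and the content, and returns the reported value and the
new content. -/
inductive Serves (P : Program) : Val → List Update → List Val → ℕ → Prop where
  | nil {σ : Val} : Serves P σ [] [] 0
  | cons {σ σ' a : Val} {u : Update} {us : List Update} {as : List Val} {t T : ℕ} :
      Computes P (.pair (encUpdate u) σ) (.pair a σ') t → Serves P σ' us as T →
      Serves P σ (u :: us) (a :: as) (t + T)

end DIS

end

/-! Counting. In a compressible state one element is a function of at most two of the others. In
cases (b) and (c) it is the latest element, equal to `LC(P)` or to `FMR(I₁, Iₘ₋₁)`. In case (a) the
latest element `L` contains other intervals, and the last ending one of them is itself in the state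
(`mem_state_of_contained`). So a state is encoded by `m - 1` of its elements, each from `2n`
candidates, by the positions of the determining elements and by which rule applies
(`exists_determined`).

Table of replacements. Fix `I`, and let `K` be the first interval ending after `J` that starts at or
after the end of `I`. If `K` starts before the end of `J`, it replaces `I`; otherwise it goes on top
of `J`, and the answer is that of the pair `(I, K)`. A scan from the latest interval backwards that
remembers `K` and its answer fills one row in linear time (`fmrScan_spec`).

Dynamic scheduling. Greedy by increasing end with best fit is optimal, so its number of accepted
intervals has to be maintained. A state with `F` accepted intervals is replaced by its profile, `F`
plus the number of machines free at `x`. One greedy step acts on profiles by a (min,+)-linear map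
(`profile_greedyStep`), and the profile of any state is the minimum of `m` shifted profiles of
uniform states, in which all machines are busy up to the same time `d`. The action of a block of
intervals is therefore known from its action on uniform states (`applyBlock_spec`). That action
depends only on which intervals start at or after `d`, so a block of `s` intervals has `s + 1` rows,
computable in `Õ(s²)` steps and kept in a search tree. A minimum of two profiles is again the
profile of a state (`join_spec`), so passing a block costs polylogarithmic time for fixed `m`.

Blocks of size about `n^(1/3)` give about `n^(2/3)` blocks. An update recomputes one block and then
passes all of them, at a cost of `Õ(n^(2/3))`. Everything is rebuilt after about `n^(2/3)` updates,
which a potential function pays for. Since `m ≥ 3`, the exponent `2/3` is at most `1 - 1/m`.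

Running times are verified through a weakest precondition calculus, `Wp`, in which each function
call is replaced by an upper bound on its time. -/

noncomputable section

namespace DIS

set_option linter.unusedSimpArgs false

/-! ### Weakest preconditions for the model of computation -/

/-- `Runs P f x y T`: function `f` of the program, applied to `x`, returns `y` in at most `T`
steps. -/
def Runs (P : Program) (f : ℕ) (x y : Val) (T : ℕ) : Prop :=
  ∃ t ≤ T, Eval P [x] (P.body f) y t

/-- Weakest precondition: evaluating the term in the environment yields a value and a number of
steps that satisfy `Q`. -/
def Wp (P : Program) : Term → List Val → (Val → ℕ → Prop) → Prop
  | .var i, ρ, Q => Q (ρ.getD i .nil) 1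
  | .nil, _, Q => Q .nil 1
  | .pair a b, ρ, Q => Wp P a ρ fun v t => Wp P b ρ fun w u => Q (.pair v w) (t + u + 1)
  | .fst a, ρ, Q => Wp P a ρ fun v t => Q v.fst (t + 1)
  | .snd a, ρ, Q => Wp P a ρ fun v t => Q v.snd (t + 1)
  | .bind a b, ρ, Q => Wp P a ρ fun v t => Wp P b (v :: ρ) fun w u => Q w (t + u + 1)
  | .ifPair c a b, ρ, Q => Wp P c ρ fun v t =>
      (v.IsPair → Wp P a ρ fun w u => Q w (t + u + 1)) ∧
      (¬ v.IsPair → Wp P b ρ fun w u => Q w (t + u + 1))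
  | .ifLt x y a b, ρ, Q => Wp P x ρ fun v t => Wp P y ρ fun v' t' =>
      (v.KeyLt v' → Wp P a ρ fun w u => Q w (t + t' + u + 1)) ∧
      (¬ v.KeyLt v' → Wp P b ρ fun w u => Q w (t + t' + u + 1))
  | .call f a, ρ, Q => Wp P a ρ fun v t =>
      ∃ w T, Runs P f v w T ∧ ∀ u ≤ T, Q w (t + u + 1)

/-- Structural induction on the expression suffices: `Wp` does not unfold a call but asks for a
`Runs` fact about it. Recursive functions are then verified by an outer induction on their
arguments, with `Runs` as the induction hypothesis. -/
theorem Wp.sound {P : Program} {e : Term} {ρ : List Val} {Q : Val → ℕ → Prop}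
    (h : Wp P e ρ Q) : ∃ v t, Eval P ρ e v t ∧ Q v t := by
  induction e generalizing ρ Q with
  | var i => exact ⟨_, _, .var, h⟩
  | nil => exact ⟨_, _, .nil, h⟩
  | pair a b iha ihb =>
    obtain ⟨v, t, h1, h2⟩ := iha h
    obtain ⟨w, u, h3, h4⟩ := ihb h2
    exact ⟨_, _, .pair h1 h3, h4⟩
  | fst a iha =>
    obtain ⟨v, t, h1, h2⟩ := iha h
    exact ⟨_, _, .fst h1, h2⟩
  | snd a iha =>
    obtain ⟨v, t, h1, h2⟩ := iha h
    exact ⟨_, _, .snd h1, h2⟩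
  | bind a b iha ihb =>
    obtain ⟨v, t, h1, h2⟩ := iha h
    obtain ⟨w, u, h3, h4⟩ := ihb h2
    exact ⟨_, _, .bind h1 h3, h4⟩
  | ifPair c a b ihc iha ihb =>
    obtain ⟨v, t, h1, h2⟩ := ihc h
    by_cases hv : v.IsPair
    · obtain ⟨w, u, h3, h4⟩ := iha (h2.1 hv)
      exact ⟨_, _, .ifPair_true h1 hv h3, h4⟩
    · obtain ⟨w, u, h3, h4⟩ := ihb (h2.2 hv)
      exact ⟨_, _, .ifPair_false h1 hv h3, h4⟩
  | ifLt x y a b ihx ihy iha ihb =>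
    obtain ⟨v, t, h1, h2⟩ := ihx h
    obtain ⟨v', t', h1', h2⟩ := ihy h2
    by_cases hv : v.KeyLt v'
    · obtain ⟨w, u, h3, h4⟩ := iha (h2.1 hv)
      exact ⟨_, _, .ifLt_true h1 h1' hv h3, h4⟩
    · obtain ⟨w, u, h3, h4⟩ := ihb (h2.2 hv)
      exact ⟨_, _, .ifLt_false h1 h1' hv h3, h4⟩
  | call f a iha =>
    obtain ⟨v, t, h1, w, T, ⟨u, hu, h3⟩, h4⟩ := iha h
    exact ⟨_, _, .call h1 h3, h4 u hu⟩

theorem Runs.of_wp {P : Program} {f : ℕ} {x y : Val} {T : ℕ}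
    (h : Wp P (P.body f) [x] fun v t => v = y ∧ t ≤ T) : Runs P f x y T := by
  obtain ⟨v, t, h1, rfl, h2⟩ := h.sound
  exact ⟨t, h2, h1⟩

theorem Runs.computes {P : Program} {x y : Val} {T : ℕ} (h : Runs P 0 x y T) :
    ∃ t ≤ T, Computes P x y t := h

@[simp] theorem Val.fst_pair (a b : Val) : (Val.pair a b).fst = a := rfl

@[simp] theorem Val.snd_pair (a b : Val) : (Val.pair a b).snd = b := rfl

@[simp] theorem Val.fst_nil : Val.nil.fst = .nil := rfl

@[simp] theorem Val.snd_nil : Val.nil.snd = .nil := rfl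

@[simp] theorem Val.isPair_pair (a b : Val) : (Val.pair a b).IsPair = True := rfl

@[simp] theorem Val.isPair_nil : Val.nil.IsPair = False := rfl

@[simp] theorem Val.keyLt_key (x y : ℝ) : (Val.key x).KeyLt (.key y) = (x < y) := rfl

@[simp] theorem Val.keyLt_nil_left (v : Val) : Val.nil.KeyLt v = False := rfl

@[simp] theorem Val.keyLt_nil_right (v : Val) : v.KeyLt .nil = False := by cases v <;> rfl

@[simp] theorem encList_nil {α : Type} (enc : α → Val) : encList enc [] = .nil := rfl

@[simp] theorem encList_cons {α : Type} (enc : α → Val) (a : α) (l : List α) :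
    encList enc (a :: l) = .pair (enc a) (encList enc l) := rfl

/-! ### The order on intervals -/

theorem Ival.le_iff {I J : Ival} :
    I ≤ J ↔ I.finish < J.finish ∨ I.finish = J.finish ∧ I.start ≤ J.start := by
  show toLex (I.finish, I.start) ≤ toLex (J.finish, J.start) ↔ _
  exact Prod.Lex.toLex_le_toLex

theorem Ival.lt_iff {I J : Ival} :
    I < J ↔ I.finish < J.finish ∨ I.finish = J.finish ∧ I.start < J.start := by
  show toLex (I.finish, I.start) < toLex (J.finish, J.start) ↔ _
  exact Prod.Lex.toLex_lt_toLex

theorem Ival.finish_le_of_le {I J : Ival} (h : I ≤ J) : I.finish ≤ J.finish := by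
  rcases Ival.le_iff.1 h with h | h
  exacts [h.le, h.1.le]

theorem DistinctEndpoints.finish_lt_iff {S : Finset Ival} (hS : DistinctEndpoints S) {I J : Ival}
    (hI : I ∈ S) (hJ : J ∈ S) : I.finish < J.finish ↔ I < J := by
  rw [Ival.lt_iff]
  refine ⟨Or.inl, ?_⟩
  rintro (h | ⟨h, h'⟩)
  · exact h
  · have hne : I ≠ J := by rintro rfl; exact lt_irrefl _ h'
    exact absurd h ((hS I hI J hJ).2 hne).2

/-! ### A program for the first machine replacement of all pairs -/

open Classical in
/-- Insertion into a list that is sorted by the ends of the intervals. -/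
def insertByFinish (J : Ival) : List Ival → List Ival
  | [] => [J]
  | K :: L => if K.finish < J.finish then K :: insertByFinish J L else J :: K :: L

def sortByFinish : List Ival → List Ival
  | [] => []
  | J :: L => insertByFinish J (sortByFinish L)

theorem insertByFinish_perm (J : Ival) (L : List Ival) : (insertByFinish J L).Perm (J :: L) := by
  induction L with
  | nil => exact .refl _
  | cons K L ih =>
    unfold insertByFinish
    split_ifs
    · exact (ih.cons K).trans (.swap _ _ _)
    · exact .refl _

theorem sortByFinish_perm (L : List Ival) : (sortByFinish L).Perm L := by
  induction L with
  | nil => exact .refl _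
  | cons J L ih => exact (insertByFinish_perm _ _).trans (ih.cons J)

theorem insertByFinish_sorted (J : Ival) {L : List Ival}
    (hL : L.Pairwise (fun I K => I.finish ≤ K.finish)) :
    (insertByFinish J L).Pairwise (fun I K => I.finish ≤ K.finish) := by
  induction L with
  | nil => simp [insertByFinish]
  | cons K L ih =>
    rw [List.pairwise_cons] at hL
    unfold insertByFinish
    split_ifs with h
    · refine List.pairwise_cons.2 ⟨fun I hI => ?_, ih hL.2⟩
      rcases List.mem_cons.1 ((insertByFinish_perm J L).mem_iff.1 hI) with rfl | hI
      exacts [h.le, hL.1 I hI]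
    · rw [not_lt] at h
      refine List.pairwise_cons.2 ⟨fun I hI => ?_, List.pairwise_cons.2 hL⟩
      rcases List.mem_cons.1 hI with rfl | hI
      exacts [h, h.trans (hL.1 I hI)]

theorem sortByFinish_sorted (L : List Ival) :
    (sortByFinish L).Pairwise (fun I K => I.finish ≤ K.finish) := by
  induction L with
  | nil => exact .nil
  | cons J L ih => exact insertByFinish_sorted J ih

/-- The entries of the table in the row of `I`, for a list of the intervals that end after `I`,
followed by `acc`, the first interval of the list that starts after the end of `I`, and the interval
that replaces `I` once that interval is on the other machine. -/
def fmrScan (I : Ival) (acc : List (Ival × Ival × Option Ival)) :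
    List Ival → List (Ival × Ival × Option Ival) × Option Ival × Option Ival
  | [] => (acc, none, none)
  | J :: L =>
    let s := fmrScan I acc L
    let v := open Classical in s.2.1.elim none fun K => if K.start < J.finish then some K else s.2.2
    ((I, J, v) :: s.1, open Classical in if J.start < I.finish then s.2 else (some J, v))

def fmrTable : List Ival → List (Ival × Ival × Option Ival)
  | [] => []
  | I :: L => (fmrScan I (fmrTable L) L).1

/-- Functions 1 and 2 are insertion sort, 3 is the backward scan of one row (argument: row interval,
remaining list, accumulated table) and 4 builds the table row by row. Quadratic sorting is
affordable because the table itself has quadratic size. -/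
def fmrProgram : Program :=
  [ .call 4 (.call 2 (.var 0)),
    .ifPair (.snd (.var 0))
      (.ifLt (.snd (.fst (.snd (.var 0)))) (.snd (.fst (.var 0)))
        (.pair (.fst (.snd (.var 0))) (.call 1 (.pair (.fst (.var 0)) (.snd (.snd (.var 0))))))
        (.var 0))
      (.pair (.fst (.var 0)) .nil),
    .ifPair (.var 0) (.call 1 (.pair (.fst (.var 0)) (.call 2 (.snd (.var 0))))) .nil,
    .ifPair (.fst (.snd (.var 0)))
      (.bind (.call 3 (.pair (.fst (.var 0))
          (.pair (.snd (.fst (.snd (.var 0)))) (.snd (.snd (.var 0))))))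
        (.bind (.ifPair (.fst (.snd (.var 0)))
            (.ifLt (.fst (.fst (.snd (.var 0)))) (.snd (.fst (.fst (.snd (.var 1)))))
              (.fst (.snd (.var 0))) (.snd (.snd (.var 0))))
            .nil)
          (.pair (.pair (.pair (.fst (.var 2)) (.pair (.fst (.fst (.snd (.var 2)))) (.var 0)))
              (.fst (.var 1)))
            (.ifLt (.fst (.fst (.fst (.snd (.var 2))))) (.snd (.fst (.var 2)))
              (.snd (.var 1)) (.pair (.fst (.fst (.snd (.var 2)))) (.var 0))))))
      (.pair (.snd (.snd (.var 0))) (.pair .nil .nil)),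
    .ifPair (.var 0)
      (.fst (.call 3 (.pair (.fst (.var 0)) (.pair (.snd (.var 0)) (.call 4 (.snd (.var 0)))))))
      .nil ]

theorem runs_insertByFinish (J : Ival) (L : List Ival) :
    Runs fmrProgram 1 (.pair (encIval J) (encList encIval L))
      (encList encIval (insertByFinish J L)) (30 * (L.length + 1)) := by
  induction L with
  | nil => exact .of_wp (by simp [Program.body, fmrProgram, Wp, insertByFinish])
  | cons K L ih =>
    refine .of_wp ?_
    simp [Program.body, fmrProgram, Wp, insertByFinish, encIval]
    refine ⟨fun h => ⟨_, _, ih, fun u hu => ?_⟩, fun h => ?_⟩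
    · rw [if_pos h]; exact ⟨rfl, by omega⟩
    · rw [if_neg (not_lt.2 h)]; exact ⟨rfl, by omega⟩

theorem runs_sortByFinish (L : List Ival) :
    Runs fmrProgram 2 (encList encIval L)
      (encList encIval (sortByFinish L)) (50 * (L.length + 1) ^ 2) := by
  induction L with
  | nil => exact .of_wp (by simp [Program.body, fmrProgram, Wp, sortByFinish])
  | cons K L ih =>
    refine .of_wp ?_
    simp [Program.body, fmrProgram, Wp]
    refine ⟨_, _, ih, fun u hu => ⟨_, _, runs_insertByFinish K _, fun u' hu' => ⟨rfl, ?_⟩⟩⟩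
    rw [(sortByFinish_perm L).length_eq] at hu'
    nlinarith

theorem runs_fmrScan (I : Ival) (acc : List (Ival × Ival × Option Ival)) (L : List Ival) :
    Runs fmrProgram 3 (.pair (encIval I) (.pair (encList encIval L) (encList encEntry acc)))
      (.pair (encList encEntry (fmrScan I acc L).1)
        (.pair (encOption (fmrScan I acc L).2.1) (encOption (fmrScan I acc L).2.2)))
      (100 * (L.length + 1)) := by
  induction L with
  | nil => exact .of_wp (by simp [Program.body, fmrProgram, Wp, fmrScan, encOption])
  | cons J L ih =>
    refine .of_wp ?_
    simp only [fmrScan]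
    generalize fmrScan I acc L = s at ih ⊢
    obtain ⟨tab, K, R⟩ := s
    simp [Program.body, fmrProgram, Wp]
    refine ⟨_, _, ih, fun u hu => ?_⟩
    rcases K with _ | K
    · simp [encOption, encIval, encEntry]
      refine ⟨fun h => ?_, fun h => ?_⟩
      · rw [if_pos h]; simp; omega
      · rw [if_neg (not_lt.2 h)]; simp [encOption, encIval]; omega
    · simp [encOption, encIval, encEntry]
      refine ⟨fun h => ⟨fun h' => ?_, fun h' => ?_⟩, fun h => ⟨fun h' => ?_, fun h' => ?_⟩⟩
      · rw [if_pos h, if_pos h']; simp [encOption, encIval]; omega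
      · rw [if_pos h, if_neg (not_lt.2 h')]; simp [encOption, encIval]; omega
      · rw [if_neg (not_lt.2 h), if_pos h']; simp [encOption, encIval]; omega
      · rw [if_neg (not_lt.2 h), if_neg (not_lt.2 h')]; simp [encOption, encIval]; omega

theorem runs_fmrTable (L : List Ival) :
    Runs fmrProgram 4 (encList encIval L)
      (encList encEntry (fmrTable L)) (150 * (L.length + 1) ^ 2) := by
  induction L with
  | nil => exact .of_wp (by simp [Program.body, fmrProgram, Wp, fmrTable])
  | cons K L ih =>
    refine .of_wp ?_
    simp [Program.body, fmrProgram, Wp]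
    refine ⟨_, _, ih, fun u hu => ⟨_, _, runs_fmrScan K _ _, fun u' hu' => ⟨rfl, ?_⟩⟩⟩
    nlinarith

theorem runs_fmrProgram (L : List Ival) :
    Runs fmrProgram 0 (encList encIval L)
      (encList encEntry (fmrTable (sortByFinish L))) (300 * (L.length + 1) ^ 2) := by
  refine .of_wp ?_
  simp [Program.body, fmrProgram, Wp]
  refine ⟨_, _, runs_sortByFinish L, fun u hu => ⟨_, _, runs_fmrTable _, fun u' hu' => ⟨rfl, ?_⟩⟩⟩
  rw [(sortByFinish_perm L).length_eq] at hu'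
  have := Nat.one_le_pow 2 (L.length + 1) (by omega)
  omega

/-! ### Correctness of the table of first machine replacements -/

theorem chooseMachine_two (a b : Slot) (h : a.time < b.time) (K : Ival) :
    (b.time ≤ K.start → chooseMachine ![a, b] K = some 1) ∧
    (¬ b.time ≤ K.start → a.time ≤ K.start → chooseMachine ![a, b] K = some 0) ∧
    (¬ b.time ≤ K.start → ¬ a.time ≤ K.start → chooseMachine ![a, b] K = none) := by
  have e : List.finRange 2 = [0, 1] := rfl
  unfold chooseMachine
  rw [e]
  refine ⟨fun h1 => ?_, fun h1 h2 => ?_, fun h1 h2 => ?_⟩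
  · have h2 : a.time ≤ K.start := h.le.trans h1
    simp [List.filter, h1, h2, List.argmax, List.argAux, h]
  · simp [List.filter, h1, h2, List.argmax, List.argAux]
  · simp [List.filter, h1, h2, List.argmax, List.argAux]

open Classical in
-- Best fit prefers the machine of `J`, which is busy longer; the machine of `I` is touched only by
-- an interval that starts between the two ends.
theorem firstOnMachineZero_cons {I J : Ival} (h : I.finish < J.finish) (K : Ival) (L : List Ival) :
    firstOnMachineZero ![.busy I, .busy J] (K :: L) =
      if J.finish ≤ K.start then firstOnMachineZero ![.busy I, .busy K] L
      else if I.finish ≤ K.start then some K else firstOnMachineZero ![.busy I, .busy J] L := by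
  obtain ⟨c1, c2, c3⟩ := chooseMachine_two (.busy I) (.busy J) h K
  have e : Function.update ![Slot.busy I, Slot.busy J] 1 (Slot.busy K) = ![.busy I, .busy K] := by
    ext i; fin_cases i <;> simp
  by_cases h1 : J.finish ≤ K.start
  · simp [firstOnMachineZero, step, c1 h1, e, h1]
  · by_cases h2 : I.finish ≤ K.start
    · simp [firstOnMachineZero, c2 h1 h2, h1, h2]
    · simp [firstOnMachineZero, step, c3 h1 h2, h1, h2]

/-- Intervals that start before the end of `I` are rejected whatever `J` is, so the first relevant
interval `K` does not depend on `J`. The remembered second value is the answer for the state `{I,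
K}` on the rest of the list, which is needed exactly when `K` lands on the machine of `J`.
Quantifying over all `J` allows the induction hypothesis to be used for `K` as well. -/
theorem fmrScan_spec (I : Ival) (acc : List (Ival × Ival × Option Ival)) (L : List Ival)
    (hL : ∀ J ∈ L, I.finish < J.finish) (J : Ival) (hJ : I.finish < J.finish) :
    firstOnMachineZero ![.busy I, .busy J] L =
      open Classical in (fmrScan I acc L).2.1.elim none fun K =>
        if K.start < J.finish then some K else (fmrScan I acc L).2.2 := by
  induction L generalizing J with
  | nil => rfl
  | cons K L ih =>
    rw [List.forall_mem_cons] at hL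
    rw [firstOnMachineZero_cons hJ, ih hL.2 J hJ, ih hL.2 K hL.1]
    simp only [fmrScan]
    by_cases h1 : K.start < I.finish
    · have h2 : ¬ J.finish ≤ K.start := by linarith
      simp [h1, h2]
    · by_cases h2 : J.finish ≤ K.start
      · simp [h1, h2]
      · simp [h1, h2, not_lt.1 h1, not_le.1 h2]

theorem fmrScan_table (I : Ival) (acc : List (Ival × Ival × Option Ival)) (L : List Ival)
    (hL : ∀ J ∈ L, I.finish < J.finish) (hs : L.Pairwise (· < ·)) :
    (fmrScan I acc L).1 = L.map (fun J => (I, J,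
      firstOnMachineZero ![.busy I, .busy J] (L.filter (J < ·)))) ++ acc := by
  induction L with
  | nil => rfl
  | cons J L ih =>
    rw [List.forall_mem_cons] at hL
    rw [List.pairwise_cons] at hs
    have e : ∀ K ∈ L, (J :: L).filter (K < ·) = L.filter (K < ·) := fun K hK => by
      rw [List.filter_cons_of_neg]
      simpa using (hs.1 K hK).le
    have e' : (J :: L).filter (J < ·) = L := by
      rw [List.filter_cons_of_neg (by simp), List.filter_eq_self]
      simpa using hs.1
    simp only [fmrScan, List.map_cons, e', List.cons_append, List.cons.injEq]
    refine ⟨by rw [fmrScan_spec I acc L hL.2 J hL.1], ?_⟩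
    rw [ih hL.2 hs.2]
    congr 1
    exact List.map_congr_left fun K hK => by rw [e K hK]

theorem mem_fmrTable (L : List Ival) (hs : L.Pairwise (· < ·))
    (hf : ∀ I ∈ L, ∀ J ∈ L, I < J → I.finish < J.finish)
    (I J : Ival) (R : Option Ival) :
    (I, J, R) ∈ fmrTable L ↔ I ∈ L ∧ J ∈ L ∧ I < J ∧
      R = firstOnMachineZero ![.busy I, .busy J] (L.filter (J < ·)) := by
  induction L with
  | nil => simp [fmrTable]
  | cons K L ih =>
    have hs' := List.pairwise_cons.1 hs
    have hf' : ∀ J ∈ L, K.finish < J.finish := fun J hJ =>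
      hf K (by simp) J (by simp [hJ]) (hs'.1 J hJ)
    have e : ∀ J ∈ L, (K :: L).filter (J < ·) = L.filter (J < ·) := fun J hJ => by
      rw [List.filter_cons_of_neg]
      simpa using (hs'.1 J hJ).le
    rw [fmrTable, fmrScan_table K _ L hf' hs'.2, List.mem_append, List.mem_map,
      ih hs'.2 fun I hI J hJ => hf I (by simp [hI]) J (by simp [hJ])]
    constructor
    · rintro (⟨J', hJ', h⟩ | ⟨h1, h2, h3, h4⟩)
      · simp only [Prod.mk.injEq] at h
        obtain ⟨rfl, rfl, rfl⟩ := h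
        exact ⟨by simp, by simp [hJ'], hs'.1 _ hJ', by rw [e _ hJ']⟩
      · exact ⟨by simp [h1], by simp [h2], h3, by rw [h4, e J h2]⟩
    · rintro ⟨h1, h2, h3, h4⟩
      have hJ : J ∈ L := by
        rcases List.mem_cons.1 h2 with rfl | h
        · rcases List.mem_cons.1 h1 with rfl | h
          exacts [absurd h3 (lt_irrefl _), absurd h3 (hs'.1 I h).not_gt]
        · exact h
      rw [e J hJ] at h4
      rcases List.mem_cons.1 h1 with rfl | h
      · exact Or.inl ⟨J, hJ, by rw [h4]⟩
      · exact Or.inr ⟨h, hJ, h3, h4⟩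

theorem fmrTable_nodup (L : List Ival) (hs : L.Pairwise (· < ·))
    (hf : ∀ I ∈ L, ∀ J ∈ L, I < J → I.finish < J.finish) : (fmrTable L).Nodup := by
  induction L with
  | nil => exact .nil
  | cons K L ih =>
    have hs' := List.pairwise_cons.1 hs
    have hf' : ∀ J ∈ L, K.finish < J.finish := fun J hJ =>
      hf K (by simp) J (by simp [hJ]) (hs'.1 J hJ)
    have hf'' : ∀ I ∈ L, ∀ J ∈ L, I < J → I.finish < J.finish :=
      fun I hI J hJ => hf I (by simp [hI]) J (by simp [hJ])
    rw [fmrTable, fmrScan_table K _ L hf' hs'.2]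
    refine List.Nodup.append ?_ (ih hs'.2 hf'') ?_
    · refine List.Nodup.map (fun J J' h => ?_) (hs'.2.imp ne_of_lt)
      exact (Prod.mk.inj (Prod.mk.inj h).2).1
    · rintro ⟨I, J, R⟩ h h'
      rw [mem_fmrTable L hs'.2 hf''] at h'
      obtain ⟨J', -, h⟩ := List.mem_map.1 h
      obtain rfl : K = I := (Prod.mk.inj h).1
      exact lt_irrefl _ (hs'.1 K h'.1)

theorem exists_fmr_program :
    ∃ (P : Program) (c : ℕ) (C : ℝ), ∀ l : List Ival, l.Nodup →
      DistinctEndpoints l.toFinset →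
      ∃ (table : List (Ival × Ival × Option Ival)) (T : ℕ),
        Computes P (encList encIval l) (encList encEntry table) T ∧
        table.Nodup ∧
        (∀ (I J : Ival) (R : Option Ival), (I, J, R) ∈ table ↔
          I ∈ l ∧ J ∈ l ∧ I < J ∧ R = FMR l.toFinset (.busy I) (.busy J)) ∧
        (T : ℝ) ≤ C * ((l.length : ℝ) + 2) ^ 2 * Real.log ((l.length : ℝ) + 2) ^ c := by
  -- No logarithm is lost, hence the exponent `0`.
  refine ⟨fmrProgram, 0, 300, fun l hl hd => ?_⟩
  obtain ⟨T, hT, h⟩ := (runs_fmrProgram l).computes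
  have hp := sortByFinish_perm l
  have hf : ∀ I ∈ sortByFinish l, ∀ J ∈ sortByFinish l, I < J → I.finish < J.finish :=
    fun I hI J hJ => (hd.finish_lt_iff (by simpa using hp.mem_iff.1 hI)
      (by simpa using hp.mem_iff.1 hJ)).2
  have hs : (sortByFinish l).Pairwise (· < ·) := by
    have h1 := (sortByFinish_sorted l).and (hp.nodup_iff.2 hl)
    refine h1.imp_of_mem fun {I J} hI hJ h => ?_
    rw [← hd.finish_lt_iff (by simpa using hp.mem_iff.1 hI) (by simpa using hp.mem_iff.1 hJ)]
    exact lt_of_le_of_ne h.1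
      ((hd I (by simpa using hp.mem_iff.1 hI) J (by simpa using hp.mem_iff.1 hJ)).2 h.2).2
  refine ⟨_, T, h, fmrTable_nodup _ hs hf, fun I J R => ?_, ?_⟩
  · rw [mem_fmrTable _ hs hf, hp.mem_iff, hp.mem_iff]
    refine and_congr_right fun hI => and_congr_right fun hJ => and_congr_right fun hIJ => ?_
    have e : (sortByFinish l).filter (J < ·) =
        (l.toFinset.filter (fun K => (Slot.busy J).time < K.finish)).sort := by
      have hs1 : ((sortByFinish l).filter (J < ·)).Pairwise (· ≤ ·) :=
        (hs.imp le_of_lt).filter _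
      refine List.Perm.eq_of_pairwise' (r := (· ≤ ·)) hs1 (Finset.pairwise_sort _ _) ?_
      refine (List.perm_ext_iff_of_nodup ((hs.imp ne_of_lt).filter _)
        (Finset.sort_nodup _ _)).2 fun K => ?_
      rw [List.mem_filter, Finset.mem_sort, Finset.mem_filter, List.mem_toFinset,
        hp.mem_iff, decide_eq_true_eq]
      exact and_congr_right fun hK => (hd.finish_lt_iff (by simpa) (by simpa)).symm
    rw [FMR, e]
  · have : (T : ℝ) ≤ 300 * ((l.length : ℝ) + 1) ^ 2 := by exact_mod_cast hT
    have h0 : (0 : ℝ) ≤ l.length := by positivity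
    rw [pow_zero, mul_one]
    nlinarith

/-! ### Compressible greedy states -/

theorem time_le_of_chooseMachine {m : ℕ} {G : Fin m → Slot} {J : Ival} {i : Fin m}
    (h : chooseMachine G J = some i) : (G i).time ≤ J.start := by
  have := List.argmax_mem h
  simpa using (List.mem_filter.1 this).2

theorem exists_chooseMachine {m : ℕ} {G : Fin m → Slot} {J : Ival} {i : Fin m}
    (h : (G i).time ≤ J.start) : ∃ j, chooseMachine G J = some j := by
  by_contra! h'
  have h2 : chooseMachine G J = none := by
    cases h3 : chooseMachine G J with
    | none => rfl
    | some j => exact absurd h3 (h' j)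
  have h3 : (List.finRange m).filter (fun i => (G i).time ≤ J.start) = [] := List.argmax_eq_none.1 h2
  have h4 : i ∈ (List.finRange m).filter (fun i => (G i).time ≤ J.start) :=
    List.mem_filter.2 ⟨List.mem_finRange i, by simpa using h⟩
  rw [h3] at h4
  exact absurd h4 List.not_mem_nil

theorem step_of_some {m : ℕ} {G : Fin m → Slot} {J : Ival} {i : Fin m}
    (h : chooseMachine G J = some i) : step G J = Function.update G i (.busy J) := by
  rw [step, h]

theorem step_of_none {m : ℕ} {G : Fin m → Slot} {J : Ival}
    (h : chooseMachine G J = none) : step G J = G := by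
  rw [step, h]

theorem step_eq_or {m : ℕ} (G : Fin m → Slot) (J : Ival) (i : Fin m) :
    step G J i = G i ∨ step G J i = .busy J ∧ (G i).time ≤ J.start := by
  cases h : chooseMachine G J with
  | none => exact Or.inl (by rw [step_of_none h])
  | some j =>
    rw [step_of_some h]
    by_cases hij : i = j
    · subst hij
      exact Or.inr ⟨by simp, time_le_of_chooseMachine h⟩
    · exact Or.inl (by simp [hij])

theorem foldl_step_eq_or {m : ℕ} (G : Fin m → Slot) (l : List Ival) (i : Fin m) :
    l.foldl step G i = G i ∨ ∃ J ∈ l, l.foldl step G i = .busy J := by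
  induction l generalizing G with
  | nil => exact Or.inl rfl
  | cons J l ih =>
    rw [List.foldl_cons]
    rcases ih (step G J) with h | ⟨K, hK, h⟩
    · rcases step_eq_or G J i with h' | h'
      · exact Or.inl (h.trans h')
      · exact Or.inr ⟨J, by simp, h.trans h'.1⟩
    · exact Or.inr ⟨K, by simp [hK], h⟩

theorem time_le_foldl_step {m : ℕ} (G : Fin m → Slot) (l : List Ival) (i : Fin m) :
    (G i).time ≤ (l.foldl step G i).time := by
  induction l generalizing G with
  | nil => exact le_rfl
  | cons J l ih =>
    refine le_trans ?_ (ih (step G J))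
    rcases step_eq_or G J i with h | ⟨h, h'⟩
    · rw [h]
    · rw [h]
      exact h'.trans J.start_lt.le

theorem foldl_step_eq_of_lt {m : ℕ} (G : Fin m → Slot) (l : List Ival) (i : Fin m)
    (h : ∀ J ∈ l, J.start < (G i).time) : l.foldl step G i = G i := by
  induction l generalizing G with
  | nil => rfl
  | cons J l ih =>
    rw [List.forall_mem_cons] at h
    have e : step G J i = G i := by
      rcases step_eq_or G J i with h' | ⟨-, h'⟩
      · exact h'
      · exact absurd h.1 h'.not_gt
    rw [List.foldl_cons, ih _ (by rw [e]; exact h.2), e]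

/-- If the latest element of a greedy state contains another interval, then the last ending
interval that it contains belongs to the state. -/
theorem mem_state_of_contained {m : ℕ} {S : Finset Ival} (hS : DistinctEndpoints S)
    {E : Fin m → Slot} (hE : IsEntry S E) {t : ℝ} {L K : Ival} {i₀ : Fin m}
    (hL : L ∈ S) (hLG : stateAt S E t i₀ = .busy L)
    (hmax : ∀ i, (stateAt S E t i).time ≤ L.finish)
    (hK : K ∈ S) (hKL : K ≠ L) (hs : L.start ≤ K.start) (hf : K.finish ≤ L.finish)
    (hlast : ∀ J ∈ S, J ≠ L → L.start ≤ J.start → J.finish ≤ L.finish → J.finish ≤ K.finish) :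
    ∃ i, stateAt S E t i = .busy K := by
  set l := (S.filter (fun J => J.finish ≤ t)).sort with hl
  have hst : stateAt S E t = l.foldl step E := rfl
  rw [hst] at hLG hmax ⊢
  have hmem : ∀ J, J ∈ l ↔ J ∈ S ∧ J.finish ≤ t := fun J => by simp [hl]
  have hsort : l.Pairwise (· < ·) := Finset.sortedLT_sort _ |>.pairwise
  have hEbusy : ∀ i J, E i ≠ .busy J := fun i J h => by
    obtain ⟨I, -, h'⟩ := hE i
    rw [h'] at h
    exact Slot.noConfusion h
  have hLl : L ∈ l := by
    rcases foldl_step_eq_or E l i₀ with h | ⟨J, hJ, h⟩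
    · exact absurd (h.symm.trans hLG) (hEbusy _ _)
    · rw [hLG] at h
      cases h
      exact hJ
  have hKltL : K < L := (hS.finish_lt_iff hK hL).1 (lt_of_le_of_ne hf ((hS K hK L hL).2 hKL).2)
  have hKl : K ∈ l := (hmem K).2 ⟨hK, hf.trans ((hmem L).1 hLl).2⟩
  obtain ⟨a, r, har⟩ := List.append_of_mem hLl
  have hsort' := hsort
  rw [har, List.pairwise_append, List.pairwise_cons] at hsort'
  have hKa : K ∈ a := by
    rw [har] at hKl
    rcases List.mem_append.1 hKl with h | h
    · exact h
    · rcases List.mem_cons.1 h with h | h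
      · exact absurd h hKL
      · exact absurd (hsort'.2.1.1 K h) hKltL.not_gt
  obtain ⟨p, q, hpq⟩ := List.append_of_mem hKa
  have hsa := hsort'.1
  rw [hpq, List.pairwise_append, List.pairwise_cons] at hsa
  set G1 := p.foldl step E with hG1
  set G2 := step G1 K with hG2
  set G3 := q.foldl step G2 with hG3
  set G4 := step G3 L with hG4
  have hG3a : G3 = a.foldl step E := by rw [hpq, List.foldl_append, List.foldl_cons]
  have hG5 : l.foldl step E = r.foldl step G4 := by
    rw [har, List.foldl_append, ← hG3a, List.foldl_cons]
  have hLr : L ∉ r := fun h => lt_irrefl _ (hsort'.2.1.1 L h)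
  have hLa : L ∉ a := fun h => lt_irrefl _ (hsort'.2.2 L h L (by simp))
  -- `L` must have been accepted at its own turn: it occurs only once in the list, and an entry
  -- state contains no `busy` element.
  obtain ⟨i, hi⟩ : ∃ i, chooseMachine G3 L = some i := by
    cases h : chooseMachine G3 L with
    | some i => exact ⟨i, rfl⟩
    | none =>
      exfalso
      rw [hG5] at hLG
      rcases foldl_step_eq_or G4 r i₀ with h1 | ⟨J, hJ, h1⟩
      · rw [hG4, step_of_none h, hG3a] at h1
        rcases foldl_step_eq_or E a i₀ with h2 | ⟨J, hJ, h2⟩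
        · exact hEbusy i₀ L (by rw [← h2, ← h1, ← hLG, hG4, step_of_none h, hG3a])
        · rw [← h1, ← hG3a, ← step_of_none h, ← hG4, hLG] at h2
          cases h2
          exact hLa hJ
      · rw [hLG] at h1
        cases h1
        exact hLr hJ
  have hti := time_le_of_chooseMachine hi
  -- The machine that will take `L` is free at the start of `L`. Busy times only grow, so it was
  -- already free at the start of `K`, and `K` is accepted.
  obtain ⟨j, hj⟩ : ∃ j, chooseMachine G1 K = some j := by
    refine exists_chooseMachine (i := i) (le_trans ?_ (hti.trans hs))
    have := time_le_foldl_step G1 (K :: q) i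
    rwa [List.foldl_cons] at this
  have h2 : G2 j = .busy K := by rw [hG2, step_of_some hj]; simp
  -- An interval considered between `K` and `L` that starts after `K` ends would lie inside `L` and
  -- end later than `K`, against the choice of `K`.
  have h3 : G3 j = .busy K := by
    rw [hG3, foldl_step_eq_of_lt G2 q j, h2]
    intro J hJ
    rw [h2]
    by_contra! h
    have hJa : J ∈ a := by rw [hpq]; simp [hJ]
    have hJS : J ∈ S := ((hmem J).1 (by rw [har]; simp [hJa])).1
    have hJL : J < L := hsort'.2.2 J hJa L (by simp)
    have hKJ : K < J := hsa.2.1.1 J hJ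
    have h4 := hlast J hJS hJL.ne (hs.trans (K.start_lt.le.trans h))
      ((hS.finish_lt_iff hJS hL).2 hJL).le
    exact absurd ((hS.finish_lt_iff hK hJS).2 hKJ) h4.not_gt
  have h4 : G4 j = .busy K := by
    rw [hG4, step_of_some hi]
    have hij : j ≠ i := by
      rintro rfl
      rw [h3] at hti
      exact absurd hti (not_le.2 (hs.trans_lt K.start_lt))
    simp [hij, h3]
  refine ⟨j, ?_⟩
  -- A later interval on machine `j` would end after `L`, but `L` is the latest element of the
  -- state.
  rcases foldl_step_eq_or G4 r j with h | ⟨J, hJ, h⟩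
  · rw [hG5, h, h4]
  · have h5 := hmax j
    rw [hG5, h] at h5
    have hJS : J ∈ S := ((hmem J).1 (by rw [har]; simp [hJ])).1
    exact absurd ((hS.finish_lt_iff hL hJS).2 (hsort'.2.1.1 J hJ)) (not_lt.2 h5)

/-! ### Encoding a compressible state by `m - 1` of its elements -/

open Classical in
/-- The elements of the greedy states of a part. -/
def slots (S : Finset Ival) : Finset Slot := S.image .busy ∪ S.image .bar

theorem card_slots_le (S : Finset Ival) : (slots S).card ≤ 2 * S.card := by
  classical
  refine (Finset.card_union_le _ _).trans ?_
  have h1 := Finset.card_image_le (s := S) (f := Slot.busy)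
  have h2 := Finset.card_image_le (s := S) (f := Slot.bar)
  omega

theorem stateAt_mem_slots {m : ℕ} {S : Finset Ival} {E : Fin m → Slot} (hE : IsEntry S E) (t : ℝ)
    (i : Fin m) : stateAt S E t i ∈ slots S := by
  classical
  rcases foldl_step_eq_or E (S.filter (fun J => J.finish ≤ t)).sort i with h | ⟨J, hJ, h⟩
  · obtain ⟨I, hI, h'⟩ := hE i
    rw [stateAt, h, h']
    simp [slots, hI]
  · rw [stateAt, h]
    simp only [Finset.mem_sort, Finset.mem_filter] at hJ
    simp [slots, hJ.1]

open Classical in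
/-- The last ending interval contained in an interval. -/
def lastContained (S : Finset Ival) : Slot → Slot
  | .busy L => if h : ∃ K ∈ S, K ≠ L ∧ L.start ≤ K.start ∧ K.finish ≤ L.finish ∧
      ∀ J ∈ S, J ≠ L → L.start ≤ J.start → J.finish ≤ L.finish → J.finish ≤ K.finish
    then .busy h.choose else .busy L
  | s => s

open Classical in
/-- The earliest ending interval that starts after the end of an interval. -/
def leftCompatible (S : Finset Ival) : Slot → Slot
  | .busy P => if h : ∃ L, IsLC S P L then .busy h.choose else .busy P
  | s => s

/-- The first machine replacement as an element of a state. -/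
def fmrSlot (S : Finset Ival) (a b : Slot) : Slot := (FMR S a b).elim a .busy

/-- The element of a compressible state that is determined by (one or two of) the others. -/
def determined (S : Finset Ival) (k : Fin 3) (a b : Slot) : Slot :=
  if k = 0 then lastContained S a else if k = 1 then leftCompatible S a else fmrSlot S a b

/-- In cases (b) and (c) the latest element is removed and recovered from the rest. In case (a) the
latest element stays and the last interval contained in it is removed; this one is recovered from
the latest element. -/
theorem exists_determined {m : ℕ} (hm : 3 ≤ m) {S : Finset Ival} (hS : DistinctEndpoints S)
    {G : Multiset Slot} (hG : IsGreedyState m S G) (hc : Compressible S G) :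
    ∃ (H : Multiset Slot) (k : Fin 3) (a b : Slot), a ∈ H ∧ b ∈ H ∧ G = determined S k a b ::ₘ H := by
  classical
  obtain ⟨E, hE, t, hGE⟩ := hG
  obtain ⟨l, hlG, hsort, L, hL, hlast, hcase⟩ := hc
  have hlen : l.length = m := by
    have := congrArg Multiset.card (hlG.trans hGE)
    simpa using this
  have hne : l ≠ [] := by rintro rfl; simp at hlast
  have hl : l = l.dropLast ++ [.busy L] := (List.dropLast_append_getLast? _ hlast).symm
  have hGH : G = .busy L ::ₘ (l.dropLast : Multiset Slot) := by
    rw [← hlG]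
    conv_lhs => rw [hl]
    rw [← Multiset.coe_add, Multiset.add_comm]
    rfl
  have hdl : l.dropLast.length = m - 1 := by simp [hlen]
  rcases hcase with hin | ⟨-, P, hP, -, hPL⟩ | ⟨a, b, ha, hb, hab⟩
  · obtain ⟨-, J, hJS, hJL, hJs, hJf⟩ := hin
    have hmaxG : ∀ x ∈ G, x.time ≤ L.finish := fun x hx => by
      rw [← hlG, Multiset.mem_coe, hl, List.mem_append, List.mem_singleton] at hx
      rcases hx with hx | rfl
      · rw [hl, List.pairwise_append] at hsort
        exact hsort.2.2 x hx _ (List.mem_singleton_self _)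
      · exact le_rfl
    have hex : ∃ K ∈ S, K ≠ L ∧ L.start ≤ K.start ∧ K.finish ≤ L.finish ∧
        ∀ J ∈ S, J ≠ L → L.start ≤ J.start → J.finish ≤ L.finish → J.finish ≤ K.finish := by
      obtain ⟨K, hK, hKmax⟩ := Finset.exists_max_image
        (S.filter fun J => J ≠ L ∧ L.start ≤ J.start ∧ J.finish ≤ L.finish) Ival.finish
        ⟨J, by simp [hJS, hJL, hJs, hJf]⟩
      simp only [Finset.mem_filter] at hK hKmax
      exact ⟨K, hK.1, hK.2.1, hK.2.2.1, hK.2.2.2, fun J h1 h2 h3 h4 => hKmax J ⟨h1, h2, h3, h4⟩⟩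
    obtain ⟨h1, h2, h3, h4, h5⟩ := hex.choose_spec
    have hmemG : ∀ x, x ∈ G ↔ ∃ i, stateAt S E t i = x := fun x => by simp [hGE]
    obtain ⟨i₀, hi₀⟩ := (hmemG (.busy L)).1 (by rw [hGH]; simp)
    obtain ⟨i, hi⟩ := mem_state_of_contained hS hE hL hi₀
      (fun i => hmaxG _ ((hmemG _).2 ⟨i, rfl⟩)) h1 h2 h3 h4 h5
    have hKG := (hmemG _).2 ⟨i, hi⟩
    have hLH : Slot.busy L ∈ G.erase (.busy hex.choose) := by
      rw [Multiset.mem_erase_of_ne]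
      · rw [hGH]; simp
      · intro h
        exact h2 (Slot.busy.inj h).symm
    refine ⟨G.erase (.busy hex.choose), 0, .busy L, .busy L, hLH, hLH, ?_⟩
    rw [determined, if_pos rfl, lastContained, dif_pos hex, Multiset.cons_erase hKG]
  · have hPH : Slot.busy P ∈ (l.dropLast : Multiset Slot) := by
      rw [hGH, Multiset.mem_cons] at hP
      rcases hP with h | h
      · cases h
        exact absurd hPL.2.1 (not_le.2 L.start_lt)
      · exact h
    refine ⟨l.dropLast, 1, .busy P, .busy P, hPH, hPH, ?_⟩
    have hex : ∃ L, IsLC S P L := ⟨L, hPL⟩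
    have e : hex.choose = L := by
      obtain ⟨h1, h2, h3⟩ := hex.choose_spec
      have h4 := le_antisymm (h3 L hPL.1 hPL.2.1) (hPL.2.2 _ h1 h2)
      by_contra hne
      exact ((hS _ h1 L hPL.1).2 hne).2 h4
    rw [determined, if_neg (by decide), if_pos rfl, leftCompatible, dif_pos hex, e, hGH]
  · have haH : a ∈ l.dropLast := by
      rw [List.mem_iff_getElem?]
      refine ⟨0, ?_⟩
      rw [List.getElem?_dropLast, if_pos (by omega), ← ha, List.head?_eq_getElem?]
    have hbH : b ∈ l.dropLast := by
      -- Index `l.length - 2` survives the removal of the last entry, so `Iₘ₋₁` is among the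
      -- retained elements.
      rw [List.mem_iff_getElem?]
      exact ⟨l.length - 2, by rw [List.getElem?_dropLast, if_pos (by omega), hb]⟩
    refine ⟨l.dropLast, 2, a, b, haH, hbH, ?_⟩
    rw [determined, if_neg (by decide), if_neg (by decide), fmrSlot, hab, hGH]
    rfl

theorem encard_compressible_le (m : ℕ) (hm : 3 ≤ m) :
    ∃ C : ℕ, ∀ S : Finset Ival, DistinctEndpoints S →
      {G : Multiset Slot | IsGreedyState m S G ∧ Compressible S G}.encard
        ≤ ((C * S.card ^ (m - 1) : ℕ) : ℕ∞) := by
  classical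
  -- Three rules, two positions among the `m - 1` retained elements, and at most `2n` values for
  -- each retained element.
  refine ⟨3 * ((m - 1) * (m - 1)) * 2 ^ (m - 1), fun S hS => ?_⟩
  let Φ : Fin 3 × (Fin (m - 1) × Fin (m - 1)) × (Fin (m - 1) → slots S) → Multiset Slot := fun x =>
    determined S x.1 (x.2.2 x.2.1.1) (x.2.2 x.2.1.2) ::ₘ
      (Finset.univ : Finset (Fin (m - 1))).val.map fun i => (x.2.2 i : Slot)
  have hsub : {G : Multiset Slot | IsGreedyState m S G ∧ Compressible S G} ⊆ Φ '' Set.univ := by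
    rintro G ⟨hG, hc⟩
    obtain ⟨H, k, a, b, ha, hb, e⟩ := exists_determined hm hS hG hc
    obtain ⟨E, hE, t, hGE⟩ := hG
    have hcard : Multiset.card H = m - 1 := by
      have h1 : Multiset.card G = m := by simp [hGE]
      rw [e, Multiset.card_cons] at h1
      omega
    have hslots : ∀ x ∈ H, x ∈ slots S := fun x hx => by
      have : x ∈ G := by rw [e]; exact Multiset.mem_cons_of_mem hx
      rw [hGE, Multiset.mem_map] at this
      obtain ⟨i, -, rfl⟩ := this
      exact stateAt_mem_slots hE t i
    obtain ⟨l, rfl⟩ := Quot.exists_rep H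
    change (l : Multiset Slot).card = m - 1 at hcard
    rw [Multiset.coe_card] at hcard
    change a ∈ l at ha
    change b ∈ l at hb
    obtain ⟨i, hi, rfl⟩ := List.getElem_of_mem ha
    obtain ⟨j, hj, rfl⟩ := List.getElem_of_mem hb
    refine ⟨(k, (⟨i, hcard ▸ hi⟩, ⟨j, hcard ▸ hj⟩),
      fun x => ⟨l[x.1]'(by omega), hslots _ (List.getElem_mem _)⟩), trivial, ?_⟩
    simp only [Φ]
    rw [e]
    congr 1
    have hofFn : ∀ (k : ℕ) (h : l.length = k),
        (Finset.univ : Finset (Fin k)).val.map (fun i => l[i.1]'(by omega)) = (l : Multiset Slot) := by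
      rintro _ rfl
      rw [Fin.univ_val_map, List.ofFn_getElem]
    exact hofFn _ hcard
  refine (Set.encard_le_encard hsub).trans ((Set.encard_image_le _ _).trans ?_)
  rw [Set.encard_univ, ENat.card_eq_coe_fintype_card, Nat.cast_le]
  simp only [Fintype.card_prod, Fintype.card_fin, Fintype.card_fun, Fintype.card_coe]
  calc 3 * ((m - 1) * (m - 1) * (slots S).card ^ (m - 1))
      ≤ 3 * ((m - 1) * (m - 1) * (2 * S.card) ^ (m - 1)) := by
        gcongr
        exact card_slots_le S
    _ = _ := by rw [mul_pow]; ring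

/-! ### Profiles of the greedy algorithm

A state of the greedy algorithm is a pair `(F, R)` of the number of accepted intervals and the list
of the times up to which the machines are busy, in descending order (`⊥` at the beginning). Its
profile sends `x` to `F` plus the number of machines that are free at `x`. -/

/-- Number of entries of `R` that are at most `x`. -/
def countLE (R : List EReal) (x : WithBot EReal) : ℕ :=
  open Classical in R.countP fun r : EReal => decide ((r : WithBot EReal) ≤ x)

@[simp] theorem countLE_nil (x : WithBot EReal) : countLE [] x = 0 := rfl

open Classical in
theorem countLE_cons (r : EReal) (R : List EReal) (x : WithBot EReal) :
    countLE (r :: R) x = countLE R x + if (r : WithBot EReal) ≤ x then 1 else 0 := by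
  simp [countLE, List.countP_cons]

theorem countLE_perm {R R' : List EReal} (h : R.Perm R') (x : WithBot EReal) :
    countLE R x = countLE R' x := by
  unfold countLE
  exact h.countP_eq _

@[simp] theorem countLE_bot (R : List EReal) : countLE R ⊥ = 0 := by
  induction R with
  | nil => rfl
  | cons r R ih => simp [countLE_cons, ih]

theorem countLE_le_length (R : List EReal) (x : WithBot EReal) : countLE R x ≤ R.length := by
  unfold countLE
  exact List.countP_le_length

theorem countLE_mono (R : List EReal) {x y : WithBot EReal} (h : x ≤ y) :
    countLE R x ≤ countLE R y := by
  unfold countLE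
  exact List.countP_mono_left fun r _ hr => by
    simp only [decide_eq_true_eq] at hr ⊢
    exact hr.trans h

theorem countLE_eq_length {R : List EReal} {x : WithBot EReal}
    (h : ∀ r ∈ R, (r : WithBot EReal) ≤ x) : countLE R x = R.length := by
  unfold countLE
  exact List.countP_eq_length.2 fun r hr => by simpa using h r hr

theorem countLE_eq_zero {R : List EReal} {x : WithBot EReal}
    (h : ∀ r ∈ R, x < (r : WithBot EReal)) : countLE R x = 0 := by
  unfold countLE
  exact List.countP_eq_zero.2 fun r hr => by simpa using h r hr

/-- `WithBot` adds a point below every time, including the initial time `⊥` of `EReal`. No machine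
is free there, so the profile at this point is the number of accepted intervals. -/
def profile (s : ℕ × List EReal) (x : WithBot EReal) : ℕ := s.1 + countLE s.2 x

theorem profile_mk (F : ℕ) (R : List EReal) (x : WithBot EReal) :
    profile (F, R) x = F + countLE R x := rfl

/-- The start of an interval as an argument of profiles. -/
def Ival.a (J : Ival) : WithBot EReal := ((J.start : EReal) : WithBot EReal)

/-- The end of an interval as an argument of profiles. -/
def Ival.b (J : Ival) : WithBot EReal := ((J.finish : EReal) : WithBot EReal)

theorem Ival.a_lt_b (J : Ival) : J.a < J.b :=
  WithBot.coe_lt_coe.2 (EReal.coe_lt_coe_iff.2 J.start_lt)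

open Classical in
/-- The action of the greedy algorithm on profiles. It is (min,+)-linear. -/
def transfer (m : ℕ) (h : WithBot EReal → ℕ) (J : Ival) (x : WithBot EReal) : ℕ :=
  if J.b ≤ x then m + min (h ⊥ + 1) (h J.a)
  else if J.a ≤ x then h x else min (h x + 1) (h J.a)

theorem transfer_of_le {m : ℕ} {h : WithBot EReal → ℕ} {J : Ival} {x : WithBot EReal}
    (hx : J.b ≤ x) : transfer m h J x = m + min (h ⊥ + 1) (h J.a) := if_pos hx

theorem transfer_of_mid {m : ℕ} {h : WithBot EReal → ℕ} {J : Ival} {x : WithBot EReal}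
    (hx : x < J.b) (hx' : J.a ≤ x) : transfer m h J x = h x := by
  rw [transfer, if_neg hx.not_ge, if_pos hx']

theorem transfer_of_lt {m : ℕ} {h : WithBot EReal → ℕ} {J : Ival} {x : WithBot EReal}
    (hx : x < J.a) : transfer m h J x = min (h x + 1) (h J.a) := by
  rw [transfer, if_neg (hx.trans J.a_lt_b).not_ge, if_neg hx.not_ge]

/-- With `foldl_transfer_add` this is the (min,+)-linearity: each value of `transfer m h J` is a
minimum of values of `h` shifted by constants. -/
theorem foldl_transfer_min (m : ℕ) (L : List Ival) (g h : WithBot EReal → ℕ) :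
    L.foldl (transfer m) (fun x => min (g x) (h x)) =
      fun x => min (L.foldl (transfer m) g x) (L.foldl (transfer m) h x) := by
  induction L generalizing g h with
  | nil => rfl
  | cons J L ih =>
    rw [List.foldl_cons, List.foldl_cons, List.foldl_cons, ← ih]
    congr 1
    funext x
    unfold transfer
    dsimp only
    split_ifs <;> omega

theorem foldl_transfer_add (m c : ℕ) (L : List Ival) (h : WithBot EReal → ℕ) :
    L.foldl (transfer m) (fun x => c + h x) = fun x => c + L.foldl (transfer m) h x := by
  induction L generalizing h with
  | nil => rfl
  | cons J L ih =>
    rw [List.foldl_cons, List.foldl_cons, ← ih]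
    congr 1
    funext x
    unfold transfer
    dsimp only
    split_ifs <;> omega

open Classical in
/-- Removes the first entry that is at most `a`. -/
def removeLE (a : EReal) : List EReal → Option (List EReal)
  | [] => none
  | t :: R => if a < t then (removeLE a R).map (t :: ·) else some R

/-- The greedy algorithm considers one interval. -/
def greedyStep (s : ℕ × List EReal) (J : Ival) : ℕ × List EReal :=
  (removeLE J.start s.2).elim s fun R => (s.1 + 1, (J.finish : EReal) :: R)

theorem removeLE_eq_none {a : EReal} {R : List EReal} (h : removeLE a R = none) :
    ∀ r ∈ R, a < r := by
  induction R with
  | nil => simp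
  | cons t R ih =>
    unfold removeLE at h
    split_ifs at h with ht
    exact List.forall_mem_cons.2 ⟨ht, ih (by simpa using h)⟩

theorem removeLE_eq_some {a : EReal} {R R' : List EReal} (h : removeLE a R = some R')
    (hR : R.Pairwise (· ≥ ·)) :
    ∃ t, t ≤ a ∧ R.Perm (t :: R') ∧ (∀ r ∈ R, r ≤ a → r ≤ t) ∧ R'.Sublist R := by
  induction R generalizing R' with
  | nil => simp [removeLE] at h
  | cons t R ih =>
    rw [List.pairwise_cons] at hR
    unfold removeLE at h
    split_ifs at h with ht
    · obtain ⟨R'', h1, rfl⟩ := Option.map_eq_some_iff.1 h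
      obtain ⟨u, hu, hp, hle, hsub⟩ := ih h1 hR.2
      refine ⟨u, hu, (hp.cons t).trans (.swap _ _ _), ?_, hsub.cons_cons t⟩
      exact List.forall_mem_cons.2 ⟨fun h => absurd h ht.not_ge, hle⟩
    · cases h
      exact ⟨t, not_lt.1 ht, .refl _, fun r hr _ => by
        rcases List.mem_cons.1 hr with rfl | hr
        exacts [le_rfl, hR.1 r hr], List.sublist_cons_self _ _⟩

/-- A state of the greedy algorithm on `m` machines, all of which are busy up to `b` at most. -/
structure IsState (m : ℕ) (b : EReal) (s : ℕ × List EReal) : Prop where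
  sorted : s.2.Pairwise (· ≥ ·)
  length : s.2.length = m
  le : ∀ r ∈ s.2, r ≤ b

theorem IsState.mono {m : ℕ} {b b' : EReal} {s : ℕ × List EReal} (h : IsState m b s)
    (hb : b ≤ b') : IsState m b' s := ⟨h.sorted, h.length, fun r hr => (h.le r hr).trans hb⟩

theorem IsState.greedyStep {m : ℕ} {J : Ival} {s : ℕ × List EReal}
    (h : IsState m J.finish s) : IsState m J.finish (greedyStep s J) := by
  unfold DIS.greedyStep
  cases h1 : removeLE J.start s.2 with
  | none => exact h
  | some R =>
    obtain ⟨t, -, hp, -, hsub⟩ := removeLE_eq_some h1 h.sorted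
    have hle : ∀ r ∈ R, r ≤ (J.finish : EReal) := fun r hr => h.le r (hsub.subset hr)
    refine ⟨List.pairwise_cons.2 ⟨hle, h.sorted.sublist hsub⟩, ?_, ?_⟩
    · have := hp.length_eq
      rw [h.length] at this
      simpa using this.symm
    · exact List.forall_mem_cons.2 ⟨le_rfl, hle⟩

/-- Let `J` replace the time `t`, the latest one up to its start. From the end of `J` on all
machines are free. Between start and end of `J` one free machine is traded for one accepted
interval. At `x` before the start, the trade is the same if `t ≤ x`, and then no time lies strictly
between `x` and the start, so the profile has equal values at both; if `x < t` the profile gains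
one. Both cases are the minimum in `transfer`. If `J` is rejected, the profile is constant up to its
start and the minimum changes nothing. -/
theorem profile_greedyStep {m : ℕ} {J : Ival} {s : ℕ × List EReal} (h : IsState m J.finish s) :
    profile (greedyStep s J) = transfer m (profile s) J := by
  obtain ⟨F, R⟩ := s
  funext x
  have hall : ∀ x, J.b ≤ x → countLE R x = m := fun x hx => by
    rw [countLE_eq_length, h.length]
    exact fun r hr => (WithBot.coe_le_coe.2 (h.le r hr)).trans hx
  cases h1 : removeLE J.start R with
  | none =>
    have h2 : ∀ x, x ≤ J.a → countLE R x = 0 := fun x hx => countLE_eq_zero fun r hr =>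
      hx.trans_lt (WithBot.coe_lt_coe.2 (removeLE_eq_none h1 r hr))
    have e : greedyStep (F, R) J = (F, R) := by simp [greedyStep, h1]
    rw [e]
    rcases le_or_gt J.b x with hx | hx
    · rw [transfer_of_le hx]
      simp [profile, hall x hx, h2 _ le_rfl]
      omega
    · rcases le_or_gt J.a x with hx' | hx'
      · rw [transfer_of_mid hx hx']
      · rw [transfer_of_lt hx']
        simp [profile, h2 _ le_rfl, h2 x hx'.le]
  | some R' =>
    obtain ⟨t, hta, hp, hle, hsub⟩ := removeLE_eq_some h1 h.sorted
    have e : greedyStep (F, R) J = (F + 1, (J.finish : EReal) :: R') := by simp [greedyStep, h1]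
    have hc : ∀ x, countLE R x = countLE R' x + if (t : WithBot EReal) ≤ x then 1 else 0 := by
      classical
      intro x
      rw [countLE_perm hp, countLE_cons]
    have hta' : (t : WithBot EReal) ≤ J.a := WithBot.coe_le_coe.2 hta
    have hlen : R'.length + 1 = m := by
      have := hp.length_eq
      have h' := h.length
      simp only [List.length_cons] at this h'
      omega
    rw [e]
    rw [profile_mk, countLE_cons]
    have hb : ((J.finish : EReal) : WithBot EReal) = J.b := rfl
    rw [hb]
    rcases le_or_gt J.b x with hx | hx
    · rw [transfer_of_le hx, if_pos hx]
      have h3 : countLE R' x = R'.length := countLE_eq_length fun r hr =>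
        (WithBot.coe_le_coe.2 (h.le r (hsub.subset hr))).trans hx
      rw [profile_mk, profile_mk, h3, hc J.a, countLE_bot, if_pos hta']
      omega
    · rw [if_neg hx.not_ge]
      rcases le_or_gt J.a x with hx' | hx'
      · rw [transfer_of_mid hx hx', profile_mk, hc x, if_pos (hta'.trans hx')]
        omega
      · rw [transfer_of_lt hx', profile_mk, profile_mk, hc x, hc J.a, if_pos hta']
        have h4 := countLE_mono R' hx'.le
        by_cases htx : (t : WithBot EReal) ≤ x
        · rw [if_pos htx]
          have h5 : countLE R' J.a ≤ countLE R' x := by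
            unfold countLE
            refine List.countP_mono_left fun r hr h6 => ?_
            simp only [decide_eq_true_eq] at h6 ⊢
            exact (WithBot.coe_le_coe.2
              (hle r (hsub.subset hr) (WithBot.coe_le_coe.1 h6))).trans htx
          omega
        · rw [if_neg htx]
          omega

/-- Lists of intervals that are sorted by their ends, all of which are at least `b`. -/
structure SortedFrom (b : EReal) (L : List Ival) : Prop where
  sorted : L.Pairwise fun I J => I.finish ≤ J.finish
  le : ∀ J ∈ L, b ≤ (J.finish : EReal)

theorem SortedFrom.tail {b : EReal} {J : Ival} {L : List Ival} (h : SortedFrom b (J :: L)) :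
    SortedFrom J.finish L :=
  ⟨(List.pairwise_cons.1 h.sorted).2, fun K hK =>
    EReal.coe_le_coe_iff.2 ((List.pairwise_cons.1 h.sorted).1 K hK)⟩

theorem IsState.foldl {m : ℕ} {b c : EReal} {L : List Ival} {s : ℕ × List EReal}
    (hL : SortedFrom b L) (h : IsState m b s) (hbc : b ≤ c) (hc : ∀ J ∈ L, (J.finish : EReal) ≤ c) :
    IsState m c (L.foldl DIS.greedyStep s) ∧
      profile (L.foldl DIS.greedyStep s) = L.foldl (transfer m) (profile s) := by
  induction L generalizing b s with
  | nil => exact ⟨h.mono hbc, rfl⟩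
  | cons J L ih =>
    have h' := h.mono (hL.le J (by simp))
    rw [List.foldl_cons, List.foldl_cons, ← profile_greedyStep h']
    exact ih hL.tail h'.greedyStep (hc J (by simp)) fun K hK => hc K (by simp [hK])

/-! ### Optimality of the greedy algorithm -/

open Classical in
theorem card_le_of_forall_le_update {m : ℕ} (u : Fin m → EReal) (i : Fin m) (b : EReal)
    (x : WithBot EReal) :
    (Finset.univ.filter fun j => (Function.update u i b j : WithBot EReal) ≤ x).card +
        (if (u i : WithBot EReal) ≤ x then 1 else 0) =
      (Finset.univ.filter fun j => (u j : WithBot EReal) ≤ x).card +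
        if (b : WithBot EReal) ≤ x then 1 else 0 := by
  simp only [Finset.card_filter]
  rw [← Finset.add_sum_erase _ _ (Finset.mem_univ i),
    ← Finset.add_sum_erase (a := i) Finset.univ
      (fun j => if (u j : WithBot EReal) ≤ x then 1 else 0) (Finset.mem_univ i)]
  have : ∀ j ∈ Finset.univ.erase i, (if (Function.update u i b j : WithBot EReal) ≤ x then 1 else 0)
      = if (u j : WithBot EReal) ≤ x then 1 else 0 := fun j hj => by
    rw [Function.update_of_ne (Finset.ne_of_mem_erase hj)]
  rw [Finset.sum_congr rfl this, Function.update_self]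
  omega

open Classical in
/-- A schedule cannot beat the profile that results from the transfer of an upper bound. -/
theorem schedule_le_transfer {m : ℕ} (A : Finset Ival) (σ : Ival → Fin m) (L : List Ival)
    (hL : L.Pairwise fun I J => I.finish ≤ J.finish)
    (hc : L.Pairwise fun I J => I ∈ A → J ∈ A → σ I = σ J → I.finish ≤ J.start)
    (u : Fin m → EReal) (hu : ∀ J ∈ L, J ∈ A → u (σ J) ≤ J.start)
    (hb : ∀ J ∈ L, ∀ i, u i ≤ J.finish) (c : ℕ) (h : WithBot EReal → ℕ)
    (hh : ∀ x, c + (Finset.univ.filter fun i => (u i : WithBot EReal) ≤ x).card ≤ h x) :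
    c + (L.filter (· ∈ A)).length ≤ L.foldl (transfer m) h ⊥ := by
  induction L generalizing u c h with
  | nil => exact (Nat.le_add_right _ _).trans (hh ⊥)
  | cons J L ih =>
    rw [List.pairwise_cons] at hL hc
    have hbot : ∀ u : Fin m → EReal,
        (Finset.univ.filter fun i => (u i : WithBot EReal) ≤ ⊥).card = 0 := fun u => by simp
    have hmono : ∀ x y : WithBot EReal, x ≤ y →
        (Finset.univ.filter fun i => (u i : WithBot EReal) ≤ x).card ≤
        (Finset.univ.filter fun i => (u i : WithBot EReal) ≤ y).card := fun x y hxy =>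
      Finset.card_le_card (Finset.monotone_filter_right _ fun i _ hi => hi.trans hxy)
    have hcard : ∀ (u : Fin m → EReal) (x : WithBot EReal),
        (Finset.univ.filter fun i => (u i : WithBot EReal) ≤ x).card ≤ m := fun u x => by
      simpa using Finset.card_filter_le (Finset.univ : Finset (Fin m))
        (fun i => (u i : WithBot EReal) ≤ x)
    have h0 := hh ⊥
    have ha := hh J.a
    rw [hbot] at h0
    rw [List.foldl_cons]
    by_cases hJ : J ∈ A
    · rw [List.filter_cons_of_pos (by simpa using hJ), List.length_cons, ← Nat.add_assoc,
        Nat.add_right_comm]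
      refine ih hL.2 hc.2 (Function.update u (σ J) J.finish) ?_ ?_ (c + 1) _ ?_
      · intro K hK hKA
        by_cases e : σ K = σ J
        · rw [e, Function.update_self]
          exact EReal.coe_le_coe_iff.2 (hc.1 K hK hJ hKA e.symm)
        · rw [Function.update_of_ne e]
          exact hu K (by simp [hK]) hKA
      · intro K hK i
        by_cases e : i = σ J
        · rw [e, Function.update_self]
          exact EReal.coe_le_coe_iff.2 (hL.1 K hK)
        · rw [Function.update_of_ne e]
          exact hb K (by simp [hK]) i
      · intro x
        have hup := card_le_of_forall_le_update u (σ J) J.finish x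
        have hJu : (u (σ J) : WithBot EReal) ≤ J.a := WithBot.coe_le_coe.2 (hu J (by simp) hJ)
        have hfin : ((J.finish : EReal) : WithBot EReal) = J.b := rfl
        have h1 := hh x
        have hupa := card_le_of_forall_le_update u (σ J) J.finish J.a
        rw [hfin, if_pos hJu, if_neg J.a_lt_b.not_ge] at hupa
        rw [hfin] at hup
        rcases le_or_gt J.b x with hx | hx
        · rw [transfer_of_le hx]
          have := hcard (Function.update u (σ J) J.finish) x
          omega
        · rw [if_neg hx.not_ge] at hup
          rcases le_or_gt J.a x with hx' | hx'
          · rw [if_pos (hJu.trans hx')] at hup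
            rw [transfer_of_mid hx hx']
            omega
          · rw [transfer_of_lt hx']
            -- The bound by `h x + 1` holds since the update frees no machine at `x`. The bound by
            -- `h J.a` holds since the machine of `J` was free at its start and no longer is.
            have h2 : (Finset.univ.filter fun i =>
                (Function.update u (σ J) (J.finish : EReal) i : WithBot EReal) ≤ x).card ≤
                (Finset.univ.filter fun i =>
                (Function.update u (σ J) (J.finish : EReal) i : WithBot EReal) ≤ J.a).card :=
              Finset.card_le_card (Finset.monotone_filter_right _ fun i _ hi => hi.trans hx'.le)
            omega
    · rw [List.filter_cons_of_neg (by simpa using hJ)]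
      refine ih hL.2 hc.2 u (fun K hK => hu K (by simp [hK])) (fun K hK => hb K (by simp [hK])) c _ ?_
      intro x
      have h1 := hh x
      rcases le_or_gt J.b x with hx | hx
      · rw [transfer_of_le hx]
        have := hcard u x
        omega
      · rcases le_or_gt J.a x with hx' | hx'
        · rw [transfer_of_mid hx hx']
          omega
        · rw [transfer_of_lt hx']
          have := hmono x J.a hx'.le
          omega

theorem map_update_univ {m : ℕ} {u : Fin m → EReal} {i : Fin m} {R' : List EReal}
    (h : (Finset.univ : Finset (Fin m)).val.map u = ↑(u i :: R')) (b : EReal) :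
    (Finset.univ : Finset (Fin m)).val.map (Function.update u i b) = ↑(b :: R') := by
  classical
  have e := Multiset.cons_erase (Finset.mem_univ_val i)
  rw [← e, Multiset.map_cons, ← Multiset.cons_coe, Multiset.cons_inj_right] at h
  rw [← e, Multiset.map_cons, Function.update_self, ← Multiset.cons_coe, Multiset.cons_inj_right, ← h]
  refine Multiset.map_congr rfl fun j hj => ?_
  have : j ≠ i := ((Multiset.Nodup.mem_erase_iff Finset.univ.nodup).1 hj).1
  rw [Function.update_of_ne this]

open Classical in
/-- The greedy algorithm extends a schedule. -/
theorem exists_schedule {m : ℕ} (L : List Ival) {b : EReal} {s : ℕ × List EReal}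
    (hL : SortedFrom b L) (hs : IsState m b s) (hnd : L.Nodup)
    (A : Finset Ival) (σ : Ival → Fin m) (u : Fin m → EReal)
    (hu : (Finset.univ : Finset (Fin m)).val.map u = ↑s.2) (hA : A.card = s.1)
    (hAL : ∀ I ∈ A, I ∉ L) (hAu : ∀ I ∈ A, (I.finish : EReal) ≤ u (σ I))
    (hcomp : ∀ I ∈ A, ∀ J ∈ A, I ≠ J → σ I = σ J → Compatible I J) :
    ∃ A' ⊆ A ∪ L.toFinset, Schedulable m A' ∧ A'.card = (L.foldl greedyStep s).1 := by
  induction L generalizing b s A σ u with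
  | nil => exact ⟨A, by simp, ⟨σ, hcomp⟩, hA⟩
  | cons J L ih =>
    have hs' := hs.mono (hL.le J (by simp))
    rw [List.nodup_cons] at hnd
    rw [List.foldl_cons]
    have hst := hs'.greedyStep
    cases h1 : removeLE J.start s.2 with
    | none =>
      have e : greedyStep s J = s := by simp [greedyStep, h1]
      rw [e]
      obtain ⟨A', h2, h3⟩ := ih hL.tail hs' hnd.2 A σ u hu hA
        (fun I hI h => hAL I hI (by simp [h])) hAu hcomp
      refine ⟨A', h2.trans ?_, h3⟩
      rw [List.toFinset_cons]
      exact Finset.union_subset_union_right (Finset.subset_insert _ _)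
    | some R' =>
      obtain ⟨t, hta, hp, -, -⟩ := removeLE_eq_some h1 hs.sorted
      have e : greedyStep s J = (s.1 + 1, (J.finish : EReal) :: R') := by simp [greedyStep, h1]
      rw [e] at hst ⊢
      have hR : (s.2 : Multiset EReal) = ↑(t :: R') := Multiset.coe_eq_coe.2 hp
      obtain ⟨i, -, rfl⟩ := Multiset.mem_map.1
        (show t ∈ (Finset.univ : Finset (Fin m)).val.map u by rw [hu, hR]; simp)
      rw [hR] at hu
      have hJA : J ∉ A := fun h => hAL J h (by simp)
      have hne : ∀ I ∈ A, I ≠ J := fun I hI h => hJA (h ▸ hI)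
      obtain ⟨A', h2, h3⟩ := ih (s := (s.1 + 1, (J.finish : EReal) :: R')) hL.tail hst hnd.2
        (insert J A) (Function.update σ J i) (Function.update u i J.finish)
        (map_update_univ hu _) (by rw [Finset.card_insert_of_notMem hJA, hA])
        (by
          intro I hI h
          rcases Finset.mem_insert.1 hI with rfl | hI
          · exact hnd.1 h
          · exact hAL I hI (by simp [h]))
        (by
          intro I hI
          rcases Finset.mem_insert.1 hI with rfl | hI
          · simp
          · rw [Function.update_of_ne (hne I hI)]
            by_cases h : σ I = i
            · rw [h, Function.update_self]
              refine (hAu I hI).trans ?_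
              rw [h]
              exact hta.trans (EReal.coe_le_coe_iff.2 J.start_lt.le)
            · rw [Function.update_of_ne h]
              exact hAu I hI)
        (by
          have hcJ : ∀ I ∈ A, σ I = i → I.finish ≤ J.start := fun I hI h => by
            have := (hAu I hI).trans (h ▸ hta)
            exact EReal.coe_le_coe_iff.1 this
          intro I hI K hK hIK h
          rcases Finset.mem_insert.1 hI with rfl | hI' <;>
            rcases Finset.mem_insert.1 hK with rfl | hK'
          · exact absurd rfl hIK
          · rw [Function.update_self, Function.update_of_ne (hne K hK')] at h
            exact Or.inr (hcJ K hK' h.symm)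
          · rw [Function.update_self, Function.update_of_ne (hne I hI')] at h
            exact Or.inl (hcJ I hI' h)
          · rw [Function.update_of_ne (hne I hI'), Function.update_of_ne (hne K hK')] at h
            exact hcomp I hI' K hK' hIK h)
      refine ⟨A', h2.trans ?_, h3⟩
      rw [List.toFinset_cons, Finset.insert_union, Finset.union_insert]

/-- The initial state of the greedy algorithm. -/
def initState (m : ℕ) : ℕ × List EReal := (0, List.replicate m ⊥)

theorem isState_initState (m : ℕ) : IsState m ⊥ (initState m) :=
  ⟨List.pairwise_replicate_of_refl, by simp [initState], fun r hr => by
    rw [List.eq_of_mem_replicate hr]⟩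

theorem sortedFrom_sort (S : Finset Ival) : SortedFrom ⊥ S.sort :=
  ⟨(Finset.pairwise_sort S (· ≤ ·)).imp fun h => Ival.finish_le_of_le h, fun _ _ => bot_le⟩

/-- The greedy algorithm is optimal. -/
theorem opt_eq_greedy {m : ℕ} (hm : 0 < m) (S : Finset Ival) :
    opt m S = (S.sort.foldl greedyStep (initState m)).1 := by
  classical
  have hL := sortedFrom_sort S
  apply le_antisymm
  · refine Finset.sup_le fun A hA => ?_
    rw [Finset.mem_filter, Finset.mem_powerset] at hA
    obtain ⟨hAS, σ, hσ⟩ := hA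
    have h := IsState.foldl hL (isState_initState m) (c := ⊤) bot_le (fun _ _ => le_top)
    have hprof : (S.sort.foldl greedyStep (initState m)).1 =
        S.sort.foldl (transfer m) (profile (initState m)) ⊥ := by
      rw [← h.2, profile, countLE_bot, Nat.add_zero]
    rw [hprof]
    have hlen : A.card = (S.sort.filter (· ∈ A)).length := by
      have : (S.sort.filter (· ∈ A)).toFinset = A := by
        ext I
        simp only [List.mem_toFinset, List.mem_filter, Finset.mem_sort, decide_eq_true_eq]
        exact ⟨fun h => h.2, fun h => ⟨hAS h, h⟩⟩
      conv_lhs => rw [← this]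
      exact List.toFinset_card_of_nodup ((Finset.sort_nodup S _).filter _)
    rw [hlen, ← Nat.zero_add (List.length _)]
    refine schedule_le_transfer A σ _ hL.sorted ?_ (fun _ => ⊥) (fun _ _ _ => bot_le)
      (fun _ _ _ => bot_le) 0 _ ?_
    · refine (hL.sorted.and (Finset.sort_nodup S (· ≤ ·))).imp fun {I J} h hI hJ hIJ => ?_
      rcases hσ I hI J hJ h.2 hIJ with h' | h'
      · exact h'
      · exact absurd (h'.trans_lt I.start_lt) h.1.not_gt
    · intro x
      rw [profile, initState, Nat.add_le_add_iff_left]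
      rcases eq_or_ne x ⊥ with rfl | hx
      · simp
      · rw [countLE_eq_length]
        · simpa using Finset.card_filter_le (Finset.univ : Finset (Fin m))
            (fun _ => ((⊥ : EReal) : WithBot EReal) ≤ x)
        · intro r hr
          rw [List.eq_of_mem_replicate hr]
          obtain ⟨y, rfl⟩ := WithBot.ne_bot_iff_exists.1 hx
          exact WithBot.coe_le_coe.2 bot_le
  · obtain ⟨A, hA, hsch, hcard⟩ := exists_schedule S.sort hL (isState_initState m)
      (Finset.sort_nodup S _) ∅ (fun _ => ⟨0, hm⟩) (fun _ => ⊥)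
      (by rw [initState]; simp [Multiset.coe_replicate]) rfl (by simp) (by simp) (by simp)
    rw [← hcard]
    refine Finset.le_sup (f := Finset.card) (Finset.mem_filter.2 ⟨?_, hsch⟩)
    rw [Finset.mem_powerset]
    simpa using hA

/-! ### The action of a block of intervals on the states -/

/-- The greedy algorithm on the intervals of a block that start at `d` or later, from the initial
state. -/
def blockRow (m : ℕ) (L : List Ival) (d : EReal) : ℕ × List EReal :=
  open Classical in (L.filter fun J => d ≤ (J.start : EReal)).foldl greedyStep (initState m)

/-- The machines that have not been used stay busy up to `d`. -/
def fillBot (d : EReal) (R : List EReal) : List EReal :=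
  open Classical in R.map fun r => if r = ⊥ then d else r

theorem removeLE_sublist {a : EReal} {R R' : List EReal} (h : removeLE a R = some R') :
    R'.Sublist R := by
  induction R generalizing R' with
  | nil => simp [removeLE] at h
  | cons t R ih =>
    unfold removeLE at h
    split_ifs at h
    · obtain ⟨R'', h1, rfl⟩ := Option.map_eq_some_iff.1 h
      exact (ih h1).cons_cons t
    · cases h
      exact List.sublist_cons_self _ _

/-- For an interval that starts at `d` or later, an unused machine is equally free whether its time
is `⊥` or `d`. -/
theorem removeLE_fillBot_of_le {a d : EReal} (hd : d ≤ a) (R : List EReal) :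
    removeLE a (fillBot d R) = (removeLE a R).map (fillBot d) := by
  induction R with
  | nil => rfl
  | cons t R ih =>
    rw [fillBot, List.map_cons, ← fillBot]
    unfold removeLE
    by_cases ht : t = ⊥
    · subst ht
      rw [if_pos rfl, if_neg hd.not_gt, if_neg not_lt_bot]
      rfl
    · rw [if_neg ht, ih]
      split_ifs
      · cases removeLE a R <;> simp [fillBot, ht]
      · rfl

theorem removeLE_fillBot_of_lt {a d : EReal} (hd : a < d) {R : List EReal}
    (hR : ∀ r ∈ R, r = ⊥ ∨ d ≤ r) : removeLE a (fillBot d R) = none := by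
  induction R with
  | nil => rfl
  | cons t R ih =>
    rw [List.forall_mem_cons] at hR
    rw [fillBot, List.map_cons, ← fillBot]
    unfold removeLE
    rw [ih hR.2, if_pos]
    · rfl
    · split_ifs with ht
      · exact hd
      · exact hd.trans_le (hR.1.resolve_left ht)

/-- Intervals starting before `d` are rejected, because no machine is released before `d`; the
others do not distinguish `d` from `⊥`. Hence the result depends on `d` only through the set of
intervals that start at or after `d`, up to refilling with `d` at the end. -/
theorem foldl_greedyStep_fillBot (d : EReal) (L : List Ival) (F : ℕ) (R : List EReal)
    (hR : ∀ r ∈ R, r = ⊥ ∨ d ≤ r) :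
    L.foldl greedyStep (F, fillBot d R) =
      open Classical in
      (((L.filter fun J => d ≤ (J.start : EReal)).foldl greedyStep (F, R)).1,
        fillBot d ((L.filter fun J => d ≤ (J.start : EReal)).foldl greedyStep (F, R)).2) := by
  induction L generalizing F R with
  | nil => rfl
  | cons J L ih =>
    rw [List.foldl_cons]
    by_cases hJ : d ≤ (J.start : EReal)
    · rw [List.filter_cons_of_pos (by simpa using hJ), List.foldl_cons]
      cases h : removeLE J.start R with
      | none =>
        have e : greedyStep (F, R) J = (F, R) := by simp [greedyStep, h]
        have e' : greedyStep (F, fillBot d R) J = (F, fillBot d R) := by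
          simp [greedyStep, removeLE_fillBot_of_le hJ, h]
        rw [e, e']
        exact ih F R hR
      | some R' =>
        have e : greedyStep (F, R) J = (F + 1, (J.finish : EReal) :: R') := by
          simp [greedyStep, h]
        have e' : greedyStep (F, fillBot d R) J =
            (F + 1, fillBot d ((J.finish : EReal) :: R')) := by
          rw [greedyStep, removeLE_fillBot_of_le hJ, h]
          simp [fillBot]
        rw [e, e']
        refine ih _ _ (List.forall_mem_cons.2 ⟨Or.inr ?_, fun r hr => ?_⟩)
        · exact hJ.trans (EReal.coe_le_coe_iff.2 J.start_lt.le)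
        · exact hR r ((removeLE_sublist h).subset hr)
    · rw [List.filter_cons_of_neg (by simpa using hJ)]
      have e' : greedyStep (F, fillBot d R) J = (F, fillBot d R) := by
        simp [greedyStep, removeLE_fillBot_of_lt (not_le.1 hJ) hR]
      rw [e']
      exact ih F R hR

/-- The action of a block on the state in which all machines are busy up to `d`. -/
theorem foldl_greedyStep_replicate (m : ℕ) (L : List Ival) (d : EReal) :
    L.foldl greedyStep (0, List.replicate m d) =
      ((blockRow m L d).1, fillBot d (blockRow m L d).2) := by
  have e : List.replicate m d = fillBot d (List.replicate m ⊥) := by simp [fillBot]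
  rw [e, foldl_greedyStep_fillBot _ _ _ _ fun r hr => Or.inl (List.eq_of_mem_replicate hr)]
  rfl

/-! ### The minimum of two profiles is the profile of a state -/

/-- The entrywise maximum of two lists, the shorter of which is padded. -/
def zipMax : List EReal → List EReal → List EReal
  | [], B => B
  | A, [] => A
  | a :: A, b :: B => max a b :: zipMax A B

theorem zipMax_nil (A : List EReal) : zipMax A [] = A := by cases A <;> rfl

theorem length_zipMax {A B : List EReal} (h : B.length ≤ A.length) :
    (zipMax A B).length = A.length := by
  induction A generalizing B with
  | nil => simpa [zipMax] using h
  | cons a A ih =>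
    cases B with
    | nil => rfl
    | cons b B => simp [zipMax, ih (B := B) (by simpa using h)]

theorem mem_zipMax {A B : List EReal} {r : EReal} (h : r ∈ zipMax A B) : r ∈ A ∨ r ∈ B := by
  induction A generalizing B with
  | nil => exact Or.inr h
  | cons a A ih =>
    cases B with
    | nil => exact Or.inl h
    | cons b B =>
      rcases List.mem_cons.1 h with rfl | h
      · rcases max_choice a b with e | e <;> simp [e]
      · rcases ih h with h | h <;> simp [h]

theorem zipMax_sorted {A B : List EReal} (hA : A.Pairwise (· ≥ ·)) (hB : B.Pairwise (· ≥ ·)) :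
    (zipMax A B).Pairwise (· ≥ ·) := by
  induction A generalizing B with
  | nil => exact hB
  | cons a A ih =>
    cases B with
    | nil => exact hA
    | cons b B =>
      rw [List.pairwise_cons] at hA hB
      refine List.pairwise_cons.2 ⟨fun r hr => ?_, ih hA.2 hB.2⟩
      rcases mem_zipMax hr with h | h
      · exact (hA.1 r h).trans (le_max_left a b)
      · exact (hB.1 r h).trans (le_max_right a b)

theorem countLE_of_head_le {a : EReal} {A : List EReal} (hA : (a :: A).Pairwise (· ≥ ·))
    {x : WithBot EReal} (h : (a : WithBot EReal) ≤ x) : countLE A x = A.length :=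
  countLE_eq_length fun r hr =>
    (WithBot.coe_le_coe.2 ((List.pairwise_cons.1 hA).1 r hr)).trans h

/-- In a descending list the entries up to `x` form a suffix, so the entrywise maximum intersects
two suffixes, and the shorter one counts. The lists are aligned at their heads, and the missing last
entries of `B` behave as times that are always reached. -/
theorem countLE_zipMax {A B : List EReal} (hA : A.Pairwise (· ≥ ·)) (hB : B.Pairwise (· ≥ ·))
    (h : B.length ≤ A.length) (x : WithBot EReal) :
    countLE (zipMax A B) x = min (countLE A x) (A.length - B.length + countLE B x) := by
  classical
  induction A generalizing B with
  | nil =>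
    have : B = [] := by simpa using h
    simp [this, zipMax]
  | cons a A ih =>
    cases B with
    | nil =>
      have := countLE_le_length (a :: A) x
      simp only [zipMax, countLE_nil, List.length_nil]
      omega
    | cons b B =>
      have hlen : B.length ≤ A.length := by simpa using h
      have h1 := ih (List.pairwise_cons.1 hA).2 (List.pairwise_cons.1 hB).2 hlen
      have h2 := countLE_le_length A x
      have h3 := countLE_le_length B x
      have hmax : ((max a b : EReal) : WithBot EReal) ≤ x ↔
          (a : WithBot EReal) ≤ x ∧ (b : WithBot EReal) ≤ x := by
        rw [WithBot.coe_max, max_le_iff]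
      rw [zipMax, countLE_cons, countLE_cons, countLE_cons, h1]
      simp only [List.length_cons, hmax]
      by_cases ha : (a : WithBot EReal) ≤ x
      · have := countLE_of_head_le hA ha
        by_cases hb : (b : WithBot EReal) ≤ x
        · have := countLE_of_head_le hB hb
          simp only [ha, hb, and_self, if_true]
          omega
        · simp only [ha, hb, and_false, if_true, if_false]
          omega
      · by_cases hb : (b : WithBot EReal) ≤ x
        · have := countLE_of_head_le hB hb
          simp only [ha, hb, false_and, if_true, if_false]
          omega
        · simp only [ha, hb, and_false, if_false]
          omega

theorem countLE_drop {R : List EReal} (hR : R.Pairwise (· ≥ ·)) (k : ℕ) (x : WithBot EReal) :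
    countLE (R.drop k) x = min (countLE R x) (R.length - k) := by
  classical
  induction R generalizing k with
  | nil => simp
  | cons r R ih =>
    cases k with
    | zero =>
      have := countLE_le_length (r :: R) x
      simp only [List.drop_zero, Nat.sub_zero]
      omega
    | succ k =>
      rw [List.drop_succ_cons, ih (List.pairwise_cons.1 hR).2, countLE_cons]
      by_cases h : (r : WithBot EReal) ≤ x
      · rw [if_pos h, countLE_of_head_le hR h]
        simp only [List.length_cons]
        omega
      · rw [if_neg h]
        simp

/-- The state whose profile is the minimum of two profiles, the first of which has the smaller
number of accepted intervals. -/
def joinLE (s t : ℕ × List EReal) : ℕ × List EReal := (s.1, zipMax s.2 (t.2.drop (t.1 - s.1)))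

def join (s t : ℕ × List EReal) : ℕ × List EReal := if s.1 ≤ t.1 then joinLE s t else joinLE t s

/-- A surplus of `k` accepted intervals in `t` is worth `k` machines that are always free. Dropping
the `k` latest times and padding at the end rewrites `t` with the smaller counter, with the machine
count capped at `m`; the cap is harmless since `s` has at most `m` free machines. -/
theorem joinLE_spec {m : ℕ} {c : EReal} {s t : ℕ × List EReal} (hs : IsState m c s)
    (ht : IsState m c t) (h : s.1 ≤ t.1) :
    IsState m c (joinLE s t) ∧ ∀ x, profile (joinLE s t) x = min (profile s x) (profile t x) := by
  have hlen : (t.2.drop (t.1 - s.1)).length ≤ s.2.length := by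
    rw [List.length_drop, ht.length, hs.length]
    omega
  have hsort := ht.sorted.sublist (List.drop_sublist (t.1 - s.1) t.2)
  refine ⟨⟨zipMax_sorted hs.sorted hsort, ?_, ?_⟩, fun x => ?_⟩
  · rw [joinLE, length_zipMax hlen, hs.length]
  · intro r hr
    rcases mem_zipMax hr with h | h
    · exact hs.le r h
    · exact ht.le r (List.mem_of_mem_drop h)
  · have h1 := countLE_le_length s.2 x
    have h2 := countLE_le_length t.2 x
    rw [joinLE, profile_mk, countLE_zipMax hs.sorted hsort hlen, countLE_drop ht.sorted,
      List.length_drop, profile, profile]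
    rw [hs.length] at h1 ⊢
    rw [ht.length] at h2 ⊢
    omega

theorem join_spec {m : ℕ} {c : EReal} {s t : ℕ × List EReal} (hs : IsState m c s)
    (ht : IsState m c t) :
    IsState m c (join s t) ∧ ∀ x, profile (join s t) x = min (profile s x) (profile t x) := by
  unfold join
  split_ifs with h
  · exact joinLE_spec hs ht h
  · have := joinLE_spec ht hs (not_le.1 h).le
    exact ⟨this.1, fun x => (this.2 x).trans (min_comm _ _)⟩

/-- The state after a block, computed from the rows of the block. -/
def applyBlock (row : EReal → ℕ × List EReal) (F : ℕ) : List EReal → Option (ℕ × List EReal)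
  | [] => none
  | d :: R =>
    let t := (F + R.length + (row d).1, fillBot d (row d).2)
    some ((applyBlock row F R).elim t fun s => join s t)

open Classical in
-- The profile of the times `r₁ ≥ … ≥ rₘ` is the minimum over `i` of the profiles with all `m`
-- machines busy up to `rᵢ`, shifted by the number `m - i` of entries after `rᵢ`. By linearity the
-- action of the block can be computed on each of these separately. For the induction the statement
-- is about suffixes `R` of the list: the corresponding minimum jumps to `m` once all entries of `R`
-- are reached, and for `R` of length `m` this is the count itself.
theorem applyBlock_spec {m : ℕ} {b c : EReal} {L : List Ival} (hL : SortedFrom b L)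
    (hbc : b ≤ c) (hc : ∀ J ∈ L, (J.finish : EReal) ≤ c) (F : ℕ) (R : List EReal)
    (hR : R.Pairwise (· ≥ ·)) (hRb : ∀ r ∈ R, r ≤ b) (hRm : R.length ≤ m) (hne : R ≠ []) :
    ∃ s, applyBlock (blockRow m L) F R = some s ∧ IsState m c s ∧
      profile s = L.foldl (transfer m)
        fun x => F + if countLE R x = R.length ∧ x ≠ ⊥ then m else countLE R x := by
  induction R with
  | nil => exact absurd rfl hne
  | cons d R ih =>
    rw [List.forall_mem_cons] at hRb
    have hd : IsState m b (0, List.replicate m d) :=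
      ⟨List.pairwise_replicate_of_refl, by simp, fun r hr => by
        rw [List.eq_of_mem_replicate hr]; exact hRb.1⟩
    have h1 := IsState.foldl hL hd hbc hc
    rw [foldl_greedyStep_replicate] at h1
    set t : ℕ × List EReal :=
      (F + R.length + (blockRow m L d).1, fillBot d (blockRow m L d).2) with ht
    have hts : IsState m c t := ⟨h1.1.sorted, h1.1.length, h1.1.le⟩
    have hcr : ∀ x : WithBot EReal, countLE (List.replicate m d) x =
        if (d : WithBot EReal) ≤ x then m else 0 := fun x => by
      split_ifs with h
      · rw [countLE_eq_length, List.length_replicate]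
        intro r hr
        rwa [List.eq_of_mem_replicate hr]
      · refine countLE_eq_zero fun r hr => ?_
        rw [List.eq_of_mem_replicate hr]
        exact not_le.1 h
    have htp : profile t = L.foldl (transfer m)
        fun x => F + R.length + if (d : WithBot EReal) ≤ x then m else 0 := by
      have e := foldl_transfer_add m (F + R.length) L (profile (0, List.replicate m d))
      rw [← h1.2] at e
      have e2 : (fun x => F + R.length + profile (0, List.replicate m d) x) =
          fun x => F + R.length + if (d : WithBot EReal) ≤ x then m else 0 := by
        funext x
        rw [profile_mk, hcr, Nat.zero_add]
      rw [← e2, e]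
      funext x
      rw [ht, profile_mk, profile_mk, Nat.add_assoc]
    rcases eq_or_ne R [] with rfl | hRne
    · refine ⟨t, rfl, hts, ?_⟩
      rw [htp]
      congr 1
      funext x
      rw [countLE_cons]
      by_cases h : (d : WithBot EReal) ≤ x
      · have hx : x ≠ ⊥ := by rintro rfl; simp at h
        simp [h, hx]
      · simp [h]
    · rw [List.pairwise_cons] at hR
      obtain ⟨s, e, hs, hsp⟩ := ih hR.2 hRb.2 (by simp at hRm; omega) hRne
      obtain ⟨hj, hjp⟩ := join_spec hs hts
      refine ⟨join s t, by simp [applyBlock, e, ht], hj, ?_⟩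
      funext x
      rw [hjp, hsp, htp, ← congrFun (foldl_transfer_min m L _ _) x]
      refine congrFun (congrArg (fun f => L.foldl (transfer m) f) (funext fun x => ?_)) x
      simp only [countLE_cons, List.length_cons]
      have h2 := countLE_le_length R x
      have hRm' : R.length + 1 ≤ m := by simpa using hRm
      by_cases h : (d : WithBot EReal) ≤ x
      · have hx : x ≠ ⊥ := by rintro rfl; simp at h
        have h3 := countLE_of_head_le (List.pairwise_cons.2 hR) h
        simp [h, hx, h3]
      · rw [if_neg h, if_neg h]
        have : ¬ (countLE R x + 0 = R.length + 1 ∧ x ≠ ⊥) := by omega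
        rw [if_neg this]
        split_ifs <;> omega

/-- The action of a block on a state. -/
theorem applyBlock_state {m : ℕ} (hm : 0 < m) {b c : EReal} {L : List Ival} (hL : SortedFrom b L)
    (hbc : b ≤ c) (hc : ∀ J ∈ L, (J.finish : EReal) ≤ c) {s : ℕ × List EReal}
    (hs : IsState m b s) :
    ∃ t, applyBlock (blockRow m L) s.1 s.2 = some t ∧ IsState m c t ∧
      profile t = L.foldl (transfer m) (profile s) := by
  classical
  have hne : s.2 ≠ [] := by
    intro h
    have := hs.length
    rw [h] at this
    simp at this
    omega
  obtain ⟨t, e, ht, hp⟩ := applyBlock_spec hL hbc hc s.1 s.2 hs.sorted hs.le hs.length.le hne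
  refine ⟨t, e, ht, ?_⟩
  rw [hp]
  congr 1
  funext x
  rw [profile, hs.length]
  split_ifs with h
  · rw [h.1]
  · rfl

/-! ### The program of the dynamic data structure -/

namespace Body

/-- The number one, and the truth value true. -/
def one : Term := .pair .nil .nil

/-- Successor of a binary number. -/
def inc : Term :=
  .ifPair (.var 0)
    (.ifPair (.fst (.var 0)) (.pair .nil (.call 1 (.snd (.var 0)))) (.pair one (.snd (.var 0))))
    (.pair one .nil)

/-- Sum of two binary numbers. -/
def add : Term :=
  .ifPair (.fst (.var 0))
    (.ifPair (.snd (.var 0))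
      (.bind (.call 2 (.pair (.snd (.fst (.var 0))) (.snd (.snd (.var 0)))))
        (.ifPair (.fst (.fst (.var 1)))
          (.ifPair (.fst (.snd (.var 1))) (.pair .nil (.call 1 (.var 0))) (.pair one (.var 0)))
          (.pair (.fst (.snd (.var 1))) (.var 0))))
      (.fst (.var 0)))
    (.snd (.var 0))

/-- Comparison of two binary numbers. -/
def le : Term :=
  .ifPair (.fst (.var 0))
    (.ifPair (.snd (.var 0))
      (.ifPair (.fst (.fst (.var 0)))
        (.ifPair (.fst (.snd (.var 0)))
          (.call 3 (.pair (.snd (.fst (.var 0))) (.snd (.snd (.var 0)))))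
          (.ifPair (.call 3 (.pair (.snd (.snd (.var 0))) (.snd (.fst (.var 0))))) .nil one))
        (.call 3 (.pair (.snd (.fst (.var 0))) (.snd (.snd (.var 0))))))
      .nil)
    one

/-- `removeLE`. -/
def remove : Term :=
  .ifPair (.snd (.var 0))
    (.ifLt (.fst (.var 0)) (.fst (.fst (.snd (.var 0))))
      (.bind (.call 4 (.pair (.fst (.var 0)) (.snd (.snd (.var 0)))))
        (.ifPair (.var 0) (.pair (.pair (.fst (.snd (.var 1))) (.fst (.var 0))) .nil) .nil))
      (.pair (.snd (.snd (.var 0))) .nil))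
    .nil

/-- The greedy algorithm on the intervals of a list that start at `d` or later. -/
def greedy : Term :=
  .ifPair (.fst (.snd (.var 0)))
    (.bind (.fst (.fst (.snd (.var 0))))
      (.ifLt (.fst (.var 0)) (.fst (.fst (.var 1)))
        (.call 5 (.pair (.fst (.var 1)) (.pair (.snd (.fst (.snd (.var 1)))) (.snd (.snd (.var 1))))))
        (.bind (.call 4 (.pair (.fst (.var 0)) (.snd (.snd (.snd (.var 1))))))
          (.ifPair (.var 0)
            (.call 5 (.pair (.fst (.var 2)) (.pair (.snd (.fst (.snd (.var 2))))
              (.pair (.call 1 (.fst (.snd (.snd (.var 2)))))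
                (.pair (.pair (.snd (.var 1)) .nil) (.fst (.var 0)))))))
            (.call 5 (.pair (.fst (.var 2))
              (.pair (.snd (.fst (.snd (.var 2)))) (.snd (.snd (.var 2)))))))))) 
    (.snd (.snd (.var 0)))

/-- Insertion into a list that is sorted by keys. -/
def insertItem : Term :=
  .ifPair (.snd (.var 0))
    (.ifLt (.fst (.fst (.fst (.snd (.var 0))))) (.fst (.fst (.fst (.var 0))))
      (.pair (.fst (.snd (.var 0))) (.call 6 (.pair (.fst (.var 0)) (.snd (.snd (.var 0))))))
      (.pair (.fst (.var 0)) (.snd (.var 0))))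
    (.pair (.fst (.var 0)) .nil)

/-- The rows of a block with their keys. -/
def items : Term :=
  .ifPair (.snd (.var 0))
    (.bind (.pair (.fst (.fst (.snd (.var 0)))) .nil)
      (.call 6 (.pair
        (.pair (.var 0) (.pair .nil (.call 5 (.pair (.var 0)
          (.pair (.fst (.var 1)) (.pair .nil (.call 28 .nil)))))))
        (.call 7 (.pair (.fst (.var 1)) (.snd (.snd (.var 1))))))))
    (.pair (.pair .nil (.pair .nil (.pair .nil (.call 28 .nil)))) .nil)

/-- Joins the trees of a list in pairs. -/
def pairUp : Term :=
  .ifPair (.snd (.var 0))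
    (.pair (.pair (.fst (.fst (.snd (.var 0))))
        (.pair (.fst (.fst (.var 0))) (.pair (.snd (.fst (.var 0))) (.snd (.fst (.snd (.var 0)))))))
      (.call 8 (.snd (.snd (.var 0)))))
    (.var 0)

/-- Joins the trees of a list. -/
def build : Term :=
  .ifPair (.snd (.var 0)) (.call 9 (.call 8 (.var 0))) (.snd (.fst (.var 0)))

/-- Search in a tree. -/
def lookup : Term :=
  .ifPair (.fst (.snd (.var 0)))
    (.ifLt (.fst (.fst (.snd (.var 0)))) (.fst (.fst (.var 0)))
      (.call 10 (.pair (.fst (.var 0)) (.snd (.snd (.snd (.var 0))))))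
      (.call 10 (.pair (.fst (.var 0)) (.fst (.snd (.snd (.var 0)))))))
    (.snd (.snd (.var 0)))

/-- `fillBot`. -/
def fill : Term :=
  .ifPair (.snd (.var 0))
    (.pair (.ifPair (.fst (.snd (.var 0))) (.fst (.snd (.var 0))) (.fst (.var 0)))
      (.call 11 (.pair (.fst (.var 0)) (.snd (.snd (.var 0))))))
    .nil

/-- `zipMax`. -/
def zip : Term :=
  .ifPair (.fst (.var 0))
    (.ifPair (.snd (.var 0))
      (.pair (.ifLt (.fst (.fst (.fst (.var 0)))) (.fst (.fst (.snd (.var 0))))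
          (.fst (.snd (.var 0)))
          (.ifPair (.fst (.fst (.var 0))) (.fst (.fst (.var 0))) (.fst (.snd (.var 0)))))
        (.call 12 (.pair (.snd (.fst (.var 0))) (.snd (.snd (.var 0))))))
      (.fst (.var 0)))
    (.snd (.var 0))

/-- Drops as many entries as the difference of two numbers. -/
def shift : Term :=
  .ifPair (.snd (.snd (.var 0)))
    (.ifPair (.call 3 (.pair (.fst (.snd (.var 0))) (.fst (.var 0))))
      (.snd (.snd (.var 0)))
      (.call 13 (.pair (.call 1 (.fst (.var 0)))
        (.pair (.fst (.snd (.var 0))) (.snd (.snd (.snd (.var 0))))))))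
    .nil

/-- `join`. -/
def join : Term :=
  .ifPair (.call 3 (.pair (.fst (.fst (.var 0))) (.fst (.snd (.var 0)))))
    (.call 15 (.var 0)) (.call 15 (.pair (.snd (.var 0)) (.fst (.var 0))))

/-- `joinLE`. -/
def joinLE : Term :=
  .pair (.fst (.fst (.var 0)))
    (.call 12 (.pair (.snd (.fst (.var 0)))
      (.call 13 (.pair (.fst (.fst (.var 0))) (.snd (.var 0))))))

/-- `applyBlock`. -/
def apply : Term :=
  .ifPair (.snd (.snd (.var 0)))
    (.bind (.call 16 (.pair (.fst (.var 0))
        (.pair (.fst (.snd (.var 0))) (.snd (.snd (.snd (.var 0)))))))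
      (.bind (.call 10 (.pair (.fst (.snd (.snd (.var 1)))) (.fst (.var 1))))
        (.bind (.pair (.call 2 (.pair (.fst (.var 1)) (.fst (.var 0))))
            (.call 11 (.pair (.fst (.snd (.snd (.var 2)))) (.snd (.var 0)))))
          (.pair (.call 1 (.fst (.var 2)))
            (.ifPair (.snd (.var 2)) (.call 14 (.pair (.snd (.var 2)) (.var 0))) (.var 0))))))
    (.pair (.fst (.snd (.var 0))) .nil)

/-- The number of intervals that are accepted in a sequence of blocks. -/
def serve : Term :=
  .ifPair (.fst (.var 0))
    (.call 17 (.pair (.snd (.fst (.var 0)))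
      (.snd (.call 16 (.pair (.snd (.fst (.fst (.var 0)))) (.snd (.var 0)))))))
    (.fst (.snd (.var 0)))

/-- Splits a list after a given number of entries. -/
def split : Term :=
  .ifPair (.fst (.var 0))
    (.ifPair (.snd (.var 0))
      (.bind (.call 18 (.pair (.snd (.fst (.var 0))) (.snd (.snd (.var 0)))))
        (.pair (.pair (.fst (.snd (.var 1))) (.fst (.var 0))) (.snd (.var 0))))
      (.pair .nil .nil))
    (.pair .nil (.snd (.var 0)))

/-- Cuts a list into blocks. -/
def chunk : Term :=
  .ifPair (.snd (.var 0))
    (.bind (.call 18 (.var 0))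
      (.pair (.pair (.fst (.var 0)) (.call 9 (.call 7 (.pair (.fst (.var 0)) (.fst (.var 0))))))
        (.call 19 (.pair (.fst (.var 1)) (.snd (.var 0))))))
    .nil

/-- Performs an update of a sorted list. -/
def update : Term :=
  .ifPair (.snd (.var 0))
    (.ifPair (.call 21 (.pair (.fst (.snd (.var 0))) (.snd (.fst (.var 0)))))
      (.pair (.fst (.snd (.var 0))) (.call 20 (.pair (.fst (.var 0)) (.snd (.snd (.var 0))))))
      (.ifPair (.fst (.fst (.var 0)))
        (.pair (.snd (.fst (.var 0))) (.snd (.var 0)))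
        (.snd (.snd (.var 0)))))
    (.ifPair (.fst (.fst (.var 0))) (.pair (.snd (.fst (.var 0))) .nil) .nil)

/-- The order on intervals. -/
def lt : Term :=
  .ifLt (.snd (.fst (.var 0))) (.snd (.snd (.var 0))) one
    (.ifLt (.snd (.snd (.var 0))) (.snd (.fst (.var 0))) .nil
      (.ifLt (.fst (.fst (.var 0))) (.fst (.snd (.var 0))) one .nil))

/-- Performs an update in the appropriate block. -/
def walk : Term :=
  .ifPair (.snd (.snd (.snd (.var 0))))
    (.ifPair (.call 21 (.pair (.snd (.fst (.var 0)))
        (.fst (.fst (.fst (.snd (.snd (.snd (.var 0)))))))))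
      (.call 24 (.var 0))
      (.pair (.fst (.snd (.snd (.var 0))))
        (.call 22 (.pair (.fst (.var 0))
          (.pair (.fst (.snd (.var 0))) (.snd (.snd (.snd (.var 0)))))))))
    (.call 24 (.var 0))

/-- Concatenation. -/
def append : Term :=
  .ifPair (.fst (.var 0))
    (.pair (.fst (.fst (.var 0))) (.call 23 (.pair (.snd (.fst (.var 0))) (.snd (.var 0)))))
    (.snd (.var 0))

/-- Performs an update in the first block. -/
def here : Term :=
  .call 23 (.pair
    (.call 19 (.pair (.fst (.snd (.var 0)))
      (.call 20 (.pair (.fst (.var 0)) (.fst (.fst (.snd (.snd (.var 0)))))))))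
    (.snd (.snd (.snd (.var 0)))))

/-- The concatenation of all blocks. -/
def flatten : Term :=
  .ifPair (.var 0)
    (.call 23 (.pair (.fst (.fst (.var 0))) (.call 25 (.snd (.var 0))))) .nil

/-- A list one eighth as long. -/
def eighth : Term :=
  .bind (.snd (.snd (.snd (.snd (.snd (.snd (.snd (.var 0))))))))
    (.ifPair (.var 0) (.pair .nil (.call 26 (.snd (.var 0)))) .nil)

/-- The size of the blocks and the number of updates up to the next global rebuilding. -/
def params : Term :=
  .ifPair (.var 0)
    (.bind (.call 27 (.call 26 (.var 0)))
      (.pair (.call 23 (.pair (.fst (.var 0)) (.fst (.var 0))))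
        (.call 23 (.pair (.snd (.var 0)) (.call 23 (.pair (.snd (.var 0))
          (.call 23 (.pair (.snd (.var 0)) (.snd (.var 0))))))))))
    (.pair one one)

/-- The initial times of all machines. -/
def init : ℕ → Term
  | 0 => .nil
  | m + 1 => .pair .nil (init m)

/-- Performs an update and reports the number of accepted intervals. -/
def main : Term :=
  .bind
    (.ifPair (.fst (.snd (.var 0)))
      (.pair (.snd (.fst (.snd (.var 0))))
        (.pair (.fst (.snd (.snd (.var 0)))) (.call 22 (.pair (.fst (.var 0)) (.snd (.snd (.var 0)))))))
      (.bind (.call 20 (.pair (.fst (.var 0)) (.call 25 (.snd (.snd (.snd (.var 0)))))))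
        (.bind (.call 27 (.var 0))
          (.pair (.snd (.var 0)) (.pair (.fst (.var 0)) (.call 19 (.pair (.fst (.var 0)) (.var 1))))))))
    (.pair (.call 17 (.pair (.snd (.snd (.var 0))) (.pair .nil (.call 28 .nil)))) (.var 0))

end Body

/-- Calls refer to positions in this list. Only the last function depends on `m`; all others read
the number of machines off the length of the list of times. -/
def schedulingProgram (m : ℕ) : Program :=
  [Body.main, Body.inc, Body.add, Body.le, Body.remove, Body.greedy, Body.insertItem, Body.items,
    Body.pairUp, Body.build, Body.lookup, Body.fill, Body.zip, Body.shift, Body.join, Body.joinLE,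
    Body.apply, Body.serve, Body.split, Body.chunk, Body.update, Body.lt, Body.walk, Body.append,
    Body.here, Body.flatten, Body.eighth, Body.params, Body.init m]

section
variable (m : ℕ)
@[simp] theorem body_main : (schedulingProgram m).body 0 = Body.main := rfl
@[simp] theorem body_inc : (schedulingProgram m).body 1 = Body.inc := rfl
@[simp] theorem body_add : (schedulingProgram m).body 2 = Body.add := rfl
@[simp] theorem body_le : (schedulingProgram m).body 3 = Body.le := rfl
@[simp] theorem body_remove : (schedulingProgram m).body 4 = Body.remove := rfl
@[simp] theorem body_greedy : (schedulingProgram m).body 5 = Body.greedy := rfl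
@[simp] theorem body_insertItem : (schedulingProgram m).body 6 = Body.insertItem := rfl
@[simp] theorem body_items : (schedulingProgram m).body 7 = Body.items := rfl
@[simp] theorem body_pairUp : (schedulingProgram m).body 8 = Body.pairUp := rfl
@[simp] theorem body_build : (schedulingProgram m).body 9 = Body.build := rfl
@[simp] theorem body_lookup : (schedulingProgram m).body 10 = Body.lookup := rfl
@[simp] theorem body_fill : (schedulingProgram m).body 11 = Body.fill := rfl
@[simp] theorem body_zip : (schedulingProgram m).body 12 = Body.zip := rfl
@[simp] theorem body_shift : (schedulingProgram m).body 13 = Body.shift := rfl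
@[simp] theorem body_join : (schedulingProgram m).body 14 = Body.join := rfl
@[simp] theorem body_joinLE : (schedulingProgram m).body 15 = Body.joinLE := rfl
@[simp] theorem body_apply : (schedulingProgram m).body 16 = Body.apply := rfl
@[simp] theorem body_serve : (schedulingProgram m).body 17 = Body.serve := rfl
@[simp] theorem body_split : (schedulingProgram m).body 18 = Body.split := rfl
@[simp] theorem body_chunk : (schedulingProgram m).body 19 = Body.chunk := rfl
@[simp] theorem body_update : (schedulingProgram m).body 20 = Body.update := rfl
@[simp] theorem body_lt : (schedulingProgram m).body 21 = Body.lt := rfl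
@[simp] theorem body_walk : (schedulingProgram m).body 22 = Body.walk := rfl
@[simp] theorem body_append : (schedulingProgram m).body 23 = Body.append := rfl
@[simp] theorem body_here : (schedulingProgram m).body 24 = Body.here := rfl
@[simp] theorem body_flatten : (schedulingProgram m).body 25 = Body.flatten := rfl
@[simp] theorem body_eighth : (schedulingProgram m).body 26 = Body.eighth := rfl
@[simp] theorem body_params : (schedulingProgram m).body 27 = Body.params := rfl
@[simp] theorem body_init : (schedulingProgram m).body 28 = Body.init m := rfl
end

/-! ### Arithmetic of binary numbers -/

@[simp] theorem encNat_zero : encNat 0 = .nil := by simp [encNat]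

theorem encNat_odd (n : ℕ) : encNat (2 * n + 1) = .pair (.pair .nil .nil) (encNat n) := by
  simp [encNat, encBool]

theorem encNat_even {n : ℕ} (hn : n ≠ 0) : encNat (2 * n) = .pair .nil (encNat n) := by
  rw [encNat, Nat.bit0_bits n hn]
  rfl

/-- The even case excludes zero because `0` is encoded by the empty list of digits: a digit `0` in
front of it would not be a valid encoding. -/
theorem nat_cases (n : ℕ) : n = 0 ∨ (∃ k, k ≠ 0 ∧ n = 2 * k) ∨ ∃ k, n = 2 * k + 1 := by
  rcases Nat.even_or_odd' n with ⟨k, h | h⟩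
  · rcases Nat.eq_zero_or_pos k with rfl | hk
    exacts [Or.inl h, Or.inr (Or.inl ⟨k, hk.ne', h⟩)]
  · exact Or.inr (Or.inr ⟨k, h⟩)

variable {m : ℕ}

theorem runs_inc (w n : ℕ) (hn : n < 2 ^ w) :
    Runs (schedulingProgram m) 1 (encNat n) (encNat (n + 1)) (15 * (w + 1)) := by
  induction w generalizing n with
  | zero =>
    obtain rfl : n = 0 := by simpa using hn
    refine .of_wp ?_
    simp [Body.inc, Body.one, Wp, encNat, encBool]
  | succ w ih =>
    rw [pow_succ] at hn
    refine .of_wp ?_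
    rcases nat_cases n with rfl | ⟨k, hk, rfl⟩ | ⟨k, rfl⟩
    · simp [Body.inc, Body.one, Wp, encNat, encBool]
      omega
    · simp [Body.inc, Body.one, Wp, encNat_even hk, encNat_odd]
      omega
    · have e : 2 * k + 1 + 1 = 2 * (k + 1) := by ring
      rw [e, encNat_even (by omega), encNat_odd]
      simp [Body.inc, Body.one, Wp]
      exact ⟨_, _, ih k (by omega), fun u hu => ⟨rfl, by omega⟩⟩

/-- The carry is added by a separate increment at every digit, which makes the bound quadratic in
the number of digits; this costs only a logarithmic factor. -/
theorem runs_add (w a b : ℕ) (ha : a < 2 ^ w) (hb : b < 2 ^ w) :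
    Runs (schedulingProgram m) 2 (.pair (encNat a) (encNat b)) (encNat (a + b))
      (60 * (w + 1) ^ 2) := by
  induction w generalizing a b with
  | zero =>
    obtain rfl : a = 0 := by simpa using ha
    refine .of_wp ?_
    simp [Body.add, Wp]
  | succ w ih =>
    rw [pow_succ] at ha hb
    have hT : 60 * (w + 1 + 1) ^ 2 = 60 * (w + 1) ^ 2 + 120 * w + 180 := by ring
    rw [hT]
    refine .of_wp ?_
    rcases nat_cases a with rfl | ⟨a, ha', rfl⟩ | ⟨a, rfl⟩
    · simp [Body.add, Wp]
    · rcases nat_cases b with rfl | ⟨b, hb', rfl⟩ | ⟨b, rfl⟩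
      · simp [Body.add, Wp, encNat_even ha']
      · have e : 2 * a + 2 * b = 2 * (a + b) := by ring
        rw [e, encNat_even ha', encNat_even hb', encNat_even (by omega)]
        simp [Body.add, Wp]
        exact ⟨_, _, ih a b (by omega) (by omega), fun u hu => ⟨rfl, by omega⟩⟩
      · have e : 2 * a + (2 * b + 1) = 2 * (a + b) + 1 := by ring
        rw [e, encNat_even ha', encNat_odd, encNat_odd]
        simp [Body.add, Wp]
        exact ⟨_, _, ih a b (by omega) (by omega), fun u hu => ⟨rfl, by omega⟩⟩
    · rcases nat_cases b with rfl | ⟨b, hb', rfl⟩ | ⟨b, rfl⟩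
      · simp [Body.add, Wp, encNat_odd]
      · have e : 2 * a + 1 + 2 * b = 2 * (a + b) + 1 := by ring
        rw [e, encNat_even hb', encNat_odd, encNat_odd]
        simp [Body.add, Body.one, Wp]
        exact ⟨_, _, ih a b (by omega) (by omega), fun u hu => ⟨rfl, by omega⟩⟩
      · have e : 2 * a + 1 + (2 * b + 1) = 2 * (a + b + 1) := by ring
        rw [e, encNat_even (by omega), encNat_odd, encNat_odd]
        simp [Body.add, Wp]
        exact ⟨_, _, ih a b (by omega) (by omega), fun u hu =>
          ⟨_, _, runs_inc (w + 1) (a + b) (by rw [pow_succ]; omega), fun u' hu' => ⟨rfl, by omega⟩⟩⟩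

theorem runs_le (w a b : ℕ) (ha : a < 2 ^ w) (hb : b < 2 ^ w) :
    Runs (schedulingProgram m) 3 (.pair (encNat a) (encNat b)) (encBool (decide (a ≤ b)))
      (30 * (w + 1)) := by
  induction w generalizing a b with
  | zero =>
    obtain rfl : a = 0 := by simpa using ha
    refine .of_wp ?_
    simp [Body.le, Body.one, Wp, encBool]
  | succ w ih =>
    rw [pow_succ] at ha hb
    refine .of_wp ?_
    rcases nat_cases a with rfl | ⟨a, ha', rfl⟩ | ⟨a, rfl⟩
    · simp [Body.le, Body.one, Wp, encBool]
      omega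
    · rcases nat_cases b with rfl | ⟨b, hb', rfl⟩ | ⟨b, rfl⟩
      · simp [Body.le, Wp, encNat_even ha', encBool, ha']
        omega
      · have e : (2 * a ≤ 2 * b) ↔ a ≤ b := by omega
        rw [encNat_even ha', encNat_even hb']
        simp only [e]
        simp [Body.le, Wp]
        exact ⟨_, _, ih a b (by omega) (by omega), fun u hu => ⟨rfl, by omega⟩⟩
      · have e : (2 * a ≤ 2 * b + 1) ↔ a ≤ b := by omega
        rw [encNat_even ha', encNat_odd]
        simp only [e]
        simp [Body.le, Wp]
        exact ⟨_, _, ih a b (by omega) (by omega), fun u hu => ⟨rfl, by omega⟩⟩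
    · rcases nat_cases b with rfl | ⟨b, hb', rfl⟩ | ⟨b, rfl⟩
      · simp [Body.le, Wp, encNat_odd, encBool]
        omega
      -- The last digits decide a tie the other way, so the recursive call swaps the arguments and
      -- negates the result.
      · have e : (2 * a + 1 ≤ 2 * b) ↔ ¬ b ≤ a := by omega
        rw [encNat_even hb', encNat_odd]
        simp only [e]
        simp [Body.le, Wp]
        refine ⟨_, _, ih b a (by omega) (by omega), fun u hu => ?_⟩
        by_cases h : b ≤ a
        · simp [h, encBool, not_lt.2 h]
          omega
        · simp [h, encBool, Body.one, Wp, not_le.1 h]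
          omega
      · have e : (2 * a + 1 ≤ 2 * b + 1) ↔ a ≤ b := by omega
        rw [encNat_odd, encNat_odd]
        simp only [e]
        simp [Body.le, Wp]
        exact ⟨_, _, ih a b (by omega) (by omega), fun u hu => ⟨rfl, by omega⟩⟩

/-! ### Operations on states -/

/-- Times are encoded as options, with the infinite times as `none`. -/
def encTime (r : EReal) : Val :=
  open Classical in if r = ⊥ ∨ r = ⊤ then .nil else .pair (.key r.toReal) .nil

@[simp] theorem encTime_bot : encTime ⊥ = .nil := by simp [encTime]

@[simp] theorem encTime_top : encTime ⊤ = .nil := by simp [encTime]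

@[simp] theorem encTime_coe (x : ℝ) : encTime x = .pair (.key x) .nil := by simp [encTime]

abbrev encTimes (R : List EReal) : Val := encList encTime R

def encState (s : ℕ × List EReal) : Val := .pair (encNat s.1) (encTimes s.2)

/-- Both infinities are encoded by `nil`, and a comparison with `nil` is false. This is the right
answer for `⊤` on the left and for `⊥` on the right. -/
theorem keyLt_encTime {a b : EReal} (ha : a ≠ ⊥) (hb : b ≠ ⊤) :
    (encTime a).fst.KeyLt (encTime b).fst ↔ a < b := by
  induction a with
  | bot => exact absurd rfl ha
  | top => simp
  | coe a =>
    induction b with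
    | bot => simp
    | top => exact absurd rfl hb
    | coe b => simp

theorem isPair_encTime {a : EReal} (ha : a ≠ ⊤) : (encTime a).IsPair ↔ a ≠ ⊥ := by
  induction a with
  | bot => simp
  | top => exact absurd rfl ha
  | coe a => simp

def encRemoved : Option (List EReal) → Val
  | none => .nil
  | some R => .pair (encTimes R) .nil

theorem runs_remove (a : ℝ) (R : List EReal) (hR : ∀ r ∈ R, r ≠ ⊤) :
    Runs (schedulingProgram m) 4 (.pair (.key a) (encTimes R)) (encRemoved (removeLE a R))
      (40 * (R.length + 1)) := by
  induction R with
  | nil => exact .of_wp (by simp [Body.remove, Wp, removeLE, encRemoved])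
  | cons t R ih =>
    rw [List.forall_mem_cons] at hR
    have hk := keyLt_encTime (EReal.coe_ne_bot a) hR.1
    rw [encTime_coe] at hk
    refine .of_wp ?_
    rw [body_remove, encTimes, encList_cons]
    simp only [Body.remove, Wp, List.getD_cons_zero, List.getD_cons_succ, Val.snd_pair, Val.fst_pair,
      Val.isPair_pair, Val.isPair_nil, true_implies, not_true, false_implies, and_true] at hk ⊢
    rw [hk, removeLE]
    by_cases h : (a : EReal) < t
    · simp only [h, true_implies, not_true, false_implies, and_true, if_true]
      refine ⟨_, _, ih hR.2, fun u hu => ?_⟩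
      cases removeLE a R with
      | none => simp [encRemoved]; omega
      | some R' => simp [encRemoved]; omega
    · simp only [h, false_implies, not_false_iff, true_implies, true_and, if_false, encRemoved,
        List.length_cons]
      omega

theorem length_greedyStep (s : ℕ × List EReal) (J : Ival) :
    (greedyStep s J).2.length = s.2.length := by
  unfold greedyStep
  cases h : removeLE J.start s.2 with
  | none => rfl
  | some R' =>
    have : ∀ R R' : List EReal, removeLE J.start R = some R' → R'.length + 1 = R.length := by
      intro R
      induction R with
      | nil => intro R' h; simp [removeLE] at h
      | cons t R ih =>
        intro R' h
        unfold removeLE at h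
        split_ifs at h
        · obtain ⟨R'', h1, rfl⟩ := Option.map_eq_some_iff.1 h
          simp [ih R'' h1]
        · cases h
          rfl
    simpa using this _ _ h

theorem greedyStep_ne_top {s : ℕ × List EReal} (hs : ∀ r ∈ s.2, r ≠ ⊤) (J : Ival) :
    ∀ r ∈ (greedyStep s J).2, r ≠ ⊤ := by
  unfold greedyStep
  cases h : removeLE J.start s.2 with
  | none => exact hs
  | some R' =>
    exact List.forall_mem_cons.2 ⟨EReal.coe_ne_top _, fun r hr =>
      hs r ((removeLE_sublist h).subset hr)⟩

theorem greedyStep_fst_le (s : ℕ × List EReal) (J : Ival) : (greedyStep s J).1 ≤ s.1 + 1 := by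
  unfold greedyStep
  cases h : removeLE J.start s.2 with
  | none => exact Nat.le_succ _
  | some R' => exact le_rfl

theorem foldl_greedyStep_bounds (L : List Ival) (s : ℕ × List EReal) (hs : ∀ r ∈ s.2, r ≠ ⊤) :
    (L.foldl greedyStep s).1 ≤ s.1 + L.length ∧ (L.foldl greedyStep s).2.length = s.2.length ∧
      ∀ r ∈ (L.foldl greedyStep s).2, r ≠ ⊤ := by
  induction L generalizing s with
  | nil => exact ⟨le_rfl, rfl, hs⟩
  | cons J L ih =>
    obtain ⟨h1, h2, h3⟩ := ih (greedyStep s J) (greedyStep_ne_top hs J)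
    have := greedyStep_fst_le s J
    exact ⟨by simp only [List.foldl_cons, List.length_cons]; omega,
      h2.trans (length_greedyStep s J), h3⟩

theorem blockRow_bounds (m : ℕ) (L : List Ival) (d : EReal) :
    (blockRow m L d).1 ≤ L.length ∧ (blockRow m L d).2.length = m ∧
      ∀ r ∈ (blockRow m L d).2, r ≠ ⊤ := by
  classical
  obtain ⟨h1, h2, h3⟩ := foldl_greedyStep_bounds (L.filter fun J => d ≤ (J.start : EReal))
    (initState m) fun r hr => by rw [List.eq_of_mem_replicate hr]; exact bot_ne_top
  refine ⟨h1.trans ?_, h2.trans (by simp [initState]), h3⟩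
  have := List.length_filter_le (fun J : Ival => decide (d ≤ (J.start : EReal))) L
  simp only [initState]
  omega

/-- `D` bounds both the digits of the counter and the number of machines, so that an increment and a
removal both take time linear in `D`. -/
theorem runs_greedy {D : ℕ} (d : EReal) (hd : d ≠ ⊤) (L : List Ival) (s : ℕ × List EReal)
    (hs : ∀ r ∈ s.2, r ≠ ⊤) (hF : s.1 + L.length < 2 ^ D) (hD : s.2.length + 1 ≤ D) :
    Runs (schedulingProgram m) 5
      (.pair (encTime d) (.pair (encList encIval L) (encState s)))
      (encState (open Classical in
        (L.filter fun J => d ≤ (J.start : EReal)).foldl greedyStep s))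
      (150 * D * (L.length + 1)) := by
  classical
  induction L generalizing s with
  | nil =>
    refine .of_wp ?_
    simp [Body.greedy, Wp]
    omega
  | cons J L ih =>
    have hk := keyLt_encTime (EReal.coe_ne_bot J.start) hd
    rw [encTime_coe] at hk
    have hT : 150 * D * ((J :: L).length + 1) = 150 * D * (L.length + 1) + 150 * D := by
      rw [List.length_cons]; ring
    rw [List.length_cons] at hF
    rw [hT]
    refine .of_wp ?_
    rw [body_greedy]
    simp only [Body.greedy, Wp, List.getD_cons_zero, List.getD_cons_succ, Val.snd_pair, Val.fst_pair,
      Val.isPair_pair, Val.isPair_nil, true_implies, not_true, false_implies, and_true, encList_cons, encIval,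
      encState] at hk ⊢
    rw [hk]
    by_cases h : (J.start : EReal) < d
    · rw [List.filter_cons_of_neg (by simpa using h)]
      simp only [h, true_implies, not_true, false_implies, and_true]
      refine ⟨_, _, ih s hs (by omega) hD, fun u hu => ⟨rfl, ?_⟩⟩
      omega
    · rw [List.filter_cons_of_pos (by simpa using h)]
      simp only [h, false_implies, not_false_iff, true_implies, true_and]
      refine ⟨_, _, runs_remove J.start s.2 hs, fun u hu => ?_⟩
      rw [List.foldl_cons]
      have ih' := ih (greedyStep s J) (greedyStep_ne_top hs J)
        (by have := greedyStep_fst_le s J; omega) (by rw [length_greedyStep]; exact hD)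
      cases h1 : removeLE J.start s.2 with
      | none =>
        have e : greedyStep s J = s := by simp [greedyStep, h1]
        rw [e] at ih' ⊢
        simp only [encRemoved, Val.isPair_pair, Val.isPair_nil, false_implies, not_false_iff, true_implies, true_and]
        refine ⟨_, _, ih', fun u' hu' => ⟨rfl, ?_⟩⟩
        omega
      | some R' =>
        have e : greedyStep s J = (s.1 + 1, (J.finish : EReal) :: R') := by simp [greedyStep, h1]
        rw [e] at ih' ⊢
        simp only [encRemoved, Val.isPair_pair, Val.isPair_nil, not_true, true_implies, false_implies, and_true, Val.fst_pair]
        refine ⟨_, _, runs_inc D s.1 (by omega), fun u1 hu1 => ?_⟩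
        simp only [encState, encTimes, encList_cons, encTime_coe] at ih'
        refine ⟨_, _, ih', fun u' hu' => ⟨rfl, ?_⟩⟩
        omega

theorem wp_init (P : Program) (k : ℕ) (ρ : List Val) (Q : Val → ℕ → Prop) :
    Wp P (Body.init k) ρ Q ↔ Q (encTimes (List.replicate k ⊥)) (2 * k + 1) := by
  induction k generalizing Q with
  | zero => simp [Body.init, Wp]
  | succ k ih =>
    simp only [Body.init, Wp, ih, List.replicate_succ, encTimes, encList_cons, encTime_bot]
    have : 1 + (2 * k + 1) + 1 = 2 * (k + 1) + 1 := by ring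
    rw [this]

theorem runs_init (v : Val) :
    Runs (schedulingProgram m) 28 v (encTimes (List.replicate m ⊥)) (2 * m + 1) :=
  .of_wp (by rw [body_init, wp_init]; exact ⟨rfl, le_rfl⟩)

theorem runs_fill (d : EReal) (R : List EReal) (hR : ∀ r ∈ R, r ≠ ⊤) :
    Runs (schedulingProgram m) 11 (.pair (encTime d) (encTimes R)) (encTimes (fillBot d R))
      (30 * (R.length + 1)) := by
  induction R with
  | nil => exact .of_wp (by simp [Body.fill, Wp, fillBot])
  | cons r R ih =>
    rw [List.forall_mem_cons] at hR
    have hp := isPair_encTime hR.1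
    refine .of_wp ?_
    have e : fillBot d (r :: R) = (if r = ⊥ then d else r) :: fillBot d R := rfl
    rw [body_fill, e]
    simp only [Body.fill, Wp, List.getD_cons_zero, Val.snd_pair, Val.fst_pair, encTimes, List.length_cons,
      Val.isPair_pair, Val.isPair_nil, true_implies, not_true, false_implies, and_true, encList_cons]
    refine ⟨fun h => ⟨_, _, ih hR.2, fun u hu => ⟨?_, by omega⟩⟩,
      fun h => ⟨_, _, ih hR.2, fun u hu => ⟨?_, by omega⟩⟩⟩
    · rw [hp] at h
      rw [if_neg h]
    · rw [hp, not_not] at h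
      rw [if_pos h]

theorem runs_zip (A B : List EReal) (hA : ∀ r ∈ A, r ≠ ⊤) (hB : ∀ r ∈ B, r ≠ ⊤) :
    Runs (schedulingProgram m) 12 (.pair (encTimes A) (encTimes B)) (encTimes (zipMax A B))
      (40 * (A.length + 1)) := by
  induction A generalizing B with
  | nil => exact .of_wp (by simp [Body.zip, Wp, zipMax])
  | cons a A ih =>
    cases B with
    | nil => exact .of_wp (by simp [Body.zip, Wp, zipMax]; omega)
    | cons b B =>
      rw [List.forall_mem_cons] at hA hB
      refine .of_wp ?_
      rw [body_zip, zipMax]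
      have hp := isPair_encTime hA.1
      simp only [Body.zip, Wp, List.getD_cons_zero, Val.snd_pair, Val.fst_pair, encTimes, List.length_cons,
        Val.isPair_pair, Val.isPair_nil, true_implies, not_true, false_implies, and_true, encList_cons]
      refine ⟨fun h => ?_, fun h => ⟨fun h' => ?_, fun h' => ?_⟩⟩
      · refine ⟨_, _, ih B hA.2 hB.2, fun u hu => ⟨?_, by omega⟩⟩
        have hab : a < b := by
          by_cases ha : a = ⊥
          · simp [ha] at h
          · exact (keyLt_encTime ha hB.1).1 h
        rw [max_eq_right hab.le]
      · refine ⟨_, _, ih B hA.2 hB.2, fun u hu => ⟨?_, by omega⟩⟩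
        rw [keyLt_encTime (hp.1 h') hB.1, not_lt] at h
        rw [max_eq_left h]
      · refine ⟨_, _, ih B hA.2 hB.2, fun u hu => ⟨?_, by omega⟩⟩
        rw [hp, not_not] at h'
        rw [h', max_eq_right bot_le]

/-- Subtraction is avoided: `F` is incremented while entries are dropped, and the loop ends when `F`
reaches `G` or the list is exhausted. The time is thus governed by the length of `R` and not by `G -
F`. -/
theorem runs_shift {D : ℕ} (F G : ℕ) (hFG : F ≤ G) (hG : G < 2 ^ D) (hD : 1 ≤ D) (R : List EReal) :
    Runs (schedulingProgram m) 13 (.pair (encNat F) (.pair (encNat G) (encTimes R)))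
      (encTimes (R.drop (G - F))) (150 * D * (R.length + 1)) := by
  induction R generalizing F with
  | nil =>
    refine .of_wp ?_
    simp [Body.shift, Wp]
    omega
  | cons r R ih =>
    have hT : 150 * D * ((r :: R).length + 1) = 150 * D * (R.length + 1) + 150 * D := by
      rw [List.length_cons]; ring
    rw [hT]
    refine .of_wp ?_
    rw [body_shift]
    simp only [Body.shift, Wp, List.getD_cons_zero, Val.snd_pair, Val.fst_pair, encTimes,
      Val.isPair_pair, Val.isPair_nil, true_implies, not_true, false_implies, and_true, encList_cons]
    refine ⟨_, _, runs_le D G F hG (by omega), fun u hu => ?_⟩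
    by_cases h : G ≤ F
    · obtain rfl : F = G := le_antisymm hFG h
      simp [encBool]
      omega
    · simp only [h, decide_false, encBool, Val.isPair_pair, Val.isPair_nil, false_implies, not_false_iff, true_implies,
        true_and]
      refine ⟨_, _, runs_inc D F (by omega), fun u1 hu1 =>
        ⟨_, _, ih (F + 1) (by omega), fun u2 hu2 => ⟨?_, by omega⟩⟩⟩
      obtain ⟨k, rfl⟩ : ∃ k, G = F + 1 + k := ⟨G - (F + 1), by omega⟩
      rw [show F + 1 + k - F = k + 1 by omega, List.drop_succ_cons, Nat.add_sub_cancel_left]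

theorem runs_joinLE {D : ℕ} (s t : ℕ × List EReal) (hst : s.1 ≤ t.1) (ht : t.1 < 2 ^ D)
    (hs' : ∀ r ∈ s.2, r ≠ ⊤) (ht' : ∀ r ∈ t.2, r ≠ ⊤) (hsD : s.2.length + 1 ≤ D)
    (htD : t.2.length + 1 ≤ D) :
    Runs (schedulingProgram m) 15 (.pair (encState s) (encState t)) (encState (joinLE s t))
      (250 * D ^ 2) := by
  refine .of_wp ?_
  rw [body_joinLE]
  simp only [Body.joinLE, Wp, List.getD_cons_zero, Val.snd_pair, Val.fst_pair, encState]
  refine ⟨_, _, runs_shift s.1 t.1 hst ht (by omega) t.2, fun u hu =>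
    ⟨_, _, runs_zip s.2 _ hs' (fun r hr => ht' r (List.mem_of_mem_drop hr)), fun u1 hu1 =>
    ⟨rfl, ?_⟩⟩⟩
  have h1 : 150 * D * (t.2.length + 1) ≤ 150 * D * D := Nat.mul_le_mul_left _ htD
  have h2 : 1 ≤ D := by omega
  have h3 : 40 * (s.2.length + 1) ≤ 40 * D := by omega
  nlinarith

theorem runs_join {D : ℕ} (s t : ℕ × List EReal) (hs : s.1 < 2 ^ D) (ht : t.1 < 2 ^ D)
    (hs' : ∀ r ∈ s.2, r ≠ ⊤) (ht' : ∀ r ∈ t.2, r ≠ ⊤) (hsD : s.2.length + 1 ≤ D)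
    (htD : t.2.length + 1 ≤ D) :
    Runs (schedulingProgram m) 14 (.pair (encState s) (encState t)) (encState (join s t))
      (400 * D ^ 2) := by
  refine .of_wp ?_
  rw [body_join]
  simp only [Body.join, Wp, List.getD_cons_zero, Val.snd_pair, Val.fst_pair, encState]
  refine ⟨_, _, runs_le D s.1 t.1 hs ht, fun u hu => ?_⟩
  have h2 : 1 ≤ D := by omega
  rw [DIS.join]
  by_cases h : s.1 ≤ t.1
  · simp only [h, decide_true, encBool, Val.isPair_pair, Val.isPair_nil, true_implies, not_true, false_implies, and_true,
      if_true]
    refine ⟨_, _, runs_joinLE s t h ht hs' ht' hsD htD, fun u1 hu1 => ⟨rfl, ?_⟩⟩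
    nlinarith
  · simp only [h, decide_false, encBool, Val.isPair_pair, Val.isPair_nil, false_implies, not_false_iff, true_implies,
      true_and, if_false]
    refine ⟨_, _, runs_joinLE t s (by omega) hs ht' hs' htD hsD, fun u1 hu1 => ⟨rfl, ?_⟩⟩
    nlinarith

/-! ### Search trees for the rows of a block -/

/-- Trees with states in the leaves and keys in the inner nodes. -/
inductive RowTree where
  | leaf (s : ℕ × List EReal)
  | node (k : ℝ) (l r : RowTree)

def RowTree.depth : RowTree → ℕ
  | .leaf _ => 0
  | .node _ l r => max l.depth r.depth + 1

open Classical in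
def RowTree.lookup (d : EReal) : RowTree → ℕ × List EReal
  | .leaf s => s
  | .node k l r => if (k : EReal) < d then r.lookup d else l.lookup d

def RowTree.enc : RowTree → Val
  | .leaf s => .pair .nil (encState s)
  | .node k l r => .pair (.pair (.key k) .nil) (.pair l.enc r.enc)

theorem runs_lookup (d : EReal) (hd : d ≠ ⊤) (t : RowTree) :
    Runs (schedulingProgram m) 10 (.pair (encTime d) t.enc) (encState (t.lookup d))
      (30 * (t.depth + 1)) := by
  induction t with
  | leaf s =>
    refine .of_wp ?_
    simp [Body.lookup, Wp, RowTree.enc, RowTree.lookup]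
    omega
  | node k l r ihl ihr =>
    have hk := keyLt_encTime (EReal.coe_ne_bot k) hd
    rw [encTime_coe, Val.fst_pair] at hk
    refine .of_wp ?_
    rw [body_lookup]
    simp only [Body.lookup, Wp, List.getD_cons_zero, Val.snd_pair, Val.fst_pair, RowTree.enc,
      Val.isPair_pair, true_implies, not_true, false_implies, and_true, hk, RowTree.lookup,
      RowTree.depth]
    refine ⟨fun h => ⟨_, _, ihr, fun u hu => ⟨by rw [if_pos h], ?_⟩⟩,
      fun h => ⟨_, _, ihl, fun u hu => ⟨by rw [if_neg h], ?_⟩⟩⟩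
    · have := le_max_right l.depth r.depth
      omega
    · have := le_max_left l.depth r.depth
      omega

def encItem (i : EReal × RowTree) : Val := .pair (encTime i.1) i.2.enc

/-- Search in a list of trees with keys: the first key that is at least `d` counts. -/
def lookupList (d : EReal) : List (EReal × RowTree) → ℕ × List EReal
  | [] => (0, [])
  | [i] => i.2.lookup d
  | i :: j :: l => open Classical in if i.1 < d then lookupList d (j :: l) else i.2.lookup d

/-- Lists of trees whose keys ascend; all keys but the last one are real numbers. -/
structure SortedItems (l : List (EReal × RowTree)) : Prop where
  sorted : l.Pairwise fun i j => i.1 ≤ j.1 ∧ i.1 ≠ ⊤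
  ne_bot : ∀ i ∈ l, i.1 ≠ ⊥

theorem SortedItems.tail {i : EReal × RowTree} {l : List (EReal × RowTree)}
    (h : SortedItems (i :: l)) : SortedItems l :=
  ⟨(List.pairwise_cons.1 h.sorted).2, fun j hj => h.ne_bot j (by simp [hj])⟩

/-- The left key, the largest one on the left, becomes the separator; the right key stays the
largest one of the joined tree. A last key `⊤` is never a separator, so `toReal` loses nothing. -/
def pairUp : List (EReal × RowTree) → List (EReal × RowTree)
  | i :: j :: l => (j.1, .node i.1.toReal i.2 j.2) :: pairUp l
  | l => l

theorem length_pairUp : ∀ l : List (EReal × RowTree), (pairUp l).length = (l.length + 1) / 2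
  | [] => rfl
  | [_] => by simp [pairUp]
  | _ :: _ :: l => by
    simp only [pairUp, List.length_cons, length_pairUp l]
    omega

theorem mem_pairUp_key : ∀ (l : List (EReal × RowTree)), ∀ i ∈ pairUp l, ∃ j ∈ l, i.1 = j.1
  | [], i, h => absurd h List.not_mem_nil
  | [a], i, h => ⟨i, h, rfl⟩
  | a :: b :: l, i, h => by
    rcases List.mem_cons.1 h with rfl | h
    · exact ⟨b, by simp, rfl⟩
    · obtain ⟨j, hj, e⟩ := mem_pairUp_key l i h
      exact ⟨j, by simp [hj], e⟩

theorem SortedItems.pairUp : ∀ {l : List (EReal × RowTree)}, SortedItems l →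
    SortedItems (DIS.pairUp l)
  | [], h => h
  | [_], h => h
  | a :: b :: l, h => by
    have ih := h.tail.tail.pairUp
    refine ⟨List.pairwise_cons.2 ⟨fun i hi => ?_, ih.sorted⟩, ?_⟩
    · obtain ⟨j, hj, e⟩ := mem_pairUp_key l i hi
      rw [e]
      exact (List.pairwise_cons.1 h.tail.sorted).1 j hj
    · exact List.forall_mem_cons.2 ⟨h.ne_bot b (by simp), ih.ne_bot⟩

theorem depth_pairUp (n : ℕ) : ∀ (l : List (EReal × RowTree)), (∀ i ∈ l, i.2.depth ≤ n) →
    ∀ i ∈ pairUp l, i.2.depth ≤ n + 1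
  | [], _, i, hi => absurd hi List.not_mem_nil
  | [a], h, i, hi => (h i hi).trans (Nat.le_succ n)
  | a :: b :: l, h, i, hi => by
    rcases List.mem_cons.1 hi with rfl | hi
    · simp only [RowTree.depth]
      have := h a (by simp)
      have := h b (by simp)
      omega
    · exact depth_pairUp n l (fun j hj => h j (by simp [hj])) i hi

theorem pairUp_ne_nil {i : EReal × RowTree} {l : List (EReal × RowTree)} :
    pairUp (i :: l) ≠ [] := by
  cases l <;> simp [pairUp]

theorem lookupList_cons {d : EReal} {i : EReal × RowTree} {l : List (EReal × RowTree)}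
    (hl : l ≠ []) : lookupList d (i :: l) =
      open Classical in if i.1 < d then lookupList d l else i.2.lookup d := by
  cases l with
  | nil => exact absurd rfl hl
  | cons j l => rfl

theorem SortedItems.coe_toReal {i j : EReal × RowTree} {l : List (EReal × RowTree)}
    (h : SortedItems (i :: j :: l)) : ((i.1.toReal : ℝ) : EReal) = i.1 :=
  EReal.coe_toReal ((List.pairwise_cons.1 h.sorted).1 j (by simp)).2 (h.ne_bot i (by simp))

theorem lookupList_pairUp (d : EReal) : ∀ (l : List (EReal × RowTree)), SortedItems l →
    lookupList d (pairUp l) = lookupList d l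
  | [], _ => rfl
  | [_], _ => rfl
  | [a, b], h => by
    simp only [pairUp, lookupList, RowTree.lookup, h.coe_toReal]
  | a :: b :: c :: l, h => by
    classical
    have ih := lookupList_pairUp d (c :: l) h.tail.tail
    have hab := ((List.pairwise_cons.1 h.sorted).1 b (by simp)).1
    rw [pairUp, lookupList_cons pairUp_ne_nil, ih, lookupList, lookupList]
    simp only [RowTree.lookup, h.coe_toReal]
    by_cases h1 : b.1 < d
    · simp [h1, hab.trans_lt h1]
    · simp [h1]

theorem runs_pairUp : ∀ (l : List (EReal × RowTree)), SortedItems l →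
    Runs (schedulingProgram m) 8 (encList encItem l) (encList encItem (pairUp l))
      (30 * (l.length + 1))
  | [], _ => .of_wp (by simp [Body.pairUp, Wp, pairUp])
  | [_], _ => .of_wp (by simp [Body.pairUp, Wp, pairUp])
  | a :: b :: l, h => by
    have e : encTime a.1 = .pair (.key a.1.toReal) .nil := by
      rw [← encTime_coe, h.coe_toReal]
    refine .of_wp ?_
    simp [Body.pairUp, Wp, pairUp, encItem, RowTree.enc, e]
    exact ⟨_, _, runs_pairUp l h.tail.tail, fun u hu => ⟨rfl, by omega⟩⟩

/-- Each round of pairing halves the list and deepens the trees by one, so the total time is a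
geometric sum and the depth grows by at most `e`. -/
theorem runs_build (e : ℕ) (l : List (EReal × RowTree)) (h : SortedItems l) (hne : l ≠ [])
    (n : ℕ) (hn : ∀ i ∈ l, i.2.depth ≤ n) (he : l.length ≤ 2 ^ e) :
    ∃ t : RowTree, Runs (schedulingProgram m) 9 (encList encItem l) t.enc (200 * l.length) ∧
      t.depth ≤ n + e ∧ ∀ d, t.lookup d = lookupList d l := by
  induction e generalizing l n with
  | zero =>
    cases l with
    | nil => exact absurd rfl hne
    | cons i l =>
      have : l = [] := by simpa using he
      subst this
      refine ⟨i.2, .of_wp ?_, hn i (by simp), fun d => rfl⟩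
      simp [Body.build, Wp, encItem]
  | succ e ih =>
    match l, hne with
    | [i], _ =>
      refine ⟨i.2, .of_wp ?_, (hn i (by simp)).trans (by omega), fun d => rfl⟩
      simp [Body.build, Wp, encItem]
    | i :: j :: l, _ =>
      have hlen := length_pairUp (i :: j :: l)
      rw [pow_succ] at he
      obtain ⟨t, h1, h2, h3⟩ := ih (pairUp (i :: j :: l)) h.pairUp pairUp_ne_nil (n + 1)
        (depth_pairUp n _ hn) (by omega)
      refine ⟨t, .of_wp ?_, by omega, fun d => (h3 d).trans (lookupList_pairUp d _ h)⟩
      have h4 := runs_pairUp (m := m) _ h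
      rw [encList_cons, encList_cons] at h4
      simp only [List.length_cons] at h4 hlen ⊢
      simp [Body.build, Wp]
      exact ⟨_, _, h4, fun u hu => ⟨_, _, h1, fun u1 hu1 => ⟨rfl, by omega⟩⟩⟩

/-! ### The rows of a block, keyed by the starts of its intervals -/

open Classical in
def insertItem (x : EReal × RowTree) : List (EReal × RowTree) → List (EReal × RowTree)
  | [] => [x]
  | y :: l => if y.1 < x.1 then y :: insertItem x l else x :: y :: l

theorem insertItem_perm (x : EReal × RowTree) (l : List (EReal × RowTree)) :
    (insertItem x l).Perm (x :: l) := by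
  induction l with
  | nil => exact .refl _
  | cons y l ih =>
    unfold insertItem
    split_ifs
    · exact (ih.cons y).trans (.swap _ _ _)
    · exact .refl _

theorem SortedItems.insertItem {x : EReal × RowTree} {l : List (EReal × RowTree)}
    (h : SortedItems l) (hx : x.1 ≠ ⊤) (hx' : x.1 ≠ ⊥) : SortedItems (insertItem x l) := by
  refine ⟨?_, fun i hi => ?_⟩
  · have hs := h.sorted
    clear h
    induction l with
    | nil => simp [DIS.insertItem]
    | cons y l ih =>
      have h := List.pairwise_cons.1 hs
      unfold DIS.insertItem
      split_ifs with hy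
      · refine List.pairwise_cons.2 ⟨fun i hi => ?_, ih h.2⟩
        rcases List.mem_cons.1 ((insertItem_perm x l).mem_iff.1 hi) with rfl | hi
        exacts [⟨hy.le, hy.ne_top⟩, h.1 i hi]
      · refine List.pairwise_cons.2 ⟨fun i hi => ⟨?_, hx⟩, hs⟩
        rcases List.mem_cons.1 hi with rfl | hi
        exacts [not_lt.1 hy, (not_lt.1 hy).trans (h.1 i hi).1]
  · rcases List.mem_cons.1 ((insertItem_perm x l).mem_iff.1 hi) with rfl | hi
    exacts [hx', h.ne_bot i hi]

theorem runs_insertItem (x : EReal × RowTree) (l : List (EReal × RowTree)) (hx : x.1 ≠ ⊤)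
    (h : ∀ i ∈ l, i.1 ≠ ⊥) :
    Runs (schedulingProgram m) 6 (.pair (encItem x) (encList encItem l))
      (encList encItem (insertItem x l)) (30 * (l.length + 1)) := by
  induction l with
  | nil => exact .of_wp (by simp [Body.insertItem, Wp, insertItem])
  | cons y l ih =>
    rw [List.forall_mem_cons] at h
    have hk := keyLt_encTime h.1 hx
    refine .of_wp ?_
    rw [body_insertItem, insertItem]
    simp only [Body.insertItem, Wp, List.getD_cons_zero, Val.snd_pair, Val.fst_pair,
      encList_cons, List.length_cons,
      Val.isPair_pair, true_implies, not_true, false_implies, and_true]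
    simp only [encItem, Val.fst_pair, hk]
    refine ⟨fun h' => ?_, fun h' => ?_⟩
    · rw [if_pos h']
      exact ⟨_, _, ih h.2, fun u hu => ⟨rfl, by omega⟩⟩
    · rw [if_neg h']
      exact ⟨rfl, by omega⟩

/-- The rows of the block `L₀` for the starts of the intervals of `L`. -/
def blockItems (m : ℕ) (L₀ : List Ival) : List Ival → List (EReal × RowTree)
  | [] => [(⊤, .leaf (initState m))]
  | J :: L => insertItem ((J.start : EReal), .leaf (blockRow m L₀ J.start)) (blockItems m L₀ L)

theorem length_blockItems (L₀ L : List Ival) : (blockItems m L₀ L).length = L.length + 1 := by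
  induction L with
  | nil => rfl
  | cons J L ih => rw [blockItems, (insertItem_perm _ _).length_eq, List.length_cons, ih,
      List.length_cons]

theorem sortedItems_blockItems (L₀ L : List Ival) : SortedItems (blockItems m L₀ L) := by
  induction L with
  | nil => exact ⟨by simp [blockItems], by simp [blockItems]⟩
  | cons J L ih => exact ih.insertItem (EReal.coe_ne_top _) (EReal.coe_ne_bot _)

theorem blockRow_top (L₀ : List Ival) : blockRow m L₀ ⊤ = initState m := by
  simp [blockRow]

theorem mem_blockItems {L₀ L : List Ival} {i : EReal × RowTree} (hi : i ∈ blockItems m L₀ L) :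
    i.2 = .leaf (blockRow m L₀ i.1) := by
  induction L with
  | nil =>
    rw [blockItems, List.mem_singleton] at hi
    rw [hi, blockRow_top]
  | cons J L ih =>
    rcases List.mem_cons.1 ((insertItem_perm _ _).mem_iff.1 hi) with rfl | hi
    exacts [rfl, ih hi]

theorem exists_mem_blockItems_top (L₀ L : List Ival) : ∃ i ∈ blockItems m L₀ L, i.1 = ⊤ := by
  induction L with
  | nil => exact ⟨_, List.mem_singleton_self _, rfl⟩
  | cons J L ih =>
    obtain ⟨i, hi, e⟩ := ih
    exact ⟨i, (insertItem_perm _ _).mem_iff.2 (by simp [hi]), e⟩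

theorem exists_mem_blockItems {L₀ L : List Ival} {J : Ival} (hJ : J ∈ L) :
    ∃ i ∈ blockItems m L₀ L, i.1 = (J.start : EReal) := by
  induction L with
  | nil => simp at hJ
  | cons K L ih =>
    rcases List.mem_cons.1 hJ with rfl | hJ
    · exact ⟨_, (insertItem_perm _ _).mem_iff.2 (List.mem_cons_self ..), rfl⟩
    · obtain ⟨i, hi, e⟩ := ih hJ
      exact ⟨i, (insertItem_perm _ _).mem_iff.2 (by simp [hi]), e⟩

theorem blockRow_congr {L : List Ival} {d k : EReal} (hdk : d ≤ k)
    (h : ∀ J ∈ L, d ≤ (J.start : EReal) → k ≤ (J.start : EReal)) :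
    blockRow m L k = blockRow m L d := by
  unfold blockRow
  congr 1
  refine List.filter_congr fun J hJ => ?_
  rw [decide_eq_decide]
  exact ⟨fun h' => hdk.trans h', h J hJ⟩

/-- No interval of the block starts between `d` and the first key at or after `d`, so both select
the same intervals and have the same row. The item with key `⊤`, whose row is the initial state,
serves all `d` beyond the last start. -/
theorem lookupList_eq_blockRow (L : List Ival) (d : EReal) (l : List (EReal × RowTree))
    (hs : SortedItems l) (hrow : ∀ i ∈ l, i.2 = .leaf (blockRow m L i.1))
    (htop : ∃ i ∈ l, d ≤ i.1)
    (hkey : ∀ J ∈ L, d ≤ (J.start : EReal) → ∃ i ∈ l, i.1 = (J.start : EReal)) :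
    lookupList d l = blockRow m L d := by
  classical
  induction l with
  | nil => simp at htop
  | cons i l ih =>
    rcases eq_or_ne l [] with rfl | hl
    · rw [lookupList, hrow i (by simp), RowTree.lookup]
      refine blockRow_congr (by simpa using htop) fun J hJ hd => ?_
      obtain ⟨j, hj, e⟩ := hkey J hJ hd
      rw [List.mem_singleton.1 hj] at e
      exact e.le
    · rw [lookupList_cons hl]
      split_ifs with h
      · refine ih hs.tail (fun j hj => hrow j (by simp [hj])) ?_ fun J hJ hd => ?_
        · obtain ⟨j, hj, hdj⟩ := htop
          rcases List.mem_cons.1 hj with rfl | hj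
          exacts [absurd hdj h.not_ge, ⟨j, hj, hdj⟩]
        · obtain ⟨j, hj, e⟩ := hkey J hJ hd
          rcases List.mem_cons.1 hj with rfl | hj
          exacts [absurd (e ▸ hd) h.not_ge, ⟨j, hj, e⟩]
      · rw [hrow i (by simp), RowTree.lookup]
        refine blockRow_congr (not_lt.1 h) fun J hJ hd => ?_
        obtain ⟨j, hj, e⟩ := hkey J hJ hd
        rw [← e]
        rcases List.mem_cons.1 hj with rfl | hj
        exacts [le_rfl, ((List.pairwise_cons.1 hs.sorted).1 j hj).1]

theorem runs_items {D N : ℕ} (hD : m + 1 ≤ D) (L₀ L : List Ival) (h₀ : L₀.length ≤ N)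
    (hL : L.length ≤ N) (hN : N < 2 ^ D) :
    Runs (schedulingProgram m) 7 (.pair (encList encIval L₀) (encList encIval L))
      (encList encItem (blockItems m L₀ L)) (300 * D * (N + 1) * (L.length + 1)) := by
  induction L with
  | nil =>
    refine .of_wp ?_
    simp [Body.items, Wp]
    refine ⟨_, _, runs_init .nil, fun u hu => ⟨?_, ?_⟩⟩
    · simp [blockItems, encItem, RowTree.enc, encState, initState]
    · nlinarith
  | cons J L ih =>
    rw [List.length_cons] at hL
    have hT : 300 * D * (N + 1) * ((J :: L).length + 1) =
        300 * D * (N + 1) * (L.length + 1) + 300 * D * (N + 1) := by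
      rw [List.length_cons]; ring
    rw [hT]
    refine .of_wp ?_
    simp [Body.items, Wp]
    refine ⟨_, _, runs_init .nil, fun u hu => ?_⟩
    have hg := runs_greedy (m := m) (D := D) (J.start : EReal) (EReal.coe_ne_top _) L₀ (initState m)
      (fun r hr => by rw [List.eq_of_mem_replicate hr]; exact bot_ne_top)
      (by simp only [initState]; omega) (by simpa [initState] using hD)
    simp only [encState, encTime_coe, initState, encNat_zero] at hg
    refine ⟨_, _, hg, fun u1 hu1 => ⟨_, _, ih (by omega), fun u2 hu2 => ?_⟩⟩
    have hi := runs_insertItem (m := m) ((J.start : EReal), .leaf (blockRow m L₀ J.start))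
      (blockItems m L₀ L) (EReal.coe_ne_top _) (sortedItems_blockItems L₀ L).ne_bot
    simp only [encItem, encTime_coe, RowTree.enc] at hi
    refine ⟨_, _, hi, fun u3 hu3 => ⟨rfl, ?_⟩⟩
    rw [length_blockItems] at hu3
    have h1 : 150 * D * (L₀.length + 1) ≤ 150 * D * (N + 1) :=
      Nat.mul_le_mul_left _ (by omega)
    have h2 : N + 1 ≤ D * (N + 1) := Nat.le_mul_of_pos_left _ (by omega)
    have h3 : D ≤ D * (N + 1) := Nat.le_mul_of_pos_right _ (by omega)
    have h4 : 150 * D * (N + 1) = 150 * (D * (N + 1)) := by ring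
    have h5 : 300 * D * (N + 1) = 300 * (D * (N + 1)) := by ring
    rw [h5] at hu2 ⊢
    rw [h4] at h1
    generalize D * (N + 1) = X at *
    generalize 300 * X * (L.length + 1) = Y at *
    omega

/-! ### Blocks -/

/-- A block: its intervals, by increasing end, and the search tree of its rows. -/
abbrev Block := List Ival × RowTree

def encBlock (B : Block) : Val := .pair (encList encIval B.1) B.2.enc

abbrev encBlocks (Bs : List Block) : Val := encList encBlock Bs

/-- A nonempty block of at most `s` intervals with the tree of its rows. -/
structure GoodBlock (m D s : ℕ) (B : Block) : Prop where
  ne_nil : B.1 ≠ []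
  length_le : B.1.length ≤ s
  depth_le : B.2.depth ≤ D
  lookup : ∀ d, B.2.lookup d = blockRow m B.1 d

theorem length_fillBot (d : EReal) (R : List EReal) : (fillBot d R).length = R.length := by
  simp [fillBot]

theorem fillBot_ne_top {d : EReal} (hd : d ≠ ⊤) {R : List EReal} (hR : ∀ r ∈ R, r ≠ ⊤) :
    ∀ r ∈ fillBot d R, r ≠ ⊤ := by
  intro r hr
  obtain ⟨x, hx, rfl⟩ := List.mem_map.1 hr
  split_ifs
  exacts [hd, hR x hx]

theorem join_fst_le_left (s t : ℕ × List EReal) : (join s t).1 ≤ s.1 := by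
  unfold join
  split_ifs with h
  exacts [le_rfl, (not_le.1 h).le]

theorem join_bounds {s t : ℕ × List EReal} (hs : s.2.length = m) (ht : t.2.length = m)
    (hs' : ∀ r ∈ s.2, r ≠ ⊤) (ht' : ∀ r ∈ t.2, r ≠ ⊤) :
    (join s t).2.length = m ∧ ∀ r ∈ (join s t).2, r ≠ ⊤ := by
  have key : ∀ s t : ℕ × List EReal, s.2.length = m → t.2.length = m → (∀ r ∈ s.2, r ≠ ⊤) →
      (∀ r ∈ t.2, r ≠ ⊤) → (joinLE s t).2.length = m ∧ ∀ r ∈ (joinLE s t).2, r ≠ ⊤ := by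
    intro s t hs ht hs' ht'
    refine ⟨?_, fun r hr => ?_⟩
    · rw [joinLE, length_zipMax (by rw [List.length_drop]; omega), hs]
    · rcases mem_zipMax hr with h | h
      exacts [hs' r h, ht' r (List.mem_of_mem_drop h)]
  unfold join
  split_ifs
  exacts [key s t hs ht hs' ht', key t s ht hs ht' hs']

theorem applyBlock_bounds (L : List Ival) (F : ℕ) (R : List EReal) (hR : ∀ r ∈ R, r ≠ ⊤)
    {s : ℕ × List EReal} (h : applyBlock (blockRow m L) F R = some s) :
    s.1 ≤ F + L.length ∧ s.2.length = m ∧ ∀ r ∈ s.2, r ≠ ⊤ := by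
  induction R generalizing s with
  | nil => simp [applyBlock] at h
  | cons d R ih =>
    rw [List.forall_mem_cons] at hR
    obtain ⟨h1, h2, h3⟩ := blockRow_bounds m L d
    have h3' := fillBot_ne_top hR.1 h3
    simp only [applyBlock, Option.some.injEq] at h
    cases e : applyBlock (blockRow m L) F R with
    | none =>
      have hnil : R = [] := by
        cases R with
        | nil => rfl
        | cons _ _ => simp [applyBlock] at e
      rw [e] at h
      subst h hnil
      exact ⟨by simpa using h1, by simpa [length_fillBot] using h2, h3'⟩
    | some t =>
      rw [e] at h
      subst h
      obtain ⟨h4, h5, h6⟩ := ih hR.2 e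
      simp only [Option.elim_some]
      have := join_bounds (m := m) (s := t)
        (t := (F + R.length + (blockRow m L d).1, fillBot d (blockRow m L d).2)) h5
        (by rw [length_fillBot]; exact h2) h6 h3'
      exact ⟨(join_fst_le_left _ _).trans h4, this⟩

def encOptState : Option (ℕ × List EReal) → Val
  | none => .nil
  | some s => encState s

/-- Besides the state, the recursion returns `F` plus the number of entries it has seen. This is the
shift of the next uniform profile, obtained by one increment per machine. -/
theorem runs_apply {D s : ℕ} {B : Block} (hB : GoodBlock m D s B) (hD : m + 1 ≤ D) (F : ℕ)
    (R : List EReal) (hR : ∀ r ∈ R, r ≠ ⊤) (hF : F + R.length + B.1.length < 2 ^ D) :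
    Runs (schedulingProgram m) 16 (.pair B.2.enc (.pair (encNat F) (encTimes R)))
      (.pair (encNat (F + R.length)) (encOptState (applyBlock (blockRow m B.1) F R)))
      (1000 * D ^ 2 * (R.length + 1)) := by
  have hD1 : 1 ≤ D := by omega
  have hD2 : D ≤ D ^ 2 := by nlinarith
  induction R with
  | nil =>
    refine .of_wp ?_
    simp [Body.apply, Wp, applyBlock, encOptState]
    omega
  | cons d R ih =>
    rw [List.forall_mem_cons] at hR
    have hT : 1000 * D ^ 2 * ((d :: R).length + 1) =
        1000 * D ^ 2 * (R.length + 1) + 1000 * D ^ 2 := by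
      rw [List.length_cons]; ring
    rw [List.length_cons] at hF
    have hlook := runs_lookup (m := m) d hR.1 B.2
    rw [hB.lookup d] at hlook
    obtain ⟨h1, h2, h3⟩ := blockRow_bounds m B.1 d
    rw [hT]
    refine .of_wp ?_
    rw [body_apply]
    simp only [Body.apply, Wp, List.getD_cons_zero, List.getD_cons_succ, Val.snd_pair, Val.fst_pair,
      encList_cons, encTimes, Val.isPair_pair, true_implies, not_true, false_implies, and_true]
    refine ⟨_, _, ih hR.2 (by omega), fun u1 hu1 => ⟨_, _, hlook, fun u2 hu2 => ?_⟩⟩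
    simp only [encState, Val.fst_pair, Val.snd_pair]
    refine ⟨_, _, runs_add D (F + R.length) (blockRow m B.1 d).1 (by omega) (by omega),
      fun u3 hu3 => ⟨_, _, runs_fill d _ h3, fun u4 hu4 =>
        ⟨_, _, runs_inc D (F + R.length) (by omega), fun u5 hu5 => ?_⟩⟩⟩
    have hd := hB.depth_le
    have h5 : 60 * (D + 1) ^ 2 = 60 * D ^ 2 + 120 * D + 60 := by ring
    rw [h5] at hu3
    rw [h2] at hu4
    rw [applyBlock, List.length_cons, ← Nat.add_assoc]
    cases e : applyBlock (blockRow m B.1) F R with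
    | none =>
      simp only [encOptState, Val.isPair_nil, false_implies, not_false_iff, true_implies, true_and,
        Option.elim_none, encState]
      omega
    | some t =>
      obtain ⟨h6, h7, h8⟩ := applyBlock_bounds B.1 F R hR.2 e
      have hj := runs_join (m := m) (D := D) t
        (F + R.length + (blockRow m B.1 d).1, fillBot d (blockRow m B.1 d).2) (by omega)
        (by simp only; omega) h8 (fillBot_ne_top hR.1 h3) (by omega)
        (by simp only [length_fillBot]; omega)
      simp only [encState] at hj
      simp only [encOptState, encState, Val.isPair_pair, not_true, true_implies, false_implies,
        and_true, Option.elim_some]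
      exact ⟨_, _, hj, fun u6 hu6 => ⟨rfl, by omega⟩⟩

/-- All intervals of a list of blocks. -/
def content (Bs : List Block) : List Ival := Bs.flatMap Prod.fst

@[simp] theorem content_nil : content [] = [] := rfl

@[simp] theorem content_cons (B : Block) (Bs : List Block) :
    content (B :: Bs) = B.1 ++ content Bs := rfl

theorem content_append (Bs Bs' : List Block) : content (Bs ++ Bs') = content Bs ++ content Bs' := by
  simp [content]

/-- Only the profile is tracked from block to block; its value at `⊥` after the last block is the
counter that is reported. -/
theorem runs_serve {D s : ℕ} (hm : 0 < m) (hD : m + 1 ≤ D) (Bs : List Block)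
    (hB : ∀ B ∈ Bs, GoodBlock m D s B) (b : EReal) (hb : b ≠ ⊤) (st : ℕ × List EReal)
    (hst : IsState m b st) (hL : SortedFrom b (content Bs))
    (hF : st.1 + m + (content Bs).length < 2 ^ D) :
    Runs (schedulingProgram m) 17 (.pair (encBlocks Bs) (encState st))
      (encNat ((content Bs).foldl (transfer m) (profile st) ⊥))
      (1100 * D ^ 3 * (Bs.length + 1)) := by
  have hD1 : 1 ≤ D ^ 3 := Nat.one_le_pow _ _ (by omega)
  induction Bs generalizing b st with
  | nil =>
    refine .of_wp ?_
    simp [Body.serve, Wp, encState, profile]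
    omega
  | cons B Bs ih =>
    rw [List.forall_mem_cons] at hB
    rw [content_cons] at hL hF
    have hT : 1100 * D ^ 3 * ((B :: Bs).length + 1) =
        1100 * D ^ 3 * (Bs.length + 1) + 1100 * D ^ 3 := by
      rw [List.length_cons]; ring
    rw [List.length_append] at hF
    have hne := hB.1.ne_nil
    have hsp := List.pairwise_append.1 hL.sorted
    -- The last end of the block bounds all busy times after it and separates it from the following
    -- blocks.
    set c : EReal := ((B.1.getLast hne).finish : EReal) with hc
    have hlast : ∀ J ∈ B.1, (J.finish : EReal) ≤ c := fun J hJ => by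
      rw [hc, EReal.coe_le_coe_iff]
      rcases List.mem_append.1 (by rw [List.dropLast_append_getLast hne]; exact hJ :
        J ∈ B.1.dropLast ++ [B.1.getLast hne]) with h | h
      · have := hsp.1
        rw [← List.dropLast_append_getLast hne, List.pairwise_append] at this
        exact this.2.2 J h _ (List.mem_singleton_self _)
      · rw [List.mem_singleton.1 h]
    have hL1 : SortedFrom b B.1 := ⟨hsp.1, fun J hJ => hL.le J (by simp [hJ])⟩
    have hbc : b ≤ c := hL1.le _ (List.getLast_mem hne)
    have hL2 : SortedFrom c (content Bs) := ⟨hsp.2.1, fun J hJ =>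
      EReal.coe_le_coe_iff.2 (hsp.2.2 _ (List.getLast_mem hne) J hJ)⟩
    obtain ⟨t, ht, hts, htp⟩ := applyBlock_state hm hL1 hbc hlast hst
    have hR : ∀ r ∈ st.2, r ≠ ⊤ := fun r hr => ((hst.le r hr).trans_lt hb.lt_top).ne
    obtain ⟨h1, -, -⟩ := applyBlock_bounds B.1 st.1 st.2 hR ht
    have hap := runs_apply hB.1 hD st.1 st.2 hR (by rw [hst.length]; omega)
    rw [ht, hst.length] at hap
    have ih' := ih hB.2 c (EReal.coe_ne_top _) t hts hL2 (by omega)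
    rw [htp] at ih'
    rw [hT, content_cons, List.foldl_append]
    refine .of_wp ?_
    rw [body_serve]
    simp only [Body.serve, Wp, List.getD_cons_zero, List.getD_cons_succ, Val.snd_pair, Val.fst_pair,
      encList_cons, encBlocks, Val.isPair_pair, true_implies, not_true, false_implies, and_true]
    simp only [encBlock, Val.snd_pair]
    refine ⟨_, _, hap, fun u1 hu1 => ⟨_, _, ih', fun u2 hu2 => ⟨rfl, ?_⟩⟩⟩
    have h2 : 1000 * D ^ 2 * (m + 1) ≤ 1000 * D ^ 2 * D := Nat.mul_le_mul_left _ hD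
    have h3 : 1000 * D ^ 2 * D = 1000 * D ^ 3 := by ring
    omega

/-! ### Cutting lists into blocks -/

def unary : ℕ → Val
  | 0 => .nil
  | n + 1 => .pair .nil (unary n)

theorem runs_split {α : Type} (enc : α → Val) (s : ℕ) (l : List α) :
    Runs (schedulingProgram m) 18 (.pair (unary s) (encList enc l))
      (.pair (encList enc (l.take s)) (encList enc (l.drop s))) (40 * (s + 1)) := by
  induction s generalizing l with
  | zero => exact .of_wp (by simp [Body.split, Wp, unary])
  | succ s ih =>
    cases l with
    | nil => exact .of_wp (by simp [Body.split, Wp, unary]; omega)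
    | cons a l =>
      refine .of_wp ?_
      simp [Body.split, Wp, unary]
      exact ⟨_, _, ih l, fun u hu => ⟨⟨rfl, rfl⟩, by omega⟩⟩

/-- All blocks but the last are full, which gives the bound on their number. Computing the rows
dominates the time, with about `s²` per block; the `s + 1` rows fit into a tree of depth at most
`D`. -/
theorem runs_chunk {D s : ℕ} (hD : m + 1 ≤ D) (hs : 1 ≤ s) (hsD : s + 1 ≤ 2 ^ D) (n : ℕ)
    (l : List Ival) (hn : l.length ≤ n) :
    ∃ Bs : List Block, content Bs = l ∧ (∀ B ∈ Bs, GoodBlock m D s B) ∧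
      Bs.length * s ≤ l.length + (s - 1) ∧
      Runs (schedulingProgram m) 19 (.pair (unary s) (encList encIval l)) (encBlocks Bs)
        (600 * D * (s + 1) ^ 2 * (Bs.length + 1)) := by
  induction n generalizing l with
  | zero =>
    obtain rfl : l = [] := by simpa using hn
    refine ⟨[], rfl, by simp, by simp, .of_wp ?_⟩
    simp [Body.chunk, Wp]
    nlinarith [Nat.one_le_pow 2 (s + 1) (by omega), Nat.mul_le_mul (show 1 ≤ D by omega)
      (Nat.one_le_pow 2 (s + 1) (by omega))]
  | succ n ih =>
    rcases eq_or_ne l [] with rfl | hl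
    · exact ih [] (by simp)
    · have hpos : 0 < l.length := List.length_pos_iff.2 hl
      obtain ⟨Bs, h1, h2, h3, h4⟩ := ih (l.drop s) (by rw [List.length_drop]; omega)
      have hlen : (l.take s).length ≤ s := by rw [List.length_take]; exact min_le_left _ _
      have hit := runs_items (m := m) (D := D) (N := s) hD (l.take s) (l.take s) hlen hlen
        (by omega)
      obtain ⟨t, h5, h6, h7⟩ := runs_build (m := m) D (blockItems m (l.take s) (l.take s))
        (sortedItems_blockItems _ _) (by
          intro h
          have := length_blockItems (m := m) (l.take s) (l.take s)
          rw [h] at this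
          simp at this) 0
        (fun i hi => by rw [mem_blockItems hi]; exact le_rfl)
        (by rw [length_blockItems]; omega)
      refine ⟨(l.take s, t) :: Bs, ?_, List.forall_mem_cons.2 ⟨⟨?_, hlen, by simpa using h6, fun d => ?_⟩, h2⟩,
        ?_, .of_wp ?_⟩
      · rw [content_cons, h1, List.take_append_drop]
      · intro h
        have := congrArg List.length h
        rw [List.length_take, List.length_nil] at this
        omega
      · rw [h7]
        obtain ⟨i, hi, e⟩ := exists_mem_blockItems_top (m := m) (l.take s) (l.take s)
        exact lookupList_eq_blockRow _ _ _ (sortedItems_blockItems _ _) (fun i hi => mem_blockItems hi)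
          ⟨i, hi, e ▸ le_top⟩ fun J hJ _ => exists_mem_blockItems hJ
      · rw [List.length_drop] at h3
        rw [List.length_cons, Nat.add_mul]
        rcases le_or_gt s l.length with h | h
        · omega
        · have : Bs.length = 0 := by
            by_contra h0
            have := Nat.le_mul_of_pos_left s (Nat.pos_of_ne_zero h0)
            omega
          rw [this]
          omega
      · obtain ⟨a, l', rfl⟩ := List.exists_cons_of_ne_nil hl
        have hsplit := runs_split (m := m) encIval s (a :: l')
        rw [encList_cons] at hsplit
        rw [body_chunk]
        simp only [Body.chunk, Wp, List.getD_cons_zero, List.getD_cons_succ, Val.snd_pair,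
          Val.fst_pair, encList_cons, encBlocks, Val.isPair_pair, true_implies, not_true,
          false_implies, and_true]
        refine ⟨_, _, hsplit, fun u1 hu1 => ?_⟩
        simp only [Val.fst_pair, Val.snd_pair]
        refine ⟨_, _, hit, fun u2 hu2 => ⟨_, _, h5, fun u3 hu3 => ⟨_, _, h4, fun u4 hu4 =>
          ⟨rfl, ?_⟩⟩⟩⟩
        rw [length_blockItems] at hu3
        have e1 : 300 * D * (s + 1) * ((List.take s (a :: l')).length + 1) ≤
            300 * (D * (s + 1) ^ 2) := by
          calc _ ≤ 300 * D * (s + 1) * (s + 1) := Nat.mul_le_mul_left _ (by omega)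
            _ = _ := by ring
        have e2 : s + 1 ≤ D * (s + 1) ^ 2 := by
          have := Nat.le_mul_of_pos_left ((s + 1) ^ 2) (show 0 < D by omega)
          nlinarith
        have e3 : 600 * D * (s + 1) ^ 2 * (((a :: l').take s, t) :: Bs).length.succ =
            600 * D * (s + 1) ^ 2 * (Bs.length + 1) + 600 * (D * (s + 1) ^ 2) := by
          rw [List.length_cons, Nat.succ_eq_add_one]; ring
        rw [Nat.succ_eq_add_one] at e3
        rw [e3]
        omega

theorem runs_append {α : Type} (enc : α → Val) (l l' : List α) :
    Runs (schedulingProgram m) 23 (.pair (encList enc l) (encList enc l'))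
      (encList enc (l ++ l')) (20 * (l.length + 1)) := by
  induction l with
  | nil => exact .of_wp (by simp [Body.append, Wp])
  | cons a l ih =>
    refine .of_wp ?_
    simp [Body.append, Wp]
    exact ⟨_, _, ih, fun u hu => ⟨rfl, by omega⟩⟩

theorem runs_flatten (Bs : List Block) :
    Runs (schedulingProgram m) 25 (encBlocks Bs) (encList encIval (content Bs))
      (40 * ((content Bs).length + Bs.length + 1)) := by
  induction Bs with
  | nil => exact .of_wp (by simp [Body.flatten, Wp])
  | cons B Bs ih =>
    refine .of_wp ?_
    simp [Body.flatten, Wp, encBlock]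
    refine ⟨_, _, ih, fun u hu => ⟨_, _, runs_append encIval B.1 (content Bs), fun u1 hu1 =>
      ⟨rfl, by omega⟩⟩⟩

/-! ### Updates -/

def Update.ival : Update → Ival
  | .insert I => I
  | .delete I => I

def Update.isInsert : Update → Bool
  | .insert _ => true
  | .delete _ => false

theorem encUpdate_eq (u : Update) : encUpdate u = .pair (encBool u.isInsert) (encIval u.ival) := by
  cases u <;> rfl

open Classical in
/-- Performs an update of a sorted list. -/
def updateList (u : Update) : List Ival → List Ival
  | [] => if u.isInsert then [u.ival] else []
  | K :: L => if K < u.ival then K :: updateList u L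
      else if u.isInsert then u.ival :: K :: L else L

theorem length_updateList_le (u : Update) (L : List Ival) :
    (updateList u L).length ≤ L.length + 1 := by
  induction L with
  | nil => unfold updateList; split_ifs <;> simp
  | cons K L ih =>
    unfold updateList
    split_ifs
    · simpa using ih
    · simp
    · simp only [List.length_cons]; omega

theorem updateList_sort {u : Update} {S : Finset Ival} (hu : u.Valid S) :
    updateList u S.sort = (u.apply S).sort := by
  have hnd := Finset.sort_nodup S (· ≤ ·)
  have hs := Finset.pairwise_sort S (· ≤ ·)
  cases u with
  | insert I =>
    have e : ∀ L, updateList (.insert I) L = L.orderedInsert (· ≤ ·) I := by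
      intro L
      induction L with
      | nil => rfl
      | cons K L ih =>
        simp only [updateList, Update.ival, Update.isInsert, List.orderedInsert, ih, if_true]
        by_cases h : K < I
        · rw [if_pos h, if_neg (not_le.2 h)]
        · rw [if_neg h, if_pos (not_lt.1 h)]
    rw [e]
    refine List.Perm.eq_of_pairwise' (r := (· ≤ ·)) (hs.orderedInsert I _)
      (Finset.pairwise_sort _ _) ?_
    refine (List.perm_orderedInsert _ I _).trans ?_
    have hI : I ∉ S := hu
    refine (List.perm_ext_iff_of_nodup (List.nodup_cons.2 ⟨by simpa using hI, hnd⟩)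
      (Finset.sort_nodup _ _)).2 fun K => ?_
    simp [Update.apply]
  | delete I =>
    have e : ∀ L : List Ival, L.Pairwise (· ≤ ·) → I ∈ L →
        updateList (.delete I) L = L.erase I := by
      intro L
      induction L with
      | nil => simp
      | cons K L ih =>
        intro hL hI
        rw [updateList]
        by_cases h : K < I
        · rw [if_pos (show K < (Update.delete I).ival from h), List.erase_cons_tail (by simpa using h.ne),
            ih (List.pairwise_cons.1 hL).2 ((List.mem_cons.1 hI).resolve_left h.ne')]
        · have : K = I := by
            rcases List.mem_cons.1 hI with h' | h'
            · exact h'.symm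
            · exact le_antisymm ((List.pairwise_cons.1 hL).1 I h') (not_lt.1 h)
          subst this
          rw [if_neg (show ¬ K < (Update.delete K).ival from h)]
          simp [Update.isInsert]
    have hI : I ∈ S := hu
    rw [e _ hs (by simpa using hI)]
    refine List.Perm.eq_of_pairwise' (r := (· ≤ ·)) (hs.sublist List.erase_sublist)
      (Finset.pairwise_sort _ _) ?_
    refine (List.perm_ext_iff_of_nodup (hnd.erase I) (Finset.sort_nodup _ _)).2 fun K => ?_
    simp [Update.apply, hnd.mem_erase_iff]

theorem updateList_append_left {u : Update} {L L' : List Ival} (h : ∀ K ∈ L, K < u.ival) :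
    updateList u (L ++ L') = L ++ updateList u L' := by
  induction L with
  | nil => rfl
  | cons K L ih =>
    rw [List.forall_mem_cons] at h
    rw [List.cons_append, updateList, if_pos h.1, ih h.2, List.cons_append]

theorem updateList_append_right {u : Update} {L L' : List Ival} (h : ∀ K ∈ L', u.ival < K)
    (hd : u.isInsert = false → u.ival ∈ L) :
    updateList u (L ++ L') = updateList u L ++ L' := by
  induction L with
  | nil =>
    have hi : u.isInsert = true := by
      by_contra hi
      exact absurd (hd (by simpa using hi)) List.not_mem_nil
    cases L' with
    | nil => simp
    | cons K L' =>
      simp [updateList, hi, (h K (by simp)).not_gt]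
  | cons K L ih =>
    rw [List.cons_append, updateList, updateList]
    by_cases hK : K < u.ival
    · rw [if_pos hK, if_pos hK, ih fun hi => (List.mem_cons.1 (hd hi)).resolve_left hK.ne']
      rfl
    · rw [if_neg hK, if_neg hK]
      split_ifs <;> rfl

theorem runs_lt (I J : Ival) :
    Runs (schedulingProgram m) 21 (.pair (encIval I) (encIval J))
      (encBool (open Classical in decide (I < J))) 40 := by
  classical
  refine .of_wp ?_
  rw [body_lt]
  simp only [Body.lt, Body.one, Wp, List.getD_cons_zero, Val.snd_pair, Val.fst_pair, encIval,
    Val.keyLt_key]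
  refine ⟨fun h => ?_, fun h => ⟨fun h' => ?_, fun h' => ⟨fun h'' => ?_, fun h'' => ?_⟩⟩⟩
  · simp [Ival.lt_iff, h, encBool]
  · simp [Ival.lt_iff, h, h'.ne', encBool]
  · simp [Ival.lt_iff, h'', le_antisymm (not_lt.1 h') (not_lt.1 h), encBool]
  · simp [Ival.lt_iff, h, h'', encBool]

theorem runs_update (u : Update) (L : List Ival) :
    Runs (schedulingProgram m) 20 (.pair (encUpdate u) (encList encIval L))
      (encList encIval (updateList u L)) (80 * (L.length + 1)) := by
  classical
  induction L with
  | nil =>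
    refine .of_wp ?_
    rw [encUpdate_eq]
    cases h : u.isInsert <;> simp [Body.update, Wp, encBool, updateList, h]
  | cons K L ih =>
    refine .of_wp ?_
    rw [encUpdate_eq] at ih ⊢
    rw [body_update]
    simp only [Body.update, Wp, List.getD_cons_zero, Val.snd_pair, Val.fst_pair, encList_cons,
      Val.isPair_pair, true_implies, not_true, false_implies, and_true]
    refine ⟨_, _, runs_lt K u.ival, fun t ht => ?_⟩
    rw [updateList]
    by_cases h : K < u.ival
    · simp only [h, decide_true, encBool, Val.isPair_pair, true_implies, not_true, false_implies,
        and_true, if_true]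
      exact ⟨_, _, ih, fun t' ht' => ⟨rfl, by simp only [List.length_cons]; omega⟩⟩
    · cases h' : u.isInsert <;> simp [h, encBool] <;> omega

/-- The updated block has at most `s + 1` intervals and is cut again, into at most two blocks; a
block that has become empty disappears. Blocks are never merged, which is left to global rebuilding.
-/
theorem runs_here {D s : ℕ} (hD : m + 1 ≤ D) (hs : 1 ≤ s) (hsD : s + 1 ≤ 2 ^ D) (u : Update)
    (Bs : List Block) (hB : ∀ B ∈ Bs, GoodBlock m D s B)
    (hd : u.isInsert = false → ∀ B ∈ Bs.head?, u.ival ∈ B.1)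
    (hlt : ∀ K ∈ content Bs.tail, u.ival < K) (hne : u.isInsert = false → Bs ≠ []) :
    ∃ Bs' : List Block, content Bs' = updateList u (content Bs) ∧
      (∀ B ∈ Bs', GoodBlock m D s B) ∧ Bs'.length ≤ Bs.length + 1 ∧
      Runs (schedulingProgram m) 24 (.pair (encUpdate u) (.pair (unary s) (encBlocks Bs)))
        (encBlocks Bs') (2200 * D * (s + 1) ^ 2) := by
  -- Projections of `nil` are `nil`, so the program treats an empty list of blocks as an empty first
  -- block; `L` stands for the first block in both cases.
  have key : ∀ (L : List Ival) (Cs : List Block), L.length ≤ s →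
      (encBlocks Bs).fst.fst = encList encIval L → (encBlocks Bs).snd = encBlocks Cs →
      (∀ B ∈ Cs, GoodBlock m D s B) → content Bs = L ++ content Cs →
      Cs.length ≤ Bs.length → (L ≠ [] → Cs.length + 1 ≤ Bs.length) →
      (u.isInsert = false → u.ival ∈ L) → (∀ K ∈ content Cs, u.ival < K) →
      ∃ Bs' : List Block, content Bs' = updateList u (content Bs) ∧
      (∀ B ∈ Bs', GoodBlock m D s B) ∧ Bs'.length ≤ Bs.length + 1 ∧
      Runs (schedulingProgram m) 24 (.pair (encUpdate u) (.pair (unary s) (encBlocks Bs)))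
        (encBlocks Bs') (2200 * D * (s + 1) ^ 2) := by
    intro L Cs hL hfst hsnd hCs hc hl1 hl2 hdel hlt'
    have hlen := length_updateList_le u L
    obtain ⟨As, h1, h2, h3, h4⟩ := runs_chunk (m := m) hD hs hsD _ (updateList u L) le_rfl
    have hAs : As.length ≤ 2 := by
      by_contra! h
      have := Nat.mul_le_mul_right s (show 3 ≤ As.length from h)
      omega
    refine ⟨As ++ Cs, ?_, ?_, ?_, .of_wp ?_⟩
    · rw [content_append, h1, hc, updateList_append_right hlt' hdel]
    · intro B hB
      rcases List.mem_append.1 hB with h | h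
      exacts [h2 B h, hCs B h]
    · rw [List.length_append]
      rcases eq_or_ne L [] with rfl | hne
      · have : As.length ≤ 1 := by
          by_contra! h
          have := Nat.mul_le_mul_right s (show 2 ≤ As.length from h)
          simp at hlen
          omega
        omega
      · have := hl2 hne
        omega
    · rw [body_here]
      simp only [Body.here, Wp, List.getD_cons_zero, Val.snd_pair, Val.fst_pair, hfst, hsnd]
      refine ⟨_, _, runs_update u L, fun t1 ht1 => ⟨_, _, h4, fun t2 ht2 =>
        ⟨_, _, runs_append encBlock As Cs, fun t3 ht3 => ⟨rfl, ?_⟩⟩⟩⟩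
      have e1 : 600 * D * (s + 1) ^ 2 * (As.length + 1) ≤ 600 * D * (s + 1) ^ 2 * 3 :=
        Nat.mul_le_mul_left _ (by omega)
      have e2 : 600 * D * (s + 1) ^ 2 * 3 = 1800 * (D * (s + 1) ^ 2) := by ring
      have e3 : 2200 * D * (s + 1) ^ 2 = 2200 * (D * (s + 1) ^ 2) := by ring
      have e4 := Nat.le_mul_of_pos_left ((s + 1) ^ 2) (show 0 < D by omega)
      have e5 : 2 * (s + 1) ≤ (s + 1) ^ 2 := by nlinarith
      rw [e3]
      omega
  cases Bs with
  | nil =>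
    refine key [] [] (by simp) rfl rfl (by simp) rfl le_rfl (by simp) (fun h => ?_) (by simp)
    exact absurd rfl (hne h)
  | cons B Bs =>
    rw [List.forall_mem_cons] at hB
    exact key B.1 Bs hB.1.length_le rfl rfl hB.2 rfl (by simp) (by simp)
      (fun h => hd h B (by simp)) hlt

/-- A block is skipped as long as the next one begins at or before the interval of the update. Then
all skipped intervals are smaller and all later blocks are larger, so updating one block updates the
whole sorted list. -/
theorem runs_walk {D s : ℕ} (hD : m + 1 ≤ D) (hs : 1 ≤ s) (hsD : s + 1 ≤ 2 ^ D) (u : Update)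
    (Bs : List Block) (hB : ∀ B ∈ Bs, GoodBlock m D s B) (hc : (content Bs).Pairwise (· < ·))
    (hd : u.isInsert = false → u.ival ∈ content Bs) :
    ∃ Bs' : List Block, content Bs' = updateList u (content Bs) ∧
      (∀ B ∈ Bs', GoodBlock m D s B) ∧ Bs'.length ≤ Bs.length + 1 ∧
      Runs (schedulingProgram m) 22 (.pair (encUpdate u) (.pair (unary s) (encBlocks Bs)))
        (encBlocks Bs') (100 * (Bs.length + 1) + 2200 * D * (s + 1) ^ 2) := by
  classical
  have hnil : u.isInsert = false → Bs ≠ [] := by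
    rintro h rfl
    simpa using hd h
  induction Bs with
  | nil =>
    obtain ⟨Bs', h1, h2, h3, h4⟩ := runs_here hD hs hsD u [] hB (by simp) (by simp) hnil
    refine ⟨Bs', h1, h2, h3, .of_wp ?_⟩
    simp [Body.walk, Wp]
    exact ⟨_, _, h4, fun t ht => ⟨rfl, by omega⟩⟩
  | cons B Bs ih =>
    cases Bs with
    | nil =>
      obtain ⟨Bs', h1, h2, h3, h4⟩ := runs_here hD hs hsD u [B] hB
        (fun h => by simpa using hd h) (by simp) hnil
      refine ⟨Bs', h1, h2, h3, .of_wp ?_⟩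
      simp [Body.walk, Wp]
      exact ⟨_, _, h4, fun t ht => ⟨rfl, by omega⟩⟩
    | cons C Bs =>
      have hC := hB C (by simp)
      obtain ⟨K, L, hKL⟩ := List.exists_cons_of_ne_nil hC.ne_nil
      rw [content_cons] at hc hd
      have hc' := List.pairwise_append.1 hc
      have hKc : content (C :: Bs) = K :: (L ++ content Bs) := by rw [content_cons, hKL]; rfl
      have hlt := runs_lt (m := m) u.ival K
      have hKle : ∀ J ∈ content (C :: Bs), K ≤ J := by
        have := hc'.2.1
        rw [show content (C :: Bs) = K :: (L ++ content Bs) from hKc] at this ⊢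
        intro J hJ
        rcases List.mem_cons.1 hJ with rfl | hJ
        exacts [le_rfl, ((List.pairwise_cons.1 this).1 J hJ).le]
      by_cases h : u.ival < K
      · have hgt : ∀ J ∈ content (C :: Bs), u.ival < J := fun J hJ => h.trans_le (hKle J hJ)
        obtain ⟨Bs', h1, h2, h3, h4⟩ := runs_here hD hs hsD u (B :: C :: Bs) hB
          (fun h' B' hB' => by
            obtain rfl : B = B' := by simpa using hB'
            rcases List.mem_append.1 (hd h') with h'' | h''
            · exact h''
            · exact absurd (hgt _ h'') (lt_irrefl _)) hgt hnil
        refine ⟨Bs', h1, h2, h3, .of_wp ?_⟩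
        rw [body_walk]
        simp only [Body.walk, Wp, List.getD_cons_zero, Val.snd_pair, Val.fst_pair, encList_cons,
          encBlocks, encUpdate_eq u, Val.isPair_pair, true_implies, not_true, false_implies, and_true]
        simp only [encBlock, hKL, encList_cons, Val.fst_pair]
        refine ⟨_, _, hlt, fun t1 ht1 => ?_⟩
        simp only [h, decide_true, encBool, Val.isPair_pair, true_implies, not_true, false_implies,
          and_true]
        simp only [encBlocks, encList_cons, encBlock, hKL, encUpdate_eq u] at h4
        refine ⟨_, _, h4, fun t ht => ⟨rfl, by omega⟩⟩
      · have hKu : K ≤ u.ival := not_lt.1 h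
        have hBlt : ∀ J ∈ B.1, J < u.ival := fun J hJ =>
          (hc'.2.2 J hJ K (by rw [hKc]; exact List.mem_cons_self ..)).trans_le hKu
        obtain ⟨Bs', h1, h2, h3, h4⟩ := ih (fun B' hB' => hB B' (by simp [hB'])) hc'.2.1
          (fun h' => by
            rcases List.mem_append.1 (hd h') with h'' | h''
            · exact absurd (hBlt _ h'') (lt_irrefl _)
            · exact h'') (by simp)
        refine ⟨B :: Bs', ?_, ?_, ?_, .of_wp ?_⟩
        · rw [content_cons, h1, content_cons B, updateList_append_left hBlt]
        · exact List.forall_mem_cons.2 ⟨hB B (by simp), h2⟩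
        · simpa using h3
        · rw [body_walk]
          simp only [Body.walk, Wp, List.getD_cons_zero, Val.snd_pair, Val.fst_pair, encList_cons,
            encBlocks, encUpdate_eq u, Val.isPair_pair, true_implies, not_true, false_implies,
            and_true]
          have hfst : (encBlock C).fst = .pair (encIval K) (encList encIval L) := by
            simp [encBlock, hKL]
          rw [hfst]
          simp only [Val.fst_pair]
          refine ⟨_, _, hlt, fun t1 ht1 => ?_⟩
          simp only [h, decide_false, encBool, Val.isPair_nil, not_false_iff, true_implies,
            false_implies, true_and]
          simp only [encBlocks, encList_cons, encUpdate_eq u] at h4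
          refine ⟨_, _, h4, fun t ht => ⟨rfl, ?_⟩⟩
          simp only [List.length_cons] at ht ⊢
          omega

/-! ### Global rebuilding -/

theorem unary_eq (n : ℕ) : unary n = encList (fun _ : Unit => .nil) (List.replicate n ()) := by
  induction n with
  | zero => rfl
  | succ n ih => rw [unary, ih, List.replicate_succ, encList_cons]

theorem runs_append_unary (a b : ℕ) :
    Runs (schedulingProgram m) 23 (.pair (unary a) (unary b)) (unary (a + b)) (20 * (a + 1)) := by
  have h := runs_append (m := m) (fun _ : Unit => .nil) (List.replicate a ()) (List.replicate b ())
  rwa [← List.replicate_add, ← unary_eq, ← unary_eq, ← unary_eq, List.length_replicate] at h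

theorem snd_encList {α : Type} (enc : α → Val) (l : List α) :
    (encList enc l).snd = encList enc l.tail := by
  cases l <;> rfl

theorem isPair_encList {α : Type} (enc : α → Val) (l : List α) :
    (encList enc l).IsPair ↔ l ≠ [] := by
  cases l <;> simp

theorem runs_eighth {α : Type} (enc : α → Val) (n : ℕ) (l : List α) (hl : l.length ≤ n) :
    Runs (schedulingProgram m) 26 (encList enc l) (unary (l.length / 8)) (60 * (l.length + 1)) := by
  induction n generalizing l with
  | zero =>
    obtain rfl : l = [] := by simpa using hl
    exact .of_wp (by simp [Body.eighth, Wp, unary])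
  | succ n ih =>
    refine .of_wp ?_
    rw [body_eighth]
    simp only [Body.eighth, Wp, List.getD_cons_zero, snd_encList, isPair_encList]
    refine ⟨fun h => ?_, fun h => ?_⟩
    · have hlen := List.length_pos_iff.2 h
      simp only [List.length_tail] at hlen
      refine ⟨_, _, ih l.tail.tail.tail.tail.tail.tail.tail.tail
        (by simp only [List.length_tail]; omega), fun t ht => ?_⟩
      simp only [List.length_tail] at ht ⊢
      refine ⟨?_, by omega⟩
      rw [show l.length / 8 = (l.length - 1 - 1 - 1 - 1 - 1 - 1 - 1 - 1) / 8 + 1 by omega]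
      rfl
    · rw [not_not] at h
      have := congrArg List.length h
      simp only [List.length_tail, List.length_nil] at this
      rw [show l.length / 8 = 0 by omega]
      exact ⟨rfl, by omega⟩

/-- The number of octal digits. -/
def octLength (n : ℕ) : ℕ := (Nat.digits 8 n).length

theorem octLength_succ {n : ℕ} (hn : 0 < n) : octLength n = octLength (n / 8) + 1 := by
  rw [octLength, Nat.digits_def' (by norm_num) hn, List.length_cons, octLength]

theorem lt_pow_octLength (n : ℕ) : n < 8 ^ octLength n :=
  Nat.lt_base_pow_length_digits (by norm_num)

theorem pow_octLength_le (n : ℕ) : 8 ^ octLength n ≤ 8 * n + 1 := by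
  rcases Nat.eq_zero_or_pos n with rfl | hn
  · simp [octLength]
  · exact (Nat.base_pow_length_digits_le 8 n (by norm_num) hn.ne').trans (Nat.le_succ _)

theorem octLength_le {n k : ℕ} (h : n < 8 ^ k) : octLength n ≤ k := by
  by_contra! h'
  have h1 := Nat.pow_le_pow_right (show 0 < 8 by norm_num) h'
  have h2 := pow_octLength_le n
  rw [Nat.succ_eq_add_one, pow_succ] at h1
  omega

/-- Division by eight removes one octal digit, for which one output is doubled and the other
quadrupled. The lists shrink geometrically, so the time is linear. The recursion runs on a unary
list, hence the generalization over the entry type. -/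
theorem runs_params {α : Type} (enc : α → Val) (n : ℕ) (l : List α) (hl : l.length ≤ n) :
    Runs (schedulingProgram m) 27 (encList enc l)
      (.pair (unary (2 ^ octLength l.length)) (unary (4 ^ octLength l.length)))
      (600 * (l.length + 1)) := by
  induction n generalizing α enc l with
  | zero =>
    obtain rfl : l = [] := by simpa using hl
    exact .of_wp (by simp [Body.params, Body.one, Wp, unary, octLength])
  | succ n ih =>
    cases l with
    | nil => exact .of_wp (by simp [Body.params, Body.one, Wp, unary, octLength])
    | cons a l =>
      have h8 := runs_eighth (m := m) enc _ (a :: l) le_rfl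
      set N := (a :: l).length with hN
      have hNpos : 0 < N := by simp [hN]
      have ih' := ih (fun _ : Unit => .nil) (List.replicate (N / 8) ())
        (by rw [List.length_replicate]; omega)
      rw [← unary_eq, List.length_replicate] at ih'
      rw [encList_cons] at h8
      rw [octLength_succ hNpos]
      set k := octLength (N / 8) with hk
      have h4 : 4 ^ k ≤ N + 1 := by
        have h1 := pow_octLength_le (N / 8)
        have h2 : 4 ^ k ≤ 8 ^ k := Nat.pow_le_pow_left (by norm_num) k
        rw [← hk] at h1
        omega
      have h2 : 2 ^ k ≤ 4 ^ k := Nat.pow_le_pow_left (by norm_num) k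
      refine .of_wp ?_
      rw [body_params]
      simp only [Body.params, Wp, List.getD_cons_zero, encList_cons, Val.isPair_pair, true_implies,
        not_true, false_implies, and_true]
      refine ⟨_, _, h8, fun t1 ht1 => ⟨_, _, ih', fun t2 ht2 => ?_⟩⟩
      simp only [Val.fst_pair, Val.snd_pair]
      refine ⟨_, _, runs_append_unary _ _, fun t3 ht3 => ⟨_, _, runs_append_unary _ _, fun t4 ht4 =>
        ⟨_, _, runs_append_unary _ _, fun t5 ht5 => ⟨_, _, runs_append_unary _ _, fun t6 ht6 =>
          ⟨?_, by omega⟩⟩⟩⟩⟩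
      rw [pow_succ, pow_succ]
      congr 2 <;> omega

theorem length_le_length_content {D s : ℕ} {Bs : List Block} (hB : ∀ B ∈ Bs, GoodBlock m D s B) :
    Bs.length ≤ (content Bs).length := by
  induction Bs with
  | nil => simp
  | cons B Bs ih =>
    rw [List.forall_mem_cons] at hB
    have := List.length_pos_iff.2 hB.1.ne_nil
    have := ih hB.2
    simp only [List.length_cons, content_cons, List.length_append]
    omega

/-! ### The amortized analysis -/

/-- A bound on the number of binary digits of all numbers that occur, and on the depths of the
trees. -/
def digitBound (m k : ℕ) : ℕ := 3 * k + m + 5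

theorem lt_two_pow_digitBound {n k : ℕ} (h : n ≤ 8 ^ k + 4 ^ k) :
    m + n < 2 ^ digitBound m k := by
  have e : 2 ^ digitBound m k = 32 * 8 ^ k * 2 ^ m := by
    rw [digitBound, pow_add, pow_add, pow_mul]; norm_num; ring
  have h1 : 4 ^ k ≤ 8 ^ k := Nat.pow_le_pow_left (by norm_num) k
  have h2 : m < 2 ^ m := Nat.lt_two_pow_self
  have h3 : 1 ≤ 8 ^ k := Nat.one_le_pow _ _ (by norm_num)
  have h4 : 1 ≤ 2 ^ m := Nat.one_le_pow _ _ (by norm_num)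
  have h5 := Nat.mul_le_mul_left (8 ^ k) h4
  have h6 := Nat.mul_le_mul_right (2 ^ m) h3
  rw [e, mul_assoc]
  omega

theorem two_pow_add_one_le_digitBound (k : ℕ) : 2 ^ k + 1 ≤ 2 ^ digitBound m k := by
  have h : 2 ^ (k + 1) ≤ 2 ^ digitBound m k :=
    Nat.pow_le_pow_right (by norm_num) (by rw [digitBound]; omega)
  have : 1 ≤ 2 ^ k := Nat.one_le_pow _ _ (by norm_num)
  rw [pow_succ] at h
  omega

theorem runs_serve_opt (hm : 0 < m) {k : ℕ} {S : Finset Ival} {Bs : List Block}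
    (hc : content Bs = S.sort) (hB : ∀ B ∈ Bs, GoodBlock m (digitBound m k) (2 ^ k) B)
    (hS : S.card ≤ 8 ^ k + 4 ^ k) :
    Runs (schedulingProgram m) 17
      (.pair (encBlocks Bs) (.pair .nil (encTimes (List.replicate m ⊥))))
      (encNat (opt m S)) (1100 * digitBound m k ^ 3 * (Bs.length + 1)) := by
  have hL := sortedFrom_sort S
  have h := runs_serve hm (by rw [digitBound]; omega) Bs hB ⊥ bot_ne_top (initState m)
    (isState_initState m) (by rwa [hc]) (by
      rw [hc, Finset.length_sort, initState, Nat.zero_add]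
      exact lt_two_pow_digitBound hS)
  have h' := IsState.foldl hL (isState_initState m) (c := ⊤) bot_le (fun _ _ => le_top)
  rw [hc, ← h'.2, profile, countLE_bot, Nat.add_zero, ← opt_eq_greedy hm] at h
  rwa [encState, initState, encNat_zero] at h

/-- The value `σ` represents the set `S`; the last global rebuilding has chosen the parameter `k`,
and `b` further updates are performed before the next one. -/
structure Stores (m : ℕ) (σ : Val) (S : Finset Ival) (k b : ℕ) (Bs : List Block) : Prop where
  fst_eq : σ.fst = unary b
  snd_eq : 0 < b → σ.snd = .pair (unary (2 ^ k)) (encBlocks Bs)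
  blocks_eq : σ.snd.snd = encBlocks Bs
  content_eq : content Bs = S.sort
  good : ∀ B ∈ Bs, GoodBlock m (digitBound m k) (2 ^ k) B
  le : b ≤ 4 ^ k
  length_le : Bs.length + b ≤ 2 * 4 ^ k
  card_le : S.card + b ≤ 8 ^ k + 4 ^ k
  le_card : 8 ^ k + 8 * b ≤ 8 * (S.card + 4 ^ k) + 1

/-- The empty content `nil` carries no parameters; with `b = 0` the first update is a rebuilding,
which does not read them. -/
theorem stores_nil (m : ℕ) : Stores m .nil ∅ 0 0 [] where
  fst_eq := rfl
  snd_eq h := absurd h (lt_irrefl 0)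
  blocks_eq := rfl
  content_eq := by simp
  good := by simp
  le := Nat.zero_le _
  length_le := by simp
  card_le := by simp
  le_card := by simp

/-- The steps that have been saved for the next global rebuilding. -/
def credit (m k b : ℕ) : ℕ := (4 ^ k - b) * (1152000 * digitBound m k ^ 3 * 4 ^ k)

theorem Update.card_apply_le {u : Update} {S : Finset Ival} (hu : u.Valid S) :
    (u.apply S).card ≤ S.card + 1 ∧ S.card ≤ (u.apply S).card + 1 := by
  classical
  cases u with
  | insert I =>
    have : (Update.apply (.insert I) S).card = S.card + 1 := Finset.card_insert_of_notMem hu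
    omega
  | delete I =>
    have h : (Update.apply (.delete I) S).card = S.card - 1 := Finset.card_erase_of_mem hu
    omega

theorem Update.ival_mem {u : Update} {S : Finset Ival} (hu : u.Valid S) (h : u.isInsert = false) :
    u.ival ∈ S := by
  cases u with
  | insert I => exact absurd h (by simp [Update.isInsert])
  | delete I => exact hu

/-- An update lowers `b` by one and changes the number of intervals by one and the number of blocks
by at most one upwards, so the inequalities of `Stores`, all stated relative to `b`, persist.
Recomputing a block costs about `(2 ^ k)² = 4 ^ k`, and so does passing the at most `2 * 4 ^ k`
blocks. -/
theorem Stores.update (hm : 0 < m) {σ : Val} {S : Finset Ival} {k b : ℕ} {Bs : List Block}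
    (h : Stores m σ S k (b + 1) Bs) {u : Update} (hu : u.Valid S) :
    ∃ σ' Bs', Stores m σ' (u.apply S) k b Bs' ∧
      Runs (schedulingProgram m) 0 (.pair (encUpdate u) σ)
        (.pair (encNat (opt m (u.apply S))) σ') (13000 * digitBound m k ^ 3 * 4 ^ k) := by
  obtain ⟨hfst, hsize, hblocks, hc, hB, hb, hlen, hcard, hle⟩ := h
  have hu' := u.card_apply_le hu
  obtain ⟨Bs', h1, h2, h3, h4⟩ := runs_walk (m := m) (by rw [digitBound]; omega)
    (Nat.one_le_pow _ _ (by norm_num)) (two_pow_add_one_le_digitBound k) u Bs hB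
    (by
      rw [hc]
      exact ((Finset.pairwise_sort S (· ≤ ·)).and (Finset.sort_nodup S (· ≤ ·))).imp
        fun h => lt_of_le_of_ne h.1 h.2)
    (fun h => by simpa [hc] using u.ival_mem hu h)
  rw [hc, updateList_sort hu] at h1
  refine ⟨.pair (unary b) (.pair (unary (2 ^ k)) (encBlocks Bs')), Bs',
    ⟨rfl, fun _ => rfl, rfl, h1, h2, by omega, by omega, by omega, by omega⟩, .of_wp ?_⟩
  have hsnd := hsize (Nat.succ_pos b)
  rw [body_main]
  simp only [Body.main, Wp, List.getD_cons_zero, List.getD_cons_succ, Val.snd_pair, Val.fst_pair,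
    hfst, hsnd, unary, Val.isPair_pair, true_implies, not_true, false_implies, and_true]
  refine ⟨_, _, h4, fun t1 ht1 => ⟨_, _, runs_init _, fun t2 ht2 =>
    ⟨_, _, runs_serve_opt hm h1 h2 (by omega), fun t3 ht3 => ⟨rfl, ?_⟩⟩⟩⟩
  have hD : m + 5 ≤ digitBound m k := by rw [digitBound]; omega
  set D := digitBound m k
  have e1 : (2 ^ k + 1) ^ 2 ≤ 4 * 4 ^ k := by
    have h5 : 1 ≤ 2 ^ k := Nat.one_le_pow _ _ (by norm_num)
    have h6 : 4 ^ k = (2 ^ k) ^ 2 := by rw [← pow_mul, mul_comm, pow_mul]; norm_num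
    rw [h6]
    nlinarith
  have e2 : 1 ≤ 4 ^ k := Nat.one_le_pow _ _ (by norm_num)
  have e3 : 25 * D ≤ D ^ 3 := by
    have : 5 * 5 ≤ D * D := Nat.mul_le_mul (by omega) (by omega)
    calc 25 * D ≤ D * D * D := Nat.mul_le_mul_right D this
      _ = D ^ 3 := by ring
  have f1 : 2200 * D * (2 ^ k + 1) ^ 2 ≤ 352 * (D ^ 3 * 4 ^ k) := by
    calc 2200 * D * (2 ^ k + 1) ^ 2 ≤ 2200 * D * (4 * 4 ^ k) := Nat.mul_le_mul_left _ e1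
      _ = 352 * (25 * D * 4 ^ k) := by ring
      _ ≤ 352 * (D ^ 3 * 4 ^ k) := by gcongr
  have f2 : 1100 * D ^ 3 * (Bs'.length + 1) ≤ 3300 * (D ^ 3 * 4 ^ k) := by
    calc 1100 * D ^ 3 * (Bs'.length + 1) ≤ 1100 * D ^ 3 * (3 * 4 ^ k) :=
          Nat.mul_le_mul_left _ (by omega)
      _ = 3300 * (D ^ 3 * 4 ^ k) := by ring
  have f3 : 25 * D * 4 ^ k ≤ D ^ 3 * 4 ^ k := Nat.mul_le_mul_right _ e3
  have f4 : D ≤ D * 4 ^ k := Nat.le_mul_of_pos_right _ e2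
  have f5 : 4 ^ k ≤ D * 4 ^ k := Nat.le_mul_of_pos_left _ (by omega)
  have f6 : 25 * D * 4 ^ k = 25 * (D * 4 ^ k) := by ring
  have f7 : 13000 * D ^ 3 * 4 ^ k = 13000 * (D ^ 3 * 4 ^ k) := by ring
  rw [f7]
  omega

/-- The new parameter is the number of octal digits of the size, so `8 ^ k'` matches the size up to
a constant. Up to `4 ^ k'` blocks at about `4 ^ k'` steps each give `16 ^ k'`. -/
theorem Stores.rebuild (hm : 0 < m) {σ : Val} {S : Finset Ival} {k : ℕ} {Bs : List Block}
    (h : Stores m σ S k 0 Bs) {u : Update} (hu : u.Valid S) :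
    ∃ σ' k' Bs', k' ≤ k + 1 ∧ Stores m σ' (u.apply S) k' (4 ^ k') Bs' ∧
      Runs (schedulingProgram m) 0 (.pair (encUpdate u) σ)
        (.pair (encNat (opt m (u.apply S))) σ') (9000 * digitBound m k' ^ 3 * 16 ^ k') := by
  obtain ⟨hfst, -, hblocks, hc, hB, -, -, hcard, -⟩ := h
  have hu' := u.card_apply_le hu
  set S' := u.apply S with hS'
  set k' := octLength S'.card with hk'
  have hlt : S'.card < 8 ^ k' := lt_pow_octLength _
  have hle : 8 ^ k' ≤ 8 * S'.card + 1 := pow_octLength_le _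
  have hkk : k' ≤ k + 1 := by
    refine octLength_le ?_
    have h1 : 4 ^ k ≤ 8 ^ k := Nat.pow_le_pow_left (by norm_num) k
    have h2 : 1 ≤ 8 ^ k := Nat.one_le_pow _ _ (by norm_num)
    rw [pow_succ]
    omega
  have p2 : 1 ≤ 2 ^ k' := Nat.one_le_pow _ _ (by norm_num)
  have p4 : 1 ≤ 4 ^ k' := Nat.one_le_pow _ _ (by norm_num)
  have hlu : (updateList u S.sort).length = S'.card := by
    rw [updateList_sort hu, Finset.length_sort]
  obtain ⟨Bs', h1, h2, h3, h4⟩ := runs_chunk (m := m) (D := digitBound m k')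
    (by rw [digitBound]; omega) p2 (two_pow_add_one_le_digitBound k') _ (updateList u S.sort) le_rfl
  -- Fewer than `8 ^ k'` intervals in blocks of size `2 ^ k'`.
  have hnb : Bs'.length ≤ 4 ^ k' := by
    rw [hlu] at h3
    by_contra! hn
    have h5 := Nat.mul_le_mul_right (2 ^ k') hn
    have h6 : (4 ^ k' + 1) * 2 ^ k' = 8 ^ k' + 2 ^ k' := by
      rw [add_mul, one_mul, ← mul_pow]; norm_num
    rw [Nat.succ_eq_add_one, h6] at h5
    omega
  have h1' : content Bs' = S'.sort := by rw [h1, updateList_sort hu]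
  have h5 := runs_params (m := m) encIval _ (updateList u S.sort) le_rfl
  rw [hlu, ← hk'] at h5
  have hfl := runs_flatten (m := m) Bs
  have hnb0 := length_le_length_content hB
  rw [hc] at hfl hnb0
  rw [Finset.length_sort] at hfl hnb0
  refine ⟨.pair (unary (4 ^ k')) (.pair (unary (2 ^ k')) (encBlocks Bs')), k', Bs', hkk,
    ⟨rfl, fun _ => rfl, rfl, h1', h2, le_rfl, by omega, by omega, by omega⟩, .of_wp ?_⟩
  rw [body_main]
  simp only [Body.main, Wp, List.getD_cons_zero, List.getD_cons_succ, Val.snd_pair, Val.fst_pair,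
    hfst, hblocks, unary, Val.isPair_nil, not_false_iff, true_implies, false_implies, true_and]
  refine ⟨_, _, hfl, fun t1 ht1 => ⟨_, _, runs_update u S.sort, fun t2 ht2 => ⟨_, _, h5,
    fun t3 ht3 => ⟨_, _, h4, fun t4 ht4 => ⟨_, _, runs_init _, fun t5 ht5 =>
    ⟨_, _, runs_serve_opt hm h1' h2 (by omega), fun t6 ht6 => ⟨rfl, ?_⟩⟩⟩⟩⟩⟩⟩
  rw [Finset.length_sort] at ht2
  have hD : m + 5 ≤ digitBound m k' := by rw [digitBound]; omega
  set D := digitBound m k'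
  have e1 : (2 ^ k' + 1) ^ 2 ≤ 4 * 4 ^ k' := by
    have h6 : 4 ^ k' = (2 ^ k') ^ 2 := by rw [← pow_mul, mul_comm, pow_mul]; norm_num
    rw [h6]
    nlinarith
  have e2 : 4 ^ k' * 4 ^ k' = 16 ^ k' := by rw [← mul_pow]; norm_num
  have e3 : 25 * D ≤ D ^ 3 := by
    have : 5 * 5 ≤ D * D := Nat.mul_le_mul (by omega) (by omega)
    calc 25 * D ≤ D * D * D := Nat.mul_le_mul_right D this
      _ = D ^ 3 := by ring
  have e4 : 8 ^ k' ≤ 16 ^ k' := Nat.pow_le_pow_left (by norm_num) k'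
  have e5 : 4 ^ k' ≤ 16 ^ k' := Nat.pow_le_pow_left (by norm_num) k'
  have f1 : 600 * D * (2 ^ k' + 1) ^ 2 * (Bs'.length + 1) ≤ 192 * (D ^ 3 * 16 ^ k') := by
    calc 600 * D * (2 ^ k' + 1) ^ 2 * (Bs'.length + 1)
        ≤ 600 * D * (4 * 4 ^ k') * (2 * 4 ^ k') := by
          gcongr
          omega
      _ = 192 * (25 * D * (4 ^ k' * 4 ^ k')) := by ring
      _ ≤ 192 * (D ^ 3 * 16 ^ k') := by rw [e2]; gcongr
  have f2 : 1100 * D ^ 3 * (Bs'.length + 1) ≤ 2200 * (D ^ 3 * 16 ^ k') := by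
    calc 1100 * D ^ 3 * (Bs'.length + 1) ≤ 1100 * D ^ 3 * (2 * 16 ^ k') :=
          Nat.mul_le_mul_left _ (by omega)
      _ = 2200 * (D ^ 3 * 16 ^ k') := by ring
  have f3 : 25 * D * 16 ^ k' ≤ D ^ 3 * 16 ^ k' := Nat.mul_le_mul_right _ e3
  have f4 : D ≤ D * 16 ^ k' := Nat.le_mul_of_pos_right _ (by omega)
  have f5 : 5 * 16 ^ k' ≤ D * 16 ^ k' := Nat.mul_le_mul_right _ (by omega)
  have f6 : 25 * D * 16 ^ k' = 25 * (D * 16 ^ k') := by ring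
  have f7 : 9000 * D ^ 3 * 16 ^ k' = 9000 * (D ^ 3 * 16 ^ k') := by ring
  rw [f7]
  omega

/-- An ordinary update pays its own cost and a deposit, `13000 + 1152000 = 1165000`. When `b` has
reached `0` there have been `4 ^ k` deposits, or the initial credit of the same amount, and the
rebuilding is paid from them. -/
theorem Stores.step (hm : 0 < m) {σ : Val} {S : Finset Ival} {k b : ℕ} {Bs : List Block}
    (h : Stores m σ S k b Bs) {u : Update} (hu : u.Valid S) :
    ∃ σ' k' b' Bs' T, Stores m σ' (u.apply S) k' b' Bs' ∧
      Computes (schedulingProgram m) (.pair (encUpdate u) σ)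
        (.pair (encNat (opt m (u.apply S))) σ') T ∧
      T + credit m k' b' ≤ 1165000 * (digitBound m k' ^ 3 * 4 ^ k') + credit m k b := by
  cases b with
  | succ b =>
    obtain ⟨σ', Bs', h', hr⟩ := h.update hm hu
    obtain ⟨T, hT, hr⟩ := hr.computes
    refine ⟨σ', k, b, Bs', T, h', hr, ?_⟩
    have e : 4 ^ k - b = 4 ^ k - (b + 1) + 1 := by have := h.le; omega
    have e' : 13000 * digitBound m k ^ 3 * 4 ^ k = 13000 * (digitBound m k ^ 3 * 4 ^ k) := by ring
    rw [credit, credit, e, add_mul, one_mul, mul_assoc 1152000]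
    omega
  | zero =>
    obtain ⟨σ', k', Bs', hk, h', hr⟩ := h.rebuild hm hu
    obtain ⟨T, hT, hr⟩ := hr.computes
    refine ⟨σ', k', 4 ^ k', Bs', T, h', hr, ?_⟩
    have hD : digitBound m k' ≤ 2 * digitBound m k := by
      rw [digitBound, digitBound]
      omega
    rw [credit, credit, Nat.sub_self, Nat.zero_mul, Nat.add_zero, Nat.sub_zero]
    refine hT.trans (le_trans ?_ (Nat.le_add_left _ _))
    -- As `k' ≤ k + 1`, the digit bound at most doubles and `16 ^ k'` grows at most by a factor
    -- `16`; the deposit comes from `9000 * 2³ * 16 = 1152000`.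
    calc 9000 * digitBound m k' ^ 3 * 16 ^ k'
        ≤ 9000 * (2 * digitBound m k) ^ 3 * 16 ^ (k + 1) := by
          gcongr
          norm_num
      _ = 4 ^ k * (1152000 * digitBound m k ^ 3 * 4 ^ k) := by
          rw [show 16 ^ (k + 1) = 16 * (4 ^ k * 4 ^ k) by rw [pow_succ, ← mul_pow]; ring]
          ring

/-- Deletions since the last rebuilding remove at most `4 ^ k` intervals. From `k = 4` on, `8 * 4 ^
k` is at most half of `8 ^ k`; below, `8 ^ 3 = 512` suffices. -/
theorem Stores.pow_le {σ : Val} {S : Finset Ival} {k b : ℕ} {Bs : List Block}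
    (h : Stores m σ S k b Bs) : 8 ^ k ≤ 512 * (S.card + 2) := by
  rcases Nat.lt_or_ge k 4 with hk | hk
  · have : 8 ^ k ≤ 8 ^ 3 := Nat.pow_le_pow_right (by norm_num) (by omega)
    omega
  · obtain ⟨j, rfl⟩ := Nat.exists_eq_add_of_le hk
    have h1 := h.le_card
    have h2 : 4 ^ j ≤ 8 ^ j := Nat.pow_le_pow_left (by norm_num) j
    rw [pow_add, pow_add] at h1
    rw [pow_add]
    omega

/-- The bound for the amortized time per update. -/
def amortizedBound (m n : ℕ) : ℝ :=
  ((n : ℝ) + 2) ^ (1 - 1 / (m : ℝ)) * Real.log ((n : ℝ) + 2) ^ 3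

theorem log_two_pow_le_amortizedBound (hm : 1 ≤ m) (n : ℕ) :
    Real.log 2 ^ 3 ≤ amortizedBound m n := by
  have h2 : (2 : ℝ) ≤ (n : ℝ) + 2 := by have : (0 : ℝ) ≤ n := n.cast_nonneg; linarith
  have hm' : (1 : ℝ) ≤ m := by exact_mod_cast hm
  have h3 : 0 ≤ 1 - 1 / (m : ℝ) := by
    rw [sub_nonneg, div_le_one (by linarith)]
    exact hm'
  have hlog : Real.log 2 ≤ Real.log ((n : ℝ) + 2) := Real.log_le_log (by norm_num) h2
  have h0 : 0 ≤ Real.log 2 := Real.log_nonneg (by norm_num)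
  rw [amortizedBound, ← one_mul (Real.log 2 ^ 3)]
  gcongr
  exact Real.one_le_rpow (by linarith) h3

/-- Here `4 ^ k = (8 ^ k)^(2/3)` and `64 = 512^(2/3)`; the exponent `2/3` is at most `1 - 1/m`
exactly because `m ≥ 3`. Taking logarithms, `3k ≤ 9 + log₂ (n + 2)`, so the digit bound is at most
`m + 14 + log₂ (n + 2)`, and `log₂ (n + 2) ≥ 1` absorbs the constant into `m + 15`. -/
theorem digitBound_mul_le (hm : 3 ≤ m) {n k : ℕ} (h : 8 ^ k ≤ 512 * (n + 2)) :
    (digitBound m k : ℝ) ^ 3 * 4 ^ k ≤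
      64 * (((m : ℝ) + 15) / Real.log 2) ^ 3 * amortizedBound m n := by
  have hn : (0 : ℝ) ≤ n := n.cast_nonneg
  set X : ℝ := (n : ℝ) + 2 with hX
  have h2 : (2 : ℝ) ≤ X := by linarith
  have hl2 : 0 < Real.log 2 := Real.log_pos (by norm_num)
  have hlog : Real.log 2 ≤ Real.log X := Real.log_le_log (by norm_num) h2
  have h8 : (8 : ℝ) ^ k ≤ 512 * X := by rw [hX]; exact_mod_cast h
  have hm' : (3 : ℝ) ≤ m := by exact_mod_cast hm
  have hD : (digitBound m k : ℝ) ≤ ((m : ℝ) + 15) / Real.log 2 * Real.log X := by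
    have h1 := Real.log_le_log (by positivity) h8
    rw [Real.log_mul (by norm_num) (by linarith), Real.log_pow,
      show (8 : ℝ) = 2 ^ 3 by norm_num, show (512 : ℝ) = 2 ^ 9 by norm_num, Real.log_pow,
      Real.log_pow] at h1
    push_cast at h1
    rw [div_mul_eq_mul_div, le_div_iff₀ hl2, digitBound]
    push_cast
    nlinarith
  have h4 : (4 : ℝ) ^ k ≤ 64 * X ^ (1 - 1 / (m : ℝ)) := by
    have hX0 : 0 ≤ X := by linarith
    have h1 : ((2 : ℝ) ^ k) ^ 3 ≤ (8 * X ^ (1 / 3 : ℝ)) ^ 3 := by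
      rw [mul_pow, ← Real.rpow_natCast (X ^ (1 / 3 : ℝ)), ← Real.rpow_mul hX0, ← pow_mul,
        mul_comm k, pow_mul]
      norm_num
      exact h8
    have h3 : (2 : ℝ) ^ k ≤ 8 * X ^ (1 / 3 : ℝ) :=
      le_of_pow_le_pow_left₀ (by norm_num) (by positivity) h1
    calc (4 : ℝ) ^ k = (2 ^ k) ^ 2 := by rw [← pow_mul, mul_comm, pow_mul]; norm_num
      _ ≤ (8 * X ^ (1 / 3 : ℝ)) ^ 2 := by gcongr
      _ = 64 * X ^ (2 / 3 : ℝ) := by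
        rw [mul_pow, ← Real.rpow_natCast (X ^ (1 / 3 : ℝ)), ← Real.rpow_mul hX0]
        norm_num
      _ ≤ 64 * X ^ (1 - 1 / (m : ℝ)) := by
        gcongr
        · linarith
        · have : 1 / (m : ℝ) ≤ 1 / 3 := one_div_le_one_div_of_le (by norm_num) hm'
          linarith
  calc (digitBound m k : ℝ) ^ 3 * 4 ^ k
      ≤ (((m : ℝ) + 15) / Real.log 2 * Real.log X) ^ 3 * (64 * X ^ (1 - 1 / (m : ℝ))) :=
        mul_le_mul (pow_le_pow_left₀ (Nat.cast_nonneg _) hD 3) h4 (by positivity)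
          (pow_nonneg ((Nat.cast_nonneg _).trans hD) 3)
    _ = 64 * (((m : ℝ) + 15) / Real.log 2) ^ 3 * amortizedBound m n := by
        rw [amortizedBound]
        ring

theorem exists_serves (hm : 3 ≤ m) (us : List Update) (S : Finset Ival) (hus : ValidSeq S us)
    {σ : Val} {k b : ℕ} {Bs : List Block} (h : Stores m σ S k b Bs) :
    ∃ T : ℕ, Serves (schedulingProgram m) σ us ((history S us).map fun S => encNat (opt m S)) T ∧
      (T : ℝ) ≤ 1165000 * (64 * (((m : ℝ) + 15) / Real.log 2) ^ 3) *
        ((history S us).map fun S => amortizedBound m S.card).sum + credit m k b := by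
  induction us generalizing S σ k b Bs with
  | nil => exact ⟨0, .nil, by simp [history]⟩
  | cons u us ih =>
    obtain ⟨σ', k', b', Bs', t, h', hr, ht⟩ := h.step (by omega) hus.1
    obtain ⟨T, h1, h2⟩ := ih _ hus.2 h'
    refine ⟨t + T, .cons hr h1, ?_⟩
    have h3 := digitBound_mul_le hm h'.pow_le
    have ht' : (t : ℝ) + credit m k' b' ≤
        1165000 * ((digitBound m k' : ℝ) ^ 3 * 4 ^ k') + credit m k b := by exact_mod_cast ht
    rw [history, List.map_cons, List.sum_cons]
    push_cast
    linarith

theorem exists_scheduling_program (m : ℕ) (hm : 3 ≤ m) :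
    ∃ (P : Program) (c : ℕ) (C : ℝ), ∀ us : List Update, ValidSeq ∅ us →
      ∃ T : ℕ, Serves P .nil us ((history ∅ us).map (fun S => encNat (opt m S))) T ∧
        (T : ℝ) ≤ C * ((history ∅ us).map (fun S =>
          ((S.card : ℝ) + 2) ^ (1 - 1 / (m : ℝ)) * Real.log ((S.card : ℝ) + 2) ^ c)).sum := by
  -- The empty structure starts with a positive credit. A nonempty sequence has at least one term,
  -- which is at least `log 2 ^ 3`, so the credit divided by this quantity can be added to the
  -- constant.
  refine ⟨schedulingProgram m, 3, 1165000 * (64 * (((m : ℝ) + 15) / Real.log 2) ^ 3) +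
    credit m 0 0 / Real.log 2 ^ 3, fun us hus => ?_⟩
  have hl2 : 0 < Real.log 2 := Real.log_pos (by norm_num)
  rcases eq_or_ne us [] with rfl | hne
  · exact ⟨0, .nil, by simp [history]⟩
  · obtain ⟨T, h1, h2⟩ := exists_serves hm us ∅ hus (stores_nil m)
    refine ⟨T, h1, ?_⟩
    change (T : ℝ) ≤ _ * ((history ∅ us).map fun S => amortizedBound m S.card).sum
    have h3 : Real.log 2 ^ 3 ≤ ((history ∅ us).map fun S => amortizedBound m S.card).sum := by
      obtain ⟨u, us, rfl⟩ := List.exists_cons_of_ne_nil hne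
      rw [history, List.map_cons, List.sum_cons]
      refine le_add_of_le_of_nonneg (log_two_pow_le_amortizedBound (by omega) _)
        (List.sum_nonneg fun x hx => ?_)
      obtain ⟨S, -, rfl⟩ := List.mem_map.1 hx
      exact (pow_pos hl2 3).le.trans (log_two_pow_le_amortizedBound (by omega) _)
    rw [add_mul, div_mul_eq_mul_div]
    refine h2.trans (add_le_add_right ?_ _)
    rw [le_div_iff₀ (pow_pos hl2 3)]
    exact mul_le_mul_of_nonneg_left h3 (Nat.cast_nonneg _)

end DIS

end

theorem mainTheorem4 :
    -- number of compressible greedy states of a part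
    (∀ m : ℕ, 3 ≤ m → ∃ C : ℕ, ∀ S : Finset DIS.Ival, DIS.DistinctEndpoints S →
      {G : Multiset DIS.Slot | DIS.IsGreedyState m S G ∧ DIS.Compressible S G}.encard
        ≤ ((C * S.card ^ (m - 1) : ℕ) : ℕ∞)) ∧
    -- computation of the first machine replacement for all pairs
    (∃ (P : DIS.Program) (c : ℕ) (C : ℝ), ∀ l : List DIS.Ival, l.Nodup →
      DIS.DistinctEndpoints l.toFinset →
      ∃ (table : List (DIS.Ival × DIS.Ival × Option DIS.Ival)) (T : ℕ),
        DIS.Computes P (DIS.encList DIS.encIval l) (DIS.encList DIS.encEntry table) T ∧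
        table.Nodup ∧
        (∀ (I J : DIS.Ival) (R : Option DIS.Ival), (I, J, R) ∈ table ↔
          I ∈ l ∧ J ∈ l ∧ I < J ∧ R = DIS.FMR l.toFinset (.busy I) (.busy J)) ∧
        (T : ℝ) ≤ C * ((l.length : ℝ) + 2) ^ 2 * Real.log ((l.length : ℝ) + 2) ^ c) ∧
    -- the dynamic data structure
    (∀ m : ℕ, 3 ≤ m → ∃ (P : DIS.Program) (c : ℕ) (C : ℝ), ∀ us : List DIS.Update,
      DIS.ValidSeq ∅ us →
      ∃ T : ℕ,
        DIS.Serves P .nil us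
          ((DIS.history ∅ us).map (fun S => DIS.encNat (DIS.opt m S))) T ∧
        (T : ℝ) ≤ C * ((DIS.history ∅ us).map (fun S =>
          ((S.card : ℝ) + 2) ^ (1 - 1 / (m : ℝ)) * Real.log ((S.card : ℝ) + 2) ^ c)).sum) := by
  exact ⟨DIS.encard_compressible_le, DIS.exists_fmr_program, DIS.exists_scheduling_program⟩
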